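/- All graphs are simple and finite. The cube (third power) $P_3(T)$ of a graph $T$ is the graph on the vertex set of $T$ in which two distinct vertices are adjacent if and only if their distance in $T$ is at most $3$. The deck of a graph $G$ is the multiset of the isomorphism classes of its vertex-deleted subgraphs $G-v$, one for each vertex $v$ of $G$. Let $\mathbb{C}$ be the class of all graphs that are isomorphic to $P_3(T)$ for some tree $T$. Lemma 4.1. The class $\mathbb{C}$ is weakly reconstructible, that is, no two non-isomorphic members of $\mathbb{C}$ have the same deck: if $G,H\in\mathbb{C}$ have the same deck, then $G\cong H$. -/

import Mathlib

universe u

namespace SimpleGraph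

/-- The `k`-th power of a graph `G`: it has the same vertices, and two distinct vertices are
adjacent if and only if their distance in `G` is at most `k` (the extended distance is used, so
that vertices in different components are at distance `⊤`). -/
def kthPower {V : Type u} (G : SimpleGraph V) (k : ℕ) : SimpleGraph V where
  Adj x y := x ≠ y ∧ G.edist x y ≤ (k : ℕ∞)
  symm := ⟨fun x y h => ⟨h.1.symm, by rw [edist_comm]; exact h.2⟩⟩
  loopless := ⟨fun _ h => h.1 rfl⟩

/-- `G` is isomorphic to the third power (cube) of some tree. -/
def IsTreeCube {V : Type u} (G : SimpleGraph V) : Prop :=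
  ∃ (U : Type u) (T : SimpleGraph U), T.IsTree ∧ Nonempty (G ≃g T.kthPower 3)

/-- Graph isomorphism, as an equivalence relation on all graphs. -/
def isoSetoid : Setoid (Σ V : Type u, SimpleGraph V) where
  r A B := Nonempty (A.2 ≃g B.2)
  iseqv :=
    ⟨fun _ => ⟨RelIso.refl _⟩, fun ⟨e⟩ => ⟨e.symm⟩, fun ⟨e⟩ ⟨f⟩ => ⟨e.trans f⟩⟩

/-- An unlabelled graph is an isomorphism class of graphs. -/
def Unlabelled : Type (u + 1) := Quotient isoSetoid.{u}

/-- The unlabelled graph underlying a graph. -/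
def unlabel {V : Type u} (G : SimpleGraph V) : Unlabelled.{u} :=
  Quotient.mk isoSetoid ⟨V, G⟩

/-- The card of `G` at `v`: the unlabelled graph obtained from `G` by deleting the vertex `v`
together with its incident edges. -/
def card {V : Type u} (G : SimpleGraph V) (v : V) : Unlabelled.{u} :=
  unlabel (G.induce ({v}ᶜ : Set V))

/-- The deck of a finite graph: the multiset of its cards, one for each vertex. -/
def deck {V : Type u} [Fintype V] (G : SimpleGraph V) : Multiset Unlabelled.{u} :=
  (Finset.univ : Finset V).val.map G.card

/-- A class `C` of graphs is weakly reconstructible if no two non-isomorphic finite members of `C`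
have the same deck. -/
def IsWeaklyReconstructible (C : ∀ V : Type u, SimpleGraph V → Prop) : Prop :=
  ∀ (V W : Type u) [Fintype V] [Fintype W] (G : SimpleGraph V) (H : SimpleGraph W),
    C V G → C W H → G.deck = H.deck → Nonempty (G ≃g H)

end SimpleGraph

/-! ### Codes of rooted trees -/

namespace TreeCode

/-! Suppose that the tree T has two vertices at distance at least 4. Call a leaf deep if its
neighbour has at most one neighbour that is not a leaf. The ball of radius 3 around a deep leaf is a
union of two balls of radius 1 with adjacent centres, and the deep leaves are exactly the simplicial
vertices of the cube (`IsTree.isSimplicialVertex_iff`). Kelly's counting recovers the degree and the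
number of triangles at each deleted vertex, so matched cards match deep leaves with deep leaves.
Deleting a leaf commutes with taking the cube, and a tree whose cube is not complete is determined
by it up to isomorphism (`IsTree.nonempty_iso_of_kthPower_eq`); hence the card at a deep leaf x
yields T - x. Small orders and complete cards are settled directly.

It remains to rebuild T from the trees T - x with x deep (`nonempty_iso_of_induce_iso`). Fix one
such x and place both trees T, S on one vertex set so that they differ only in where x is attached:
at z 0 in T and at z m in S, joined by a path z 0, ..., z m. Let P_j be the branch of S at z j away
from z (j+1), and Q_j the branch of T at z (m-j) away from z (m-j-1). If P_j = Q_j up to the middle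
of the path, reversing the path gives an isomorphism.

The equality is proved by induction on j. Let s be the smaller of the sizes of P_j and Q_j. If the
earlier pairs agree, then T and S have the same branches of size at most s over all directed edges,
up to an extra P_j in S and an extra Q_j in T (`LeafMove.dartSum_add_eq`). Counting the branches of
size s - 1 in all deletions of deep leaves (`sum_codeCount_deleteIncidenceSet`) shows that the
branches of size s in T and in S have the same total deck of deletions. So P_j and Q_j have the same
deck, and a rooted tree is determined by its size and this deck if each deleted leaf is labelled by
whether it was an only child (`eq_of_leafDeck_eq`). The labels are recoverable: deleting a leaf
lowers the number of leaves by one, or by none if the label is true, and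
`codeCount_pt_le_of_deletions` shows that T and S have equally many leaves. -/

/-- The code of the rooted tree whose root has branches with the codes in `M`. -/
def node : Multiset ℕ ≃ ℕ := Denumerable.eqv (Multiset ℕ)

/-- The multiset of codes of the branches at the root. -/
def kids (c : ℕ) : Multiset ℕ := node.symm c

@[simp] theorem kids_node (M : Multiset ℕ) : kids (node M) = M := node.symm_apply_apply M

@[simp] theorem node_kids (c : ℕ) : node (kids c) = c := node.apply_symm_apply c

/-- `Denumerable.raise` forms partial sums, and the code of a list exceeds the sum of its head and
the code of its tail. Consequently a branch has a smaller code than the tree, which makes recursion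
on codes well founded. -/
theorem lt_of_mem_raise {a : ℕ} : ∀ (l : List ℕ) (n : ℕ), a ∈ Denumerable.raise l n →
    a < n + Encodable.encode l
  | [], n, h => by simp [Denumerable.raise] at h
  | m :: l, n, h => by
    have h2 := Nat.add_le_pair m (Encodable.encode l)
    simp only [Denumerable.raise, List.mem_cons, Encodable.encode_list_cons, Encodable.encode_nat,
      Nat.succ_eq_add_one] at h ⊢
    rcases h with rfl | h
    · omega
    · have h1 := lt_of_mem_raise l (m + n) h
      omega

theorem lt_of_mem_kids {a c : ℕ} (h : a ∈ kids c) : a < c := by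
  have h' : a ∈ Multiset.map (Denumerable.ofNat ℕ)
      (Denumerable.raise (Denumerable.ofNat (List ℕ) c) 0 : List ℕ) := h
  simp only [Multiset.map_coe, Multiset.mem_coe, List.mem_map, Denumerable.ofNat_nat,
    exists_eq_right] at h'
  simpa using lt_of_mem_raise _ _ h'

theorem lt_node {a : ℕ} {M : Multiset ℕ} (h : a ∈ M) : a < node M :=
  lt_of_mem_kids (by simpa using h)

/-- The number of vertices of the rooted tree with code `c`. -/
def size (c : ℕ) : ℕ := 1 + ((kids c).attach.map fun a => size a.1).sum
termination_by c
decreasing_by exact lt_of_mem_kids a.2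

theorem size_node (M : Multiset ℕ) : size (node M) = 1 + (M.map size).sum := by
  rw [size, Multiset.attach_map_val' _ size, kids_node]

theorem size_lt_of_mem {a : ℕ} {M : Multiset ℕ} (h : a ∈ M) : size a < size (node M) := by
  rw [size_node, ← Multiset.cons_erase h]
  simp
  omega

/-- The code of the one-vertex tree. -/
def pt : ℕ := node 0

theorem one_le_size (c : ℕ) : 1 ≤ size c := by rw [size]; omega

theorem card_le_sum_size (M : Multiset ℕ) : M.card ≤ (M.map size).sum := by
  induction M using Multiset.induction with
  | empty => simp
  | cons a M ih => have := one_le_size a; simp; omega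

@[simp] theorem size_pt : size pt = 1 := by simp [pt, size_node]

theorem size_eq_one {c : ℕ} : size c = 1 ↔ c = pt := by
  constructor
  · intro h
    rw [← node_kids c, size_node] at h
    have h1 := card_le_sum_size (kids c)
    have h2 : kids c = 0 := by rw [← Multiset.card_eq_zero]; omega
    rw [← node_kids c, h2, pt]
  · rintro rfl; simp

theorem two_le_size {c : ℕ} (h : c ≠ pt) : 2 ≤ size c := by
  have := one_le_size c
  have := mt size_eq_one.1 h
  omega

theorem sum_size_eq_card {M : Multiset ℕ} : (M.map size).sum = M.card ↔ ∀ a ∈ M, a = pt := by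
  induction M using Multiset.induction with
  | empty => simp
  | cons a M ih =>
    have h1 := one_le_size a
    have h2 := card_le_sum_size M
    simp only [Multiset.map_cons, Multiset.sum_cons, Multiset.card_cons, Multiset.mem_cons,
      forall_eq_or_imp, ← size_eq_one] at ih ⊢
    rw [← ih]
    omega

/-- The code of the rooted tree with two vertices. -/
def edge : ℕ := node {pt}

@[simp] theorem size_edge : size edge = 2 := by simp [edge, size_node]

theorem pt_ne_edge : pt ≠ edge := fun h => by simpa using congrArg size h

theorem size_eq_two {c : ℕ} : size c = 2 ↔ c = edge := by
  constructor
  · intro h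
    rw [← node_kids c, size_node] at h
    have h1 := card_le_sum_size (kids c)
    have h3 : kids c ≠ 0 := by rintro h0; simp [h0] at h
    have h2 : (kids c).card = 1 := by
      have := mt Multiset.card_eq_zero.1 h3
      omega
    obtain ⟨a, ha⟩ := Multiset.card_eq_one.1 h2
    rw [ha] at h
    have : a = pt := size_eq_one.1 (by simp at h; omega)
    rw [← node_kids c, ha, this, edge]
  · rintro rfl; simp

/-! ### Labelled leaf decks of rooted trees. -/

/-- The codes obtained by deleting a leaf all of whose siblings are leaves; the label tells whether
the leaf was an only child. -/
def leafDeck (c : ℕ) : Multiset (ℕ × Bool) :=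
  if ∀ a ∈ kids c, a = pt then
    (kids c).map fun a => (node ((kids c).erase a), decide ((kids c).card = 1))
  else
    (kids c).attach.bind fun a =>
      (leafDeck a.1).map fun p => (node (p.1 ::ₘ (kids c).erase a.1), p.2)
termination_by c
decreasing_by exact lt_of_mem_kids a.2

/-- The multisets of branches obtained by deleting a leaf from one of the branches. -/
def branchDeck (M : Multiset ℕ) : Multiset (Multiset ℕ × Bool) :=
  M.bind fun a => (leafDeck a).map fun p => (p.1 ::ₘ M.erase a, p.2)

theorem leafDeck_node_of_forall {M : Multiset ℕ} (h : ∀ a ∈ M, a = pt) :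
    leafDeck (node M) = M.map fun a => (node (M.erase a), decide (M.card = 1)) := by
  rw [leafDeck, if_pos (by simpa using h), kids_node]

theorem leafDeck_node_of_not_forall {M : Multiset ℕ} (h : ¬ ∀ a ∈ M, a = pt) :
    leafDeck (node M) = (branchDeck M).map (Prod.map node id) := by
  rw [leafDeck, if_neg (by simpa using h), branchDeck, Multiset.map_bind]
  have := Multiset.attach_bind_coe (kids (node M))
    (fun a => (leafDeck a).map fun p => (node (p.1 ::ₘ (kids (node M)).erase a), p.2))
  rw [this, kids_node]
  congr 1
  ext1 a
  rw [Multiset.map_map]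
  rfl

@[simp] theorem leafDeck_pt : leafDeck pt = 0 := by
  rw [pt, leafDeck_node_of_forall (by simp)]; simp

@[simp] theorem leafDeck_edge : leafDeck edge = {(pt, true)} := by
  rw [edge, leafDeck_node_of_forall (by simp)]; simp [pt]

/-- Descending into nontrivial branches for as long as there are any ends at a vertex all of whose
children are leaves. -/
theorem leafDeck_ne_zero {c : ℕ} (h : c ≠ pt) : leafDeck c ≠ 0 := by
  induction c using Nat.strong_induction_on with
  | _ c ih =>
    obtain ⟨M, rfl⟩ := node.surjective c
    by_cases hM : ∀ a ∈ M, a = pt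
    · rw [leafDeck_node_of_forall hM]
      intro h0
      rw [Multiset.map_eq_zero] at h0
      exact h (by rw [h0, pt])
    · rw [leafDeck_node_of_not_forall hM]
      push Not at hM
      obtain ⟨a, ha, ha'⟩ := hM
      obtain ⟨p, hp⟩ := Multiset.exists_mem_of_ne_zero (ih a (lt_node ha) ha')
      intro h0
      rw [Multiset.map_eq_zero] at h0
      have : (p.1 ::ₘ M.erase a, p.2) ∈ branchDeck M :=
        Multiset.mem_bind.2 ⟨a, ha, Multiset.mem_map.2 ⟨p, hp, rfl⟩⟩
      simp [h0] at this

theorem size_of_mem_leafDeck {c : ℕ} {p : ℕ × Bool} (h : p ∈ leafDeck c) :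
    size p.1 + 1 = size c := by
  induction c using Nat.strong_induction_on generalizing p with
  | _ c ih =>
    obtain ⟨M, rfl⟩ := node.surjective c
    by_cases hM : ∀ a ∈ M, a = pt
    · rw [leafDeck_node_of_forall hM, Multiset.mem_map] at h
      obtain ⟨a, ha, rfl⟩ := h
      have := hM a ha
      subst this
      conv_rhs => rw [← Multiset.cons_erase ha]
      simp [size_node]; omega
    · rw [leafDeck_node_of_not_forall hM, Multiset.mem_map] at h
      obtain ⟨q, hq, rfl⟩ := h
      obtain ⟨a, ha, hq⟩ := Multiset.mem_bind.1 hq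
      obtain ⟨p, hp, rfl⟩ := Multiset.mem_map.1 hq
      have := ih a (lt_node ha) hp
      conv_rhs => rw [← Multiset.cons_erase ha]
      simp [size_node]; omega

theorem card_branchDeck (M : Multiset ℕ) :
    (branchDeck M).card = (M.map fun a => (leafDeck a).card).sum := by
  simp [branchDeck, Multiset.card_bind]

theorem card_of_mem_branchDeck {M : Multiset ℕ} {X : Multiset ℕ × Bool} (h : X ∈ branchDeck M) :
    X.1.card = M.card := by
  obtain ⟨a, ha, hX⟩ := Multiset.mem_bind.1 h
  obtain ⟨p, hp, rfl⟩ := Multiset.mem_map.1 hX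
  conv_rhs => rw [← Multiset.cons_erase ha]
  simp

/-- Double counting of the copies of `b` in the cards. A deletion in the branch `a` keeps the copies
among the other branches, loses one if `a = b`, and gains one if `a` shrinks to `b`. The lost copies
stand on the left to avoid subtraction. -/
theorem sum_count_branchDeck (M : Multiset ℕ) (b : ℕ) :
    ((branchDeck M).map fun X => X.1.count b).sum + M.count b * (leafDeck b).card =
      (branchDeck M).card * M.count b +
        (M.map fun a => ((leafDeck a).map Prod.fst).count b).sum := by
  have h1 : M.count b * (leafDeck b).card =
      (M.map fun a => if a = b then (leafDeck a).card else 0).sum := by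
    induction M using Multiset.induction with
    | empty => simp
    | cons a M ih =>
      rw [Multiset.map_cons, Multiset.sum_cons, ← ih, Multiset.count_cons]
      by_cases h : a = b
      · subst h; simp; ring
      · simp [h, Ne.symm h]
  rw [h1, card_branchDeck, branchDeck, Multiset.map_bind, Multiset.sum_bind,
    ← Multiset.sum_map_mul_right, ← Multiset.sum_map_add, ← Multiset.sum_map_add]
  congr 1
  apply Multiset.map_congr rfl
  intro a ha
  have h2 : M.count b = (M.erase a).count b + if a = b then 1 else 0 := by
    conv_lhs => rw [← Multiset.cons_erase ha]
    rw [Multiset.count_cons]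
    simp [eq_comm]
  rw [h2]
  induction leafDeck a using Multiset.induction with
  | empty => simp
  | cons p D ih =>
    simp only [Multiset.map_cons, Multiset.sum_cons, Multiset.card_cons, Multiset.count_cons,
      Multiset.map_map, Function.comp_def] at ih ⊢
    by_cases h : a = b
    · simp only [h, if_true] at ih ⊢
      linarith
    · simp only [h, if_false] at ih ⊢
      linarith

theorem branchDeck_replicate (b r : ℕ) :
    branchDeck (b ::ₘ Multiset.replicate r pt) =
      (leafDeck b).map fun p => (p.1 ::ₘ Multiset.replicate r pt, p.2) := by
  rw [branchDeck, Multiset.cons_bind, Multiset.erase_cons_head, add_eq_left]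
  rw [Multiset.bind]
  apply Multiset.eq_zero_of_forall_notMem
  intro x hx
  obtain ⟨D, hD, hxD⟩ := Multiset.mem_join.1 hx
  obtain ⟨a, ha, rfl⟩ := Multiset.mem_map.1 hD
  rw [Multiset.eq_of_mem_replicate ha] at hxD
  simp at hxD

/-- Here the labels matter: both deletions of the cherry give `edge`, but with label `false`, while
the rooted path has only one deletion. -/
theorem leafDeck_ne_of_size_eq_three {b : ℕ} (hb : size b = 3) :
    leafDeck b ≠ Multiset.replicate 2 (edge, true) := by
  obtain ⟨M, rfl⟩ := node.surjective b
  rw [size_node] at hb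
  by_cases hM : ∀ a ∈ M, a = pt
  · have h1 := sum_size_eq_card.2 hM
    have h2 : M = Multiset.replicate 2 pt := Multiset.eq_replicate.2 ⟨by omega, hM⟩
    intro h
    have h3 : (edge, true) ∈ leafDeck (node M) := by rw [h]; simp
    rw [leafDeck_node_of_forall hM, Multiset.mem_map] at h3
    obtain ⟨a, -, h3⟩ := h3
    rw [h2] at h3
    simp at h3
  · intro h
    have h4 := congrArg Multiset.card h
    rw [leafDeck_node_of_not_forall hM, Multiset.card_map, card_branchDeck] at h4
    push Not at hM
    obtain ⟨a, ha, ha'⟩ := hM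
    obtain ⟨N, rfl⟩ := Multiset.exists_cons_of_mem ha
    have h1 := two_le_size ha'
    have h2 := card_le_sum_size N
    simp only [Multiset.map_cons, Multiset.sum_cons] at hb
    have h3 : N = 0 := by rw [← Multiset.card_eq_zero]; omega
    subst h3
    have : a = edge := size_eq_two.1 (by simp at hb; omega)
    subst this
    simp at h4

theorem branchDeck_ne_zero {M : Multiset ℕ} (h : ¬ ∀ a ∈ M, a = pt) : branchDeck M ≠ 0 := by
  intro h0
  have h1 : leafDeck (node M) = 0 := by rw [leafDeck_node_of_not_forall h, h0]; rfl
  refine leafDeck_ne_zero ?_ h1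
  intro h2
  have : M = 0 := node.injective h2
  exact h (by simp [this])

/-- The top-down step: if two multisets of branches with the same deck differ in the multiplicity
of `b` but agree above the size of `b`, then `b` carries the whole deck. -/
theorem card_branchDeck_eq_of_count_ne {M M' : Multiset ℕ} (hF : branchDeck M = branchDeck M')
    {b : ℕ} (hb : M.count b ≠ M'.count b)
    (hmax : ∀ c, size b < size c → M.count c = M'.count c) :
    (branchDeck M).card = (leafDeck b).card := by
  -- Only a branch larger than `b` can shrink to `b`, and the two multisets agree there. Subtracting
  -- the two double counts then leaves a product equal to zero.
  have key : ∀ N : Multiset ℕ, (N.map fun a => ((leafDeck a).map Prod.fst).count b).sum =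
      ((N.filter fun a => size b < size a).map
        fun a => ((leafDeck a).map Prod.fst).count b).sum := by
    intro N
    conv_lhs => rw [← Multiset.filter_add_not (fun a => size b < size a) N]
    rw [Multiset.map_add, Multiset.sum_add, add_eq_left]
    apply Multiset.sum_eq_zero
    intro x hx
    obtain ⟨a, ha, rfl⟩ := Multiset.mem_map.1 hx
    rw [Multiset.count_eq_zero]
    intro hc
    obtain ⟨p, hp, rfl⟩ := Multiset.mem_map.1 hc
    have := size_of_mem_leafDeck hp
    have := (Multiset.mem_filter.1 ha).2
    omega
  have hfil : (M.filter fun a => size b < size a) = (M'.filter fun a => size b < size a) := by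
    ext c
    by_cases hc : size b < size c
    · simp only [Multiset.count_filter, hc, if_true, hmax c hc]
    · simp only [Multiset.count_filter, hc, if_false]
  have h1 := sum_count_branchDeck M b
  have h2 := sum_count_branchDeck M' b
  rw [key, hfil, ← key] at h1
  rw [← hF] at h2
  zify at h1 h2 hb ⊢
  have h3 : ((M.count b : ℤ) - M'.count b) * ((branchDeck M).card - (leafDeck b).card) = 0 := by
    linarith
  rcases mul_eq_zero.1 h3 with h | h
  · exact absurd (by linarith) hb
  · linarith

/-- No deletion is left for the branches other than `b`, and only the one-vertex tree has an empty
deck. -/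
theorem eq_cons_replicate {M : Multiset ℕ} {b : ℕ} (hb : b ∈ M)
    (h : (branchDeck M).card = (leafDeck b).card) :
    M = b ::ₘ Multiset.replicate (M.card - 1) pt := by
  obtain ⟨N, rfl⟩ := Multiset.exists_cons_of_mem hb
  rw [card_branchDeck, Multiset.map_cons, Multiset.sum_cons, add_eq_left,
    Multiset.sum_eq_zero_iff] at h
  congr 1
  refine Multiset.eq_replicate.2 ⟨by simp, fun a ha => ?_⟩
  by_contra hne
  exact leafDeck_ne_zero hne (Multiset.card_eq_zero.1 (h _ (Multiset.mem_map.2 ⟨a, ha, rfl⟩)))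

/-- By the top-down step `M` is `b` together with points, so every card of `M'` has at most one
nontrivial branch. If `M'` has one nontrivial branch, the induction hypothesis identifies it with
`b`. If it has two, every deletion must reduce one of them to a point, so `M'` is two copies of
`edge` together with points, and the labels exclude this. -/
theorem branchDeck_ne_of_count_lt {M M' : Multiset ℕ} (hM' : ¬ ∀ a ∈ M', a = pt)
    (hsum : (M.map size).sum = (M'.map size).sum)
    (ih : ∀ a ∈ M, ∀ a', size a = size a' → leafDeck a = leafDeck a' → a = a')
    (hF : branchDeck M = branchDeck M') {b : ℕ} (hb : M'.count b < M.count b)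
    (hmax : ∀ c, size b < size c → M.count c = M'.count c) : False := by
  have hcard := card_branchDeck_eq_of_count_ne hF hb.ne' hmax
  have hbM : b ∈ M := Multiset.count_pos.1 (by omega)
  have hMeq := eq_cons_replicate hbM hcard
  have hne' := branchDeck_ne_zero hM'
  have hMM : M.card = M'.card := by
    obtain ⟨X, hX⟩ := Multiset.exists_mem_of_ne_zero hne'
    rw [← card_of_mem_branchDeck hX]
    rw [← hF] at hX
    rw [card_of_mem_branchDeck hX]
  have hbpt : b ≠ pt := by
    rintro rfl
    rw [hF] at hcard
    simp at hcard
    exact hne' hcard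
  have hbM' : b ∉ M' := by
    intro h
    have := eq_cons_replicate h (by rw [← hF, hcard])
    rw [hMeq, this, hMM] at hb
    exact lt_irrefl _ hb
  set r := M.card - 1 with hr
  have hFM := branchDeck_replicate b r
  rw [← hMeq, hF] at hFM
  push Not at hM'
  obtain ⟨c₁, hc₁, hc₁'⟩ := hM'
  have hF' : ∀ p ∈ leafDeck c₁, ∃ q ∈ leafDeck b,
      q.1 ::ₘ Multiset.replicate r pt = p.1 ::ₘ M'.erase c₁ ∧ q.2 = p.2 := by
    intro p hp
    have : (p.1 ::ₘ M'.erase c₁, p.2) ∈ branchDeck M' :=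
      Multiset.mem_bind.2 ⟨c₁, hc₁, Multiset.mem_map.2 ⟨p, hp, rfl⟩⟩
    rw [hFM, Multiset.mem_map] at this
    obtain ⟨q, hq, hq'⟩ := this
    rw [Prod.ext_iff] at hq'
    exact ⟨q, hq, hq'⟩
  by_cases hrest : ∀ a ∈ M'.erase c₁, a = pt
  · have h1 : M' = c₁ ::ₘ Multiset.replicate r pt := by
      conv_lhs => rw [← Multiset.cons_erase hc₁]
      congr 1
      refine Multiset.eq_replicate.2 ⟨?_, hrest⟩
      rw [Multiset.card_erase_of_mem hc₁, hr, hMM]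
      rfl
    have h2 := branchDeck_replicate c₁ r
    rw [← h1, hFM] at h2
    have hinj : Function.Injective
        (fun p : ℕ × Bool => (p.1 ::ₘ Multiset.replicate r pt, p.2)) := by
      intro p q h
      simp only [Prod.mk.injEq, Multiset.cons_inj_left] at h
      exact Prod.ext h.1 h.2
    have h3 := Multiset.map_injective hinj h2
    have h4 : size b = size c₁ := by
      rw [hMeq, h1] at hsum
      simp at hsum
      omega
    exact hbM' (ih b hbM c₁ h4 h3 ▸ hc₁)
  · push Not at hrest
    obtain ⟨c₂, hc₂, hc₂'⟩ := hrest
    -- A nontrivial branch `d` survives a deletion in `c`. The card has room for one nontrivial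
    -- branch only, so `c` has shrunk to a point.
    have key : ∀ c d, d ≠ pt → d ∈ M'.erase c → ∀ p ∈ leafDeck c, ∀ q : ℕ × Bool,
        q.1 ::ₘ Multiset.replicate r pt = p.1 ::ₘ M'.erase c → c = edge ∧
          (M'.erase c).erase d = Multiset.replicate (r - 1) pt := by
      intro c d hd hdc p hp q hq
      have h1 : d = q.1 := by
        have : d ∈ q.1 ::ₘ Multiset.replicate r pt := hq ▸ Multiset.mem_cons_of_mem hdc
        rcases Multiset.mem_cons.1 this with h | h
        · exact h
        · exact absurd (Multiset.eq_of_mem_replicate h) hd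
      rw [← h1, ← Multiset.cons_erase hdc, Multiset.cons_swap, Multiset.cons_inj_right] at hq
      have h2 : p.1 = pt := by
        have : p.1 ∈ Multiset.replicate r pt := hq ▸ Multiset.mem_cons_self _ _
        exact Multiset.eq_of_mem_replicate this
      have h3 := size_of_mem_leafDeck hp
      rw [h2, size_pt] at h3
      refine ⟨size_eq_two.1 h3.symm, ?_⟩
      refine Multiset.eq_replicate.2 ⟨?_, fun a ha => ?_⟩
      · have := congrArg Multiset.card hq
        simp only [Multiset.card_replicate, Multiset.card_cons] at this
        omega
      · have : a ∈ Multiset.replicate r pt := hq ▸ Multiset.mem_cons_of_mem ha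
        exact Multiset.eq_of_mem_replicate this
    obtain ⟨p, hp⟩ := Multiset.exists_mem_of_ne_zero (leafDeck_ne_zero hc₁')
    obtain ⟨q, hq, hqp, -⟩ := hF' p hp
    obtain ⟨rfl, hrep⟩ := key c₁ c₂ hc₂' hc₂ p hp q hqp
    have hM'eq : M' = edge ::ₘ c₂ ::ₘ Multiset.replicate (r - 1) pt := by
      rw [← hrep, Multiset.cons_erase hc₂, Multiset.cons_erase hc₁]
    have hc₂e : c₂ = edge := by
      obtain ⟨p, hp⟩ := Multiset.exists_mem_of_ne_zero (leafDeck_ne_zero hc₂')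
      have hc₂M : c₂ ∈ M' := Multiset.mem_of_mem_erase hc₂
      have : (p.1 ::ₘ M'.erase c₂, p.2) ∈ branchDeck M' :=
        Multiset.mem_bind.2 ⟨c₂, hc₂M, Multiset.mem_map.2 ⟨p, hp, rfl⟩⟩
      rw [hFM, Multiset.mem_map] at this
      obtain ⟨q, hq, hq'⟩ := this
      rw [Prod.ext_iff] at hq'
      refine (key c₂ edge pt_ne_edge.symm ?_ p hp q hq'.1).1
      rw [hM'eq, Multiset.cons_swap, Multiset.erase_cons_head]
      simp
    subst hc₂e
    have hrpos : 1 ≤ r := by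
      rw [hMM] at hr
      rw [hM'eq] at hr
      simp at hr
      omega
    have hB3 : size b = 3 := by
      rw [hMeq, hM'eq] at hsum
      simp at hsum
      omega
    have hFM2 : branchDeck M' = Multiset.replicate 2 (edge ::ₘ Multiset.replicate r pt, true) := by
      have hz : (Multiset.replicate (r - 1) pt).bind
          (fun a => (leafDeck a).map fun p => (p.1 ::ₘ M'.erase a, p.2)) = 0 := by
        apply Multiset.eq_zero_of_forall_notMem
        intro x hx
        obtain ⟨a, ha, hx⟩ := Multiset.mem_bind.1 hx
        rw [Multiset.eq_of_mem_replicate ha] at hx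
        simp at hx
      have he : M'.erase edge = edge ::ₘ Multiset.replicate (r - 1) pt := by
        rw [hM'eq]; simp
      have hp : pt ::ₘ M'.erase edge = edge ::ₘ Multiset.replicate r pt := by
        rw [he, Multiset.cons_swap, ← Multiset.replicate_succ, Nat.sub_add_cancel hrpos]
      have h0 : branchDeck M' = (edge ::ₘ edge ::ₘ Multiset.replicate (r - 1) pt).bind
          fun a => (leafDeck a).map fun p => (p.1 ::ₘ M'.erase a, p.2) := by
        rw [branchDeck, ← hM'eq]
      rw [h0, Multiset.cons_bind, Multiset.cons_bind, hz, leafDeck_edge]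
      simp [hp, Multiset.replicate_succ]
    refine leafDeck_ne_of_size_eq_three hB3 (Multiset.eq_replicate.2 ⟨?_, fun p hp => ?_⟩)
    · rw [← hcard, hF, hFM2]; simp
    · have : (p.1 ::ₘ Multiset.replicate r pt, p.2) ∈ branchDeck M' := by
        rw [hFM]; exact Multiset.mem_map.2 ⟨p, hp, rfl⟩
      rw [hFM2] at this
      have := Multiset.eq_of_mem_replicate this
      simp only [Prod.mk.injEq, Multiset.cons_inj_left] at this
      exact Prod.ext this.1 this.2

/-- A card of a star has only points as branches. In the other tree such a card comes from a branch
`edge` and has label `true`; but a star with label `true` has a single leaf, and its card has no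
branches. -/
theorem leafDeck_ne_of_star {M M' : Multiset ℕ} (hM : ∀ a ∈ M, a = pt) (hM' : ¬ ∀ a ∈ M', a = pt) :
    leafDeck (node M) ≠ leafDeck (node M') := by
  intro h
  rw [leafDeck_node_of_forall hM, leafDeck_node_of_not_forall hM'] at h
  push Not at hM'
  obtain ⟨c, hc, hc'⟩ := hM'
  obtain ⟨p, hp⟩ := Multiset.exists_mem_of_ne_zero (leafDeck_ne_zero hc')
  have h1 : (p.1 ::ₘ M'.erase c, p.2) ∈ branchDeck M' :=
    Multiset.mem_bind.2 ⟨c, hc, Multiset.mem_map.2 ⟨p, hp, rfl⟩⟩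
  have h2 := Multiset.mem_map_of_mem (Prod.map node id) h1
  rw [← h, Multiset.mem_map] at h2
  obtain ⟨a, ha, h2⟩ := h2
  simp only [Prod.map_apply, id_eq, Prod.mk.injEq, EmbeddingLike.apply_eq_iff_eq] at h2
  have h3 : p.1 ∈ M.erase a := h2.1 ▸ Multiset.mem_cons_self _ _
  have h4 : p.1 = pt := hM _ (Multiset.mem_of_mem_erase h3)
  have h5 : c = edge := size_eq_two.1 (by rw [← size_of_mem_leafDeck hp, h4, size_pt])
  subst h5
  simp only [leafDeck_edge, Multiset.mem_singleton] at hp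
  subst hp
  have h6 : M.card = 1 := by simpa using h2.2
  have h7 := Multiset.card_erase_of_mem ha
  rw [h2.1, h6] at h7
  simp at h7

/-- A rooted tree is determined by its size and its labelled deck. -/
theorem eq_of_leafDeck_eq {c c' : ℕ} (hs : size c = size c') (h : leafDeck c = leafDeck c') :
    c = c' := by
  induction hn : size c using Nat.strong_induction_on generalizing c c' with
  | _ n ih =>
    subst hn
    obtain ⟨M, rfl⟩ := node.surjective c
    obtain ⟨M', rfl⟩ := node.surjective c'
    have hsum : (M.map size).sum = (M'.map size).sum := by
      rw [size_node, size_node] at hs; omega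
    by_cases hM : ∀ a ∈ M, a = pt
    · by_cases hM' : ∀ a ∈ M', a = pt
      · congr 1
        rw [Multiset.eq_replicate_card.2 hM, Multiset.eq_replicate_card.2 hM',
          ← sum_size_eq_card.2 hM, ← sum_size_eq_card.2 hM', hsum]
      · exact absurd h (leafDeck_ne_of_star hM hM')
    by_cases hM' : ∀ a ∈ M', a = pt
    · exact absurd h.symm (leafDeck_ne_of_star hM' hM)
    rw [leafDeck_node_of_not_forall hM, leafDeck_node_of_not_forall hM'] at h
    have hF : branchDeck M = branchDeck M' :=
      Multiset.map_injective (Prod.map_injective.2 ⟨node.injective, fun _ _ h => h⟩) h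
    by_contra hne
    have hne' : ∃ b, M.count b ≠ M'.count b := by
      by_contra hall
      push Not at hall
      exact hne (congrArg node (Multiset.ext.2 hall))
    obtain ⟨b, hb⟩ := hne'
    -- The top-down step applies to a largest branch whose multiplicities differ.
    let D := ((M + M').toFinset).filter fun b => M.count b ≠ M'.count b
    have hD : ∀ c, M.count c ≠ M'.count c → c ∈ D := by
      intro c hc
      refine Finset.mem_filter.2 ⟨?_, hc⟩
      rw [Multiset.mem_toFinset, ← Multiset.count_pos, Multiset.count_add]
      omega
    obtain ⟨b, hbD, hmax⟩ := D.exists_max_image size ⟨b, hD b hb⟩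
    have hb := (Finset.mem_filter.1 hbD).2
    have hmax' : ∀ c, size b < size c → M.count c = M'.count c := by
      intro c hc
      by_contra hc'
      exact absurd (hmax c (hD c hc')) (by omega)
    rcases lt_or_gt_of_ne hb with hlt | hlt
    · exact branchDeck_ne_of_count_lt hM hsum.symm
        (fun a ha a' h1 h2 => ih _ (hs ▸ size_lt_of_mem ha) h1 h2 rfl) hF.symm hlt
        fun c hc => (hmax' c hc).symm
    · exact branchDeck_ne_of_count_lt hM' hsum
        (fun a ha a' h1 h2 => ih _ (size_lt_of_mem ha) h1 h2 rfl) hF hlt hmax'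

end TreeCode

/-! ### Distances and branches in trees -/

namespace SimpleGraph

open scoped Classical
open Finset

section Metric

variable {V : Type*} {T : SimpleGraph V}

theorem IsTree.dist_adj_or (hT : T.IsTree) (w : V) {u v : V} (h : T.Adj u v) :
    T.dist u w = T.dist v w + 1 ∨ T.dist v w = T.dist u w + 1 := by
  rw [dist_comm, dist_comm (u := v)]
  exact hT.dist_eq_dist_add_one_of_adj w h

theorem IsTree.dist_eq_zero (hT : T.IsTree) {u v : V} : T.dist u v = 0 ↔ u = v :=
  hT.connected.dist_eq_zero_iff

theorem IsTree.exists_adj_toward (hT : T.IsTree) {v w : V} (h : v ≠ w) :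
    ∃ a, T.Adj v a ∧ T.dist v w = T.dist a w + 1 := by
  obtain ⟨p, hp⟩ := hT.connected.exists_walk_length_eq_dist v w
  cases p with
  | nil => exact absurd rfl h
  | @cons _ a _ hva q =>
    refine ⟨a, hva, ?_⟩
    have h1 := dist_le q
    rcases hT.dist_adj_or w hva with h2 | h2
    · exact h2
    · simp at hp; omega

/-- A step towards `w` extends to a shortest walk, and this is the unique path from `v` to `w`. -/
theorem IsTree.toward_unique (hT : T.IsTree) {v w a b : V} (ha : T.Adj v a) (hb : T.Adj v b)
    (ha' : T.dist v w = T.dist a w + 1) (hb' : T.dist v w = T.dist b w + 1) : a = b := by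
  obtain ⟨p, hp⟩ := hT.connected.exists_walk_length_eq_dist a w
  obtain ⟨q, hq⟩ := hT.connected.exists_walk_length_eq_dist b w
  have h1 : (Walk.cons ha p).IsPath := Walk.isPath_of_length_eq_dist _ (by simp [hp, ha'])
  have h2 : (Walk.cons hb q).IsPath := Walk.isPath_of_length_eq_dist _ (by simp [hq, hb'])
  have h3 := (hT.isAcyclic.subsingleton_path v w).elim ⟨_, h1⟩ ⟨_, h2⟩
  have h4 := congrArg (fun p : T.Path v w => p.1.snd) h3
  simpa using h4

theorem IsTree.dist_away (hT : T.IsTree) {v w a b : V} (ha : T.Adj v a) (hb : T.Adj v b)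
    (hab : a ≠ b) (ha' : T.dist v w = T.dist a w + 1) : T.dist b w = T.dist v w + 1 := by
  rcases hT.dist_adj_or w hb with h | h
  · exact absurd (hT.toward_unique ha hb ha' h) hab
  · exact h

end Metric

section Branch

variable {V : Type*} [Fintype V] {T : SimpleGraph V} {u v w a b x y : V}

/-- The vertices closer to `v` than to `u`: in a tree with an edge `uv`, the component of `v` after
the deletion of this edge. -/
noncomputable def branch (T : SimpleGraph V) (u v : V) : Finset V :=
  univ.filter fun w => T.dist v w < T.dist u w

theorem mem_branch : w ∈ T.branch u v ↔ T.dist v w < T.dist u w := by simp [branch]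

theorem IsTree.mem_branch_iff (hT : T.IsTree) (h : T.Adj u v) :
    w ∈ T.branch u v ↔ T.dist u w = T.dist v w + 1 := by
  rw [mem_branch]
  rcases hT.dist_adj_or w h with h | h <;> omega

theorem IsTree.notMem_branch_iff (hT : T.IsTree) (h : T.Adj u v) :
    w ∉ T.branch u v ↔ w ∈ T.branch v u := by
  rw [mem_branch, mem_branch]
  rcases hT.dist_adj_or w h with h | h <;> omega

theorem Adj.mem_branch_right (h : T.Adj u v) : v ∈ T.branch u v := by
  rw [mem_branch, dist_self, dist_eq_one_iff_adj.2 h]; omega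

theorem left_notMem_branch : u ∉ T.branch u v := by simp [mem_branch]

theorem IsTree.mem_branch_iff_eq_or (hT : T.IsTree) (h : T.Adj u v) :
    w ∈ T.branch u v ↔ w = v ∨ ∃ a, (T.Adj v a ∧ a ≠ u) ∧ w ∈ T.branch v a := by
  constructor
  · intro hw
    by_cases hwv : w = v
    · exact Or.inl hwv
    · obtain ⟨a, ha, ha'⟩ := hT.exists_adj_toward (Ne.symm hwv)
      refine Or.inr ⟨a, ⟨ha, ?_⟩, by rw [mem_branch]; omega⟩
      rintro rfl
      rw [mem_branch] at hw
      omega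
  · rintro (rfl | ⟨a, ⟨ha, hau⟩, hw⟩)
    · exact h.mem_branch_right
    · rw [hT.mem_branch_iff ha] at hw
      rw [hT.mem_branch_iff h]
      exact hT.dist_away ha h.symm hau hw

theorem IsTree.disjoint_branch (hT : T.IsTree) (ha : T.Adj v a) (hb : T.Adj v b) (hab : a ≠ b) :
    Disjoint (T.branch v a) (T.branch v b) := by
  rw [Finset.disjoint_left]
  intro w hwa hwb
  rw [hT.mem_branch_iff ha] at hwa
  rw [hT.mem_branch_iff hb] at hwb
  exact hab (hT.toward_unique ha hb hwa hwb)

theorem IsTree.branch_subset (hT : T.IsTree) (h : T.Adj u v) (ha : T.Adj v a) (hau : a ≠ u) :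
    T.branch v a ⊆ T.branch u v := fun _ hw =>
  (hT.mem_branch_iff_eq_or h).2 (Or.inr ⟨a, ⟨ha, hau⟩, hw⟩)

/-- The neighbours of `v` other than `u`. -/
noncomputable def kidSet (X : SimpleGraph V) (u v : V) : Finset V :=
  univ.filter fun w => X.Adj v w ∧ w ≠ u

@[simp] theorem mem_kidSet {X : SimpleGraph V} : w ∈ X.kidSet u v ↔ X.Adj v w ∧ w ≠ u := by
  simp [kidSet]

theorem IsTree.branch_eq (hT : T.IsTree) (h : T.Adj u v) :
    T.branch u v = insert v ((T.kidSet u v).biUnion (T.branch v)) := by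
  ext w
  rw [hT.mem_branch_iff_eq_or h]
  simp

theorem IsTree.branch_erase_eq (hT : T.IsTree) (h : T.Adj u v) :
    (T.branch u v).erase v = (T.kidSet u v).biUnion (T.branch v) := by
  rw [hT.branch_eq h, Finset.erase_insert]
  simp only [mem_biUnion, not_exists, not_and]
  exact fun _ _ => left_notMem_branch

theorem IsTree.pairwiseDisjoint_branch (hT : T.IsTree) :
    ((T.kidSet u v : Finset V) : Set V).PairwiseDisjoint (T.branch v) := by
  intro a ha b hb hab
  simp only [mem_coe, mem_kidSet] at ha hb
  exact hT.disjoint_branch ha.1 hb.1 hab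

theorem IsTree.card_branch (hT : T.IsTree) (h : T.Adj u v) :
    (T.branch u v).card = 1 + ∑ a ∈ T.kidSet u v, (T.branch v a).card := by
  rw [← Finset.card_biUnion, ← hT.branch_erase_eq h, add_comm,
    Finset.card_erase_add_one h.mem_branch_right]
  exact fun a ha b hb => hT.pairwiseDisjoint_branch ha hb

theorem IsTree.card_branch_lt (hT : T.IsTree) (h : T.Adj u v) (ha : T.Adj v a) (hau : a ≠ u) :
    (T.branch v a).card < (T.branch u v).card := by
  refine Finset.card_lt_card ⟨hT.branch_subset h ha hau, fun hs => ?_⟩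
  exact left_notMem_branch (hs h.mem_branch_right)

theorem IsTree.card_branch_add (hT : T.IsTree) (h : T.Adj u v) :
    (T.branch u v).card + (T.branch v u).card = Fintype.card V := by
  have : T.branch v u = (T.branch u v)ᶜ := by
    ext w; rw [Finset.mem_compl, hT.notMem_branch_iff h]
  rw [this, Finset.card_add_card_compl]

theorem Adj.one_le_card_branch (h : T.Adj u v) : 1 ≤ (T.branch u v).card :=
  Finset.card_pos.2 ⟨v, h.mem_branch_right⟩

/-- If `w ≠ v`, then both `y` and the neighbour of `w` towards `v` lead from `w` towards `u`. They
differ, since `y` is farther from `v`, against the uniqueness of that neighbour. -/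
theorem IsTree.eq_of_adj_of_notMem_branch (hT : T.IsTree) (h : T.Adj u v) (hw : w ∈ T.branch u v)
    (hwy : T.Adj w y) (hy : y ∉ T.branch u v) : w = v ∧ y = u := by
  rw [hT.notMem_branch_iff h, hT.mem_branch_iff h.symm] at hy
  rw [hT.mem_branch_iff h] at hw
  have hwy' : T.dist w y = 1 := dist_eq_one_iff_adj.2 hwy
  rcases hT.dist_adj_or u hwy with h1 | h1 <;> rcases hT.dist_adj_or v hwy with h2 | h2 <;>
    simp only [dist_comm (u := w), dist_comm (u := y)] at h1 h2 <;> try omega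
  by_cases hwv : w = v
  · subst hwv
    refine ⟨rfl, ?_⟩
    rw [dist_self] at *
    have : T.dist u y = 0 := by omega
    exact (hT.dist_eq_zero.1 this).symm
  · exfalso
    obtain ⟨a, ha, ha'⟩ := hT.exists_adj_toward hwv
    have hya : y ≠ a := by
      rintro rfl
      rw [dist_comm, dist_comm (u := y)] at ha'
      omega
    have hwu : T.dist w u = T.dist a u + 1 := by
      rcases hT.dist_adj_or u ha with h3 | h3
      · exact h3
      · have h4 := hT.connected.dist_triangle (u := a) (v := v) (w := u)
        have h5 : T.dist v u = 1 := dist_eq_one_iff_adj.2 h.symm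
        rw [dist_comm (u := w)] at h3 ha'
        omega
    have := hT.dist_away ha hwy hya.symm hwu
    rw [dist_comm (u := w), dist_comm (u := y)] at this
    omega

end Branch

/-! ### Leaves, inner vertices and deep leaves. -/

section Leaf

variable {V : Type*} {T : SimpleGraph V} {u v w a b x y p : V}

/-- `x` is a leaf attached to `p`. -/
def IsLeafAt (T : SimpleGraph V) (p x : V) : Prop := ∀ y, T.Adj x y ↔ y = p

/-- `v` has at least two neighbours. -/
def IsInner (T : SimpleGraph V) (v : V) : Prop := ∃ a b, a ≠ b ∧ T.Adj v a ∧ T.Adj v b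

/-- `x` is a leaf attached to a vertex with at most one neighbour that is not a leaf. -/
def IsDeepLeaf (T : SimpleGraph V) (x : V) : Prop :=
  ∃ p, T.IsLeafAt p x ∧ ∀ a b, T.Adj p a → T.Adj p b → T.IsInner a → T.IsInner b → a = b

theorem IsLeafAt.adj (h : T.IsLeafAt p x) : T.Adj x p := (h p).2 rfl

theorem IsLeafAt.not_isInner (h : T.IsLeafAt p x) : ¬ T.IsInner x := by
  rintro ⟨a, b, hab, ha, hb⟩
  exact hab (((h a).1 ha).trans ((h b).1 hb).symm)

theorem Adj.isLeafAt_of_not_isInner (h : T.Adj x p) (hx : ¬ T.IsInner x) : T.IsLeafAt p x := by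
  intro y
  refine ⟨fun hy => ?_, fun hy => hy ▸ h⟩
  by_contra hne
  exact hx ⟨y, p, hne, hy, h⟩

theorem IsLeafAt.eq (h : T.IsLeafAt p x) (h' : T.IsLeafAt a x) : a = p := (h a).1 h'.adj

theorem IsDeepLeaf.not_isInner (h : T.IsDeepLeaf x) : ¬ T.IsInner x := by
  obtain ⟨p, hp, -⟩ := h
  exact hp.not_isInner

end Leaf

end SimpleGraph

/-! ### Codes of the branches of a tree -/

namespace SimpleGraph

open scoped Classical
open Finset TreeCode

section Code

variable {V : Type*} [Fintype V] {T X Y : SimpleGraph V} {u v w a b x y p : V}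

/-- The code of the branch at `v` away from `u`, cut off at depth `k`. -/
noncomputable def codeAux (X : SimpleGraph V) : ℕ → V → V → ℕ
  | 0, _, _ => pt
  | k + 1, u, v => node ((X.kidSet u v).val.map (codeAux X k v))

/-- The code of the branch at `v` away from `u`. -/
noncomputable def code (X : SimpleGraph V) (u v : V) : ℕ := X.codeAux (Fintype.card V) u v

/-- Branches shrink strictly on descent, so a depth equal to the size of the branch suffices and the
cut-off in `code` is harmless. The subgraph `X` allows for the deletion of a leaf, which keeps the
leaf as an isolated vertex. -/
theorem codeAux_succ_eq (hT : T.IsTree) (hX : X ≤ T) (k : ℕ) :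
    ∀ {u v : V}, T.Adj u v → (T.branch u v).card ≤ k →
      X.codeAux (k + 1) u v = X.codeAux k u v := by
  induction k with
  | zero =>
    intro u v h hk
    have := h.one_le_card_branch
    omega
  | succ k ih =>
    intro u v h hk
    rw [codeAux, codeAux]
    congr 1
    refine Multiset.map_congr rfl fun a ha => ?_
    rw [Finset.mem_val, mem_kidSet] at ha
    refine ih (hX ha.1) ?_
    have := hT.card_branch_lt h (hX ha.1) ha.2
    omega

theorem code_eq (hT : T.IsTree) (hX : X ≤ T) (h : T.Adj u v) :
    X.code u v = node ((X.kidSet u v).val.map (X.code v)) := by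
  rw [code, ← codeAux_succ_eq hT hX _ h (Finset.card_le_univ _), codeAux]
  rfl

theorem size_code (hT : T.IsTree) (h : T.Adj u v) :
    size (T.code u v) = (T.branch u v).card := by
  induction hn : (T.branch u v).card using Nat.strong_induction_on generalizing u v with
  | _ n ih =>
    subst hn
    rw [code_eq hT le_rfl h, size_node, Multiset.map_map, hT.card_branch h]
    congr 1
    refine Finset.sum_congr rfl fun a ha => ?_
    rw [mem_kidSet] at ha
    exact ih _ (hT.card_branch_lt h ha.1 ha.2) ha.1 rfl

theorem code_eq_pt_iff (hT : T.IsTree) (h : T.Adj u v) : T.code u v = pt ↔ ¬ T.IsInner v := by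
  rw [code_eq hT le_rfl h, pt, EmbeddingLike.apply_eq_iff_eq, Multiset.map_eq_zero,
    Finset.val_eq_zero, Finset.eq_empty_iff_forall_notMem]
  constructor
  · rintro hk ⟨a, b, hab, ha, hb⟩
    have h1 := hk a
    have h2 := hk b
    simp only [mem_kidSet, not_and, not_not] at h1 h2
    exact hab ((h1 ha).trans (h2 hb).symm)
  · intro hv a ha
    rw [mem_kidSet] at ha
    exact hv ⟨a, u, ha.2, ha.1, h.symm⟩

theorem code_deleteIncidenceSet_of_notMem (hT : T.IsTree) (h : T.Adj u v) 
    (hx : x ∉ T.branch u v) : (T.deleteIncidenceSet x).code u v = T.code u v := by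
  induction hn : (T.branch u v).card using Nat.strong_induction_on generalizing u v with
  | _ n ih =>
    subst hn
    have hvx : v ≠ x := fun e => hx (e ▸ h.mem_branch_right)
    have hk : (T.deleteIncidenceSet x).kidSet u v = T.kidSet u v := by
      ext a
      simp only [mem_kidSet, deleteIncidenceSet_adj, and_congr_left_iff]
      intro hau
      refine ⟨fun ha => ha.1, fun ha => ⟨ha, hvx, ?_⟩⟩
      rintro rfl
      exact hx (hT.branch_subset h ha hau ha.mem_branch_right)
    rw [code_eq hT (deleteIncidenceSet_le _ _) h, code_eq hT le_rfl h, hk]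
    congr 1
    refine Multiset.map_congr rfl fun a ha => ?_
    rw [Finset.mem_val, mem_kidSet] at ha
    exact ih _ (hT.card_branch_lt h ha.1 ha.2) ha.1
      (fun hxa => hx (hT.branch_subset h ha.1 ha.2 hxa)) rfl

/-- The label of a leaf `x`: is its neighbour a vertex of degree at most two? -/
noncomputable def leafLabel (T : SimpleGraph V) (x : V) : Bool :=
  decide (∃ p q, T.IsLeafAt p x ∧ ∀ y, T.Adj p y → y = x ∨ y = q)

/-- The set of deep leaves. -/
noncomputable def deepSet (T : SimpleGraph V) : Finset V := univ.filter T.IsDeepLeaf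

@[simp] theorem mem_deepSet : x ∈ T.deepSet ↔ T.IsDeepLeaf x := by simp [deepSet]

theorem IsTree.branch_eq_singleton (hT : T.IsTree) (h : T.Adj u v) (hv : ¬ T.IsInner v) :
    T.branch u v = {v} := by
  rw [hT.branch_eq h]
  have : T.kidSet u v = ∅ := by
    ext a
    simp only [mem_kidSet, Finset.notMem_empty, iff_false, not_and, not_not]
    intro ha
    by_contra hau
    exact hv ⟨a, u, hau, ha, h.symm⟩
  simp [this]

theorem code_deleteIncidenceSet_eq_cons (hT : T.IsTree) (h : T.Adj u v) (ha : T.Adj v a)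
    (hau : a ≠ u) (hx : x ∈ (T.branch v a).erase a) :
    (T.deleteIncidenceSet x).code u v = node ((T.deleteIncidenceSet x).code v a ::ₘ
      ((T.kidSet u v).val.map (T.code v)).erase (T.code v a)) := by
  rw [Finset.mem_erase] at hx
  have hvx : v ≠ x := by
    rintro rfl
    exact left_notMem_branch hx.2
  have hk : (T.deleteIncidenceSet x).kidSet u v = T.kidSet u v := by
    ext b
    simp only [mem_kidSet, deleteIncidenceSet_adj, and_congr_left_iff]
    intro hbu
    refine ⟨fun hb => hb.1, fun hb => ⟨hb, hvx, ?_⟩⟩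
    rintro rfl
    exact Finset.disjoint_left.1 (hT.disjoint_branch ha hb hx.1.symm) hx.2 hb.mem_branch_right
  have hak : a ∈ (T.kidSet u v).val := by rw [Finset.mem_val, mem_kidSet]; exact ⟨ha, hau⟩
  rw [code_eq hT (deleteIncidenceSet_le _ _) h, hk, ← Multiset.map_erase_of_mem _ _ hak]
  congr 1
  conv_lhs => rw [← Multiset.cons_erase hak, Multiset.map_cons]
  congr 1
  refine Multiset.map_congr rfl fun b hb => ?_
  rw [(T.kidSet u v).nodup.mem_erase_iff, Finset.mem_val, mem_kidSet] at hb
  exact code_deleteIncidenceSet_of_notMem hT hb.2.1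
    (Finset.disjoint_left.1 (hT.disjoint_branch ha hb.2.1 hb.1.symm) hx.2)

theorem leafLabel_eq (h : T.Adj u v) (hx : T.IsLeafAt v x) (hxu : x ≠ u) :
    T.leafLabel x = decide ((T.kidSet u v).card = 1) := by
  rw [leafLabel, decide_eq_decide, Finset.card_eq_one]
  have hxk : x ∈ T.kidSet u v := by rw [mem_kidSet]; exact ⟨hx.adj.symm, hxu⟩
  constructor
  · rintro ⟨p, q, hp, hq⟩
    obtain rfl := hx.eq hp
    refine ⟨x, ?_⟩
    ext y
    rw [Finset.mem_singleton]
    refine ⟨fun hy => ?_, fun hy => hy ▸ hxk⟩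
    rw [mem_kidSet] at hy
    have hu := (hq u h.symm).resolve_left (Ne.symm hxu)
    exact (hq y hy.1).resolve_right (hu ▸ hy.2)
  · rintro ⟨y, hy⟩
    rw [hy, Finset.mem_singleton] at hxk
    subst hxk
    refine ⟨v, u, hx, fun z hz => ?_⟩
    by_contra hcon
    push Not at hcon
    have : z ∈ T.kidSet u v := by rw [mem_kidSet]; exact ⟨hz, hcon.2⟩
    rw [hy, Finset.mem_singleton] at this
    exact hcon.1 this

/-- The deletions of deep leaves in a branch realise the deck of its code. -/
theorem sum_deep_branch (hT : T.IsTree) (h : T.Adj u v) (hu : T.IsInner u) (F : ℕ × Bool → ℕ) :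
    ∑ x ∈ (T.branch u v).erase v with T.IsDeepLeaf x,
      F ((T.deleteIncidenceSet x).code u v, T.leafLabel x) =
        ((leafDeck (T.code u v)).map F).sum := by
  induction hn : (T.branch u v).card using Nat.strong_induction_on generalizing u v F with
  | _ n ih =>
    subst hn
    have hcode := code_eq hT le_rfl h
    set K := T.kidSet u v with hK
    -- If all children of `v` are leaves, they are deep, since `u` is the only possible inner
    -- neighbour of `v`. Otherwise `v` has two inner neighbours, `u` among them, so leaves at `v`
    -- are not deep and the deletions take place further down. The two cases are those of
    -- `leafDeck`.
    by_cases hkids : ∀ a ∈ K, ¬ T.IsInner a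
    · have hpt : ∀ a ∈ K, T.code v a = pt := fun a ha =>
        (code_eq_pt_iff hT (mem_kidSet.1 ha).1).2 (hkids a ha)
      have hleaf : ∀ a ∈ K, T.IsLeafAt v a := fun a ha =>
        (mem_kidSet.1 ha).1.symm.isLeafAt_of_not_isInner (hkids a ha)
      have hset : ((T.branch u v).erase v).filter T.IsDeepLeaf = K := by
        rw [hT.branch_erase_eq h]
        ext x
        rw [mem_filter, mem_biUnion]
        constructor
        · rintro ⟨⟨a, ha, hx⟩, -⟩
          rw [hT.branch_eq_singleton (mem_kidSet.1 ha).1 (hkids a ha), mem_singleton] at hx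
          exact hx ▸ ha
        · intro hx
          refine ⟨⟨x, hx, (mem_kidSet.1 hx).1.mem_branch_right⟩, v, hleaf x hx, ?_⟩
          have key : ∀ b, T.Adj v b → T.IsInner b → b = u := by
            intro b hb hbi
            by_contra hbu
            exact hkids b (mem_kidSet.2 ⟨hb, hbu⟩) hbi
          intro a b ha hb hai hbi
          rw [key a ha hai, key b hb hbi]
      have hM : ∀ c ∈ K.val.map (T.code v), c = pt := by
        intro c hc
        obtain ⟨a, ha, rfl⟩ := Multiset.mem_map.1 hc
        exact hpt a ha
      rw [hset, hcode, leafDeck_node_of_forall hM, Multiset.map_map, Multiset.map_map]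
      refine Finset.sum_congr rfl fun a ha => ?_
      have haK := mem_kidSet.1 ha
      simp only [Function.comp_apply, Multiset.card_map, Finset.card_val]
      rw [leafLabel_eq h (hleaf a ha) haK.2, code_eq hT (deleteIncidenceSet_le _ _) h,
        ← Multiset.map_erase_of_mem _ _ (Finset.mem_def.1 ha), ← Finset.erase_val]
      have hk : (T.deleteIncidenceSet a).kidSet u v = K.erase a := by
        ext b
        rw [mem_erase, mem_kidSet, mem_kidSet, deleteIncidenceSet_adj]
        have := haK.1.ne
        tauto
      rw [hk]
      congr 3
      refine Multiset.map_congr rfl fun b hb => ?_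
      rw [Finset.mem_val, mem_erase, mem_kidSet] at hb
      exact code_deleteIncidenceSet_of_notMem hT hb.2.1
        (Finset.disjoint_left.1 (hT.disjoint_branch haK.1 hb.2.1 hb.1.symm)
          haK.1.mem_branch_right)
    · have hM : ¬ ∀ c ∈ K.val.map (T.code v), c = pt := by
        intro hc
        refine hkids fun a ha => ?_
        rw [← code_eq_pt_iff hT (mem_kidSet.1 ha).1]
        exact hc _ (Multiset.mem_map_of_mem _ (Finset.mem_def.1 ha))
      push Not at hkids
      obtain ⟨a₀, ha₀, ha₀i⟩ := hkids
      have ha₀K := mem_kidSet.1 ha₀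
      have hnd : ∀ a ∈ K, ¬ T.IsDeepLeaf a := by
        rintro a ha ⟨p, hp, hp'⟩
        obtain rfl := (hp v).1 (mem_kidSet.1 ha).1.symm
        exact ha₀K.2 (hp' a₀ u ha₀K.1 h.symm ha₀i hu)
      have hset : ((T.branch u v).erase v).filter T.IsDeepLeaf =
          K.biUnion fun a => ((T.branch v a).erase a).filter T.IsDeepLeaf := by
        rw [hT.branch_erase_eq h, Finset.filter_biUnion]
        refine Finset.biUnion_congr rfl fun a ha => ?_
        ext x
        simp only [mem_filter, mem_erase]
        constructor
        · rintro ⟨hx, hd⟩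
          refine ⟨⟨?_, hx⟩, hd⟩
          rintro rfl
          exact hnd x ha hd
        · rintro ⟨⟨-, hx⟩, hd⟩
          exact ⟨hx, hd⟩
      rw [hset, hcode, leafDeck_node_of_not_forall hM, Finset.sum_biUnion, branchDeck,
        Multiset.map_bind, Multiset.map_bind, Multiset.sum_bind, Multiset.map_map]
      · refine Finset.sum_congr rfl fun a ha => ?_
        have haK := mem_kidSet.1 ha
        have hvi : T.IsInner v := ⟨a, u, haK.2, haK.1, h.symm⟩
        have := ih _ (hT.card_branch_lt h haK.1 haK.2) haK.1 hvi
          (fun p => F (node (p.1 ::ₘ (K.val.map (T.code v)).erase (T.code v a)), p.2)) rfl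
        simp only [Function.comp_apply, Multiset.map_map]
        refine Eq.trans (Finset.sum_congr rfl fun x hx => ?_) this
        rw [code_deleteIncidenceSet_eq_cons hT h haK.1 haK.2 (mem_filter.1 hx).1]
      · intro a ha b hb hab
        refine Finset.disjoint_of_subset_left ?_ (Finset.disjoint_of_subset_right ?_
          (hT.disjoint_branch (mem_kidSet.1 ha).1 (mem_kidSet.1 hb).1 hab))
        · exact (Finset.filter_subset _ _).trans (Finset.erase_subset _ _)
        · exact (Finset.filter_subset _ _).trans (Finset.erase_subset _ _)

end Code

end SimpleGraph

/-! ### Geodesics, and the counting equation for deleted deep leaves -/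

namespace SimpleGraph

open scoped Classical
open Finset TreeCode

section Geodesic

variable {V : Type*} {T : SimpleGraph V} {u v w a b x y p q : V}

theorem exists_crossing {P : ℕ → Prop} {m : ℕ} (h0 : P 0) (hm : ¬ P m) :
    ∃ i < m, P i ∧ ¬ P (i + 1) := by
  by_contra hcon
  push Not at hcon
  have : ∀ i ≤ m, P i := by
    intro i
    induction i with
    | zero => exact fun _ => h0
    | succ i ih => exact fun hi => hcon i (by omega) (ih (by omega))
  exact hm (this m le_rfl)

theorem IsTree.exists_geodesic (hT : T.IsTree) (p q : V) :
    ∃ z : ℕ → V, z 0 = p ∧ z (T.dist p q) = q ∧ (∀ i < T.dist p q, T.Adj (z i) (z (i + 1))) ∧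
      ∀ i ≤ T.dist p q, T.dist p (z i) = i ∧ T.dist (z i) q + i = T.dist p q := by
  obtain ⟨W, hW⟩ := hT.connected.exists_walk_length_eq_dist p q
  refine ⟨W.getVert, W.getVert_zero, hW ▸ W.getVert_length, fun i hi =>
    W.adj_getVert_succ (hW ▸ hi), fun i hi => ?_⟩
  have h1 := dist_le (W.take i)
  have h2 := dist_le (W.drop i)
  rw [Walk.take_length] at h1
  rw [Walk.drop_length] at h2
  have h3 := hT.connected.dist_triangle (u := p) (v := W.getVert i) (w := q)
  omega

variable [Fintype V]

/-- Distances across an edge of a tree. -/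
theorem IsTree.dist_across (hT : T.IsTree) (h : T.Adj a b) (hw : w ∈ T.branch a b)
    (hy : y ∉ T.branch a b) : T.dist w y = T.dist w b + 1 + T.dist a y := by
  obtain ⟨z, h0, hm, hadj, hd⟩ := hT.exists_geodesic w y
  obtain ⟨i, hi, hi1, hi2⟩ := exists_crossing (P := fun i => z i ∈ T.branch a b)
    (m := T.dist w y) (by rwa [h0]) (by rwa [hm])
  obtain ⟨h1, h2⟩ := hT.eq_of_adj_of_notMem_branch h hi1 (hadj i hi) hi2
  have h3 := hd i hi.le
  have h4 := hd (i + 1) hi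
  rw [h1] at h3
  rw [h2] at h4
  omega

/-- Paths from the branch to `u` or `v` leave through `a`, so the comparison of the two distances
has the same outcome at all its vertices. -/
theorem IsTree.branch_subset_of_mem (hT : T.IsTree) (h : T.Adj a b)
    (hu : u ∉ T.branch a b) (hv : v ∉ T.branch a b) (hx : x ∈ T.branch a b)
    (hxu : x ∈ T.branch u v) : T.branch a b ⊆ T.branch u v := by
  intro w hw
  rw [mem_branch] at *
  rw [dist_comm (u := v), dist_comm (u := u)] at hxu ⊢
  rw [← mem_branch] at hw hx hu hv
  rw [hT.dist_across h hw hu, hT.dist_across h hw hv]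
  rw [hT.dist_across h hx hu, hT.dist_across h hx hv] at hxu
  omega

end Geodesic

/-! ### Branch counts in the deletions of deep leaves. -/

section Counting

variable {V : Type*} [Fintype V] {T : SimpleGraph V} {u v w a b x y p q : V}

/-- The darts of a graph. -/
noncomputable def dartSet (X : SimpleGraph V) : Finset (V × V) :=
  univ.filter fun d => X.Adj d.1 d.2

@[simp] theorem mem_dartSet {X : SimpleGraph V} {d : V × V} : d ∈ X.dartSet ↔ X.Adj d.1 d.2 := by
  simp [dartSet]

/-- The number of darts whose branch has the code `c`. -/
noncomputable def codeCount (X : SimpleGraph V) (c : ℕ) : ℕ :=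
  ∑ d ∈ X.dartSet, if X.code d.1 d.2 = c then 1 else 0

/-- The deep leaves with a given label. -/
noncomputable def deepLabelSet (T : SimpleGraph V) (τ : Bool) : Finset V :=
  T.deepSet.filter fun x => T.leafLabel x = τ

theorem mem_deepLabelSet {τ : Bool} :
    x ∈ T.deepLabelSet τ ↔ T.IsDeepLeaf x ∧ T.leafLabel x = τ := by
  simp [deepLabelSet]

theorem size_code_deleteIncidenceSet (hT : T.IsTree) (h : T.Adj u v) (hx : ¬ T.IsInner x)
    (hxb : x ∈ (T.branch u v).erase v) :
    size ((T.deleteIncidenceSet x).code u v) + 1 = (T.branch u v).card := by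
  induction hn : (T.branch u v).card using Nat.strong_induction_on generalizing u v with
  | _ n ih =>
    subst hn
    rw [hT.branch_erase_eq h, mem_biUnion] at hxb
    obtain ⟨a, ha, hxa⟩ := hxb
    have haK := mem_kidSet.1 ha
    by_cases hax : x = a
    · subst hax
      have hk : (T.deleteIncidenceSet x).kidSet u v = (T.kidSet u v).erase x := by
        ext b
        rw [mem_erase, mem_kidSet, mem_kidSet, deleteIncidenceSet_adj]
        have := haK.1.ne
        tauto
      rw [code_eq hT (deleteIncidenceSet_le _ _) h, hk, size_node, hT.card_branch h,
        ← Finset.add_sum_erase _ _ ha, hT.branch_eq_singleton haK.1 hx, Multiset.map_map]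
      have : (((T.kidSet u v).erase x).val.map
          (size ∘ (T.deleteIncidenceSet x).code v)).sum =
            ∑ b ∈ (T.kidSet u v).erase x, (T.branch v b).card := by
        refine Finset.sum_congr rfl fun b hb => ?_
        rw [mem_erase, mem_kidSet] at hb
        rw [Function.comp_apply, code_deleteIncidenceSet_of_notMem hT hb.2.1, size_code hT hb.2.1]
        exact Finset.disjoint_left.1 (hT.disjoint_branch haK.1 hb.2.1 hb.1.symm) hxa
      rw [this, card_singleton]
      omega
    · have hxa' : x ∈ (T.branch v a).erase a := mem_erase.2 ⟨hax, hxa⟩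
      have h1 := ih _ (hT.card_branch_lt h haK.1 haK.2) haK.1 hxa' rfl
      rw [code_deleteIncidenceSet_eq_cons hT h haK.1 haK.2 hxa', size_node,
        ← Multiset.map_erase_of_mem _ _ (Finset.mem_def.1 ha), ← Finset.erase_val,
        Multiset.map_cons, Multiset.sum_cons, Multiset.map_map, hT.card_branch h,
        ← Finset.add_sum_erase _ _ ha, ← h1]
      have : (((T.kidSet u v).erase a).val.map (size ∘ T.code v)).sum =
          ∑ b ∈ (T.kidSet u v).erase a, (T.branch v b).card := by
        refine Finset.sum_congr rfl fun b hb => ?_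
        rw [mem_erase, mem_kidSet] at hb
        exact size_code hT hb.2.1
      rw [this]
      omega

theorem IsTree.isInner_of_card_branch (hT : T.IsTree) (h : T.Adj u v)
    (hc : (T.branch u v).card + 2 ≤ Fintype.card V) : T.IsInner u := by
  by_contra hu
  have h1 := hT.card_branch_add h
  rw [hT.branch_eq_singleton h.symm hu, card_singleton] at h1
  omega

theorem sum_map_ite_eq_count (D : Multiset (ℕ × Bool)) (a : ℕ × Bool) :
    (D.map fun p => if p = a then 1 else 0).sum = D.count a := by
  induction D using Multiset.induction with
  | empty => simp
  | cons b D ih =>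
    rw [Multiset.map_cons, Multiset.sum_cons, ih, Multiset.count_cons, add_comm]
    simp only [eq_comm]

/-- The deep leaves with a given label whose deletion turns the code of a dart into `c`. -/
theorem count_deletions_dart (hT : T.IsTree) (h : T.Adj u v) (τ : Bool) {c s : ℕ}
    (hs : 2 ≤ s) (hsV : s + 2 ≤ Fintype.card V) (hc : size c + 1 = s) :
    (∑ x ∈ T.deepLabelSet τ, if (T.deleteIncidenceSet x).Adj u v ∧
        (T.deleteIncidenceSet x).code u v = c then 1 else 0) +
      (if T.code u v = c then ∑ x ∈ T.deepLabelSet τ, if x ∈ T.branch u v then 1 else 0 else 0) =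
    (if T.code u v = c then (T.deepLabelSet τ).card else 0) +
      if size (T.code u v) = s then (leafDeck (T.code u v)).count (c, τ) else 0 := by
  have hsz := size_code hT h
  have hadj : ∀ x, (T.deleteIncidenceSet x).Adj u v ↔ u ≠ x ∧ v ≠ x := by
    intro x; rw [deleteIncidenceSet_adj]; tauto
  -- A branch with code `c` keeps it exactly under the deletions outside, since a deletion inside
  -- lowers the size. Any other branch reaches `c` only by a deletion inside and only from size `s`;
  -- the bound `hsV` makes `u` inner, so that `leafDeck` describes these deletions.
  by_cases hcs : T.code u v = c
  · have hu : T.IsInner u := hT.isInner_of_card_branch h (by rw [← hsz, hcs]; omega)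
    have hne : size (T.code u v) ≠ s := by rw [hcs]; omega
    rw [if_pos hcs, if_pos hcs, if_neg hne, ← Finset.sum_add_distrib, add_zero,
      Finset.card_eq_sum_ones]
    refine Finset.sum_congr rfl fun x hx => ?_
    have hxd := (mem_deepLabelSet.1 hx).1.not_isInner
    by_cases hxb : x ∈ T.branch u v
    · rw [if_pos hxb, if_neg]
      rintro ⟨h1, h2⟩
      have h3 := size_code_deleteIncidenceSet hT h hxd
        (mem_erase.2 ⟨((hadj x).1 h1).2.symm, hxb⟩)
      rw [h2, ← hsz, hcs] at h3
      omega
    · rw [if_neg hxb, if_pos]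
      refine ⟨(hadj x).2 ⟨?_, ?_⟩, ?_⟩
      · rintro rfl; exact hxd hu
      · rintro rfl; exact hxb h.mem_branch_right
      · rw [code_deleteIncidenceSet_of_notMem hT h hxb, hcs]
  · rw [if_neg hcs, if_neg hcs, add_zero, zero_add]
    by_cases hss : size (T.code u v) = s
    · have hu : T.IsInner u := hT.isInner_of_card_branch h (by omega)
      have hv : T.IsInner v := by
        by_contra hv
        rw [(code_eq_pt_iff hT h).2 hv, size_pt] at hss
        omega
      rw [if_pos hss, ← sum_map_ite_eq_count, ← sum_deep_branch hT h hu, Finset.sum_boole,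
        Finset.sum_boole]
      congr 2
      ext x
      simp only [mem_filter, mem_deepLabelSet, mem_erase, Prod.mk.injEq, hadj]
      constructor
      · rintro ⟨⟨hd, hl⟩, ⟨hxu, hxv⟩, hxc⟩
        refine ⟨⟨⟨hxv.symm, ?_⟩, hd⟩, hxc, hl⟩
        by_contra hxb
        rw [code_deleteIncidenceSet_of_notMem hT h hxb] at hxc
        exact hcs hxc
      · rintro ⟨⟨⟨hxv, -⟩, hd⟩, hxc, hl⟩
        refine ⟨⟨hd, hl⟩, ⟨?_, hxv.symm⟩, hxc⟩
        rintro rfl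
        exact hd.not_isInner hu
    · rw [if_neg hss]
      refine Finset.sum_eq_zero fun x hx => if_neg ?_
      have hxd := (mem_deepLabelSet.1 hx).1.not_isInner
      rintro ⟨h1, h2⟩
      by_cases hxb : x ∈ T.branch u v
      · have h3 := size_code_deleteIncidenceSet hT h hxd
          (mem_erase.2 ⟨((hadj x).1 h1).2.symm, hxb⟩)
        rw [h2] at h3
        omega
      · rw [code_deleteIncidenceSet_of_notMem hT h hxb] at h2
        exact hcs h2

theorem IsLeafAt.branch_eq (hT : T.IsTree) (h : T.IsLeafAt p x) : T.branch p x = {x} :=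
  hT.branch_eq_singleton h.adj.symm h.not_isInner

/-- The deep leaves inside the branches with code `c`. -/
theorem sum_deep_mem_branch (hT : T.IsTree) (τ : Bool) {c : ℕ}
    (hc : size c + 2 ≤ Fintype.card V) :
    (∑ d ∈ T.dartSet, if T.code d.1 d.2 = c then
      ∑ x ∈ T.deepLabelSet τ, if x ∈ T.branch d.1 d.2 then 1 else 0 else 0) =
    if c = pt then (T.deepLabelSet τ).card
    else T.codeCount c * ((leafDeck c).filter fun p => p.2 = τ).card := by
  -- The point is exceptional: a deep leaf lies in its own one-vertex branch, although `leafDeck pt`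
  -- is empty.
  by_cases hcp : c = pt
  · subst hcp
    rw [if_pos rfl]
    have h1 : ∀ d ∈ T.dartSet, (if T.code d.1 d.2 = pt then
        ∑ x ∈ T.deepLabelSet τ, if x ∈ T.branch d.1 d.2 then 1 else 0 else 0) =
        ∑ x ∈ T.deepLabelSet τ, if d.2 = x then 1 else 0 := by
      intro d hd
      rw [mem_dartSet] at hd
      by_cases hd2 : T.IsInner d.2
      · rw [if_neg (by rw [code_eq_pt_iff hT hd]; exact not_not.2 hd2)]
        refine (Finset.sum_eq_zero fun x hx => if_neg ?_).symm
        rintro rfl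
        exact (mem_deepLabelSet.1 hx).1.not_isInner hd2
      · rw [if_pos ((code_eq_pt_iff hT hd).2 hd2), hT.branch_eq_singleton hd hd2]
        simp only [mem_singleton, eq_comm]
    rw [Finset.sum_congr rfl h1, Finset.sum_comm, Finset.card_eq_sum_ones]
    refine Finset.sum_congr rfl fun x hx => ?_
    obtain ⟨p, hp, -⟩ := (mem_deepLabelSet.1 hx).1
    rw [Finset.sum_boole, Nat.cast_id, Finset.card_eq_one]
    refine ⟨(p, x), ?_⟩
    ext ⟨a, b⟩
    simp only [mem_filter, mem_dartSet, mem_singleton, Prod.mk.injEq]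
    constructor
    · rintro ⟨h, rfl⟩
      exact ⟨(hp a).1 h.symm, rfl⟩
    · rintro ⟨rfl, rfl⟩
      exact ⟨hp.adj.symm, rfl⟩
  · rw [if_neg hcp, codeCount, Finset.sum_mul]
    refine Finset.sum_congr rfl fun d hd => ?_
    rw [mem_dartSet] at hd
    by_cases hdc : T.code d.1 d.2 = c
    · rw [if_pos hdc, if_pos hdc, one_mul]
      have hu : T.IsInner d.1 :=
        hT.isInner_of_card_branch hd (by rw [← size_code hT hd, hdc]; exact hc)
      have hv : T.IsInner d.2 := by
        by_contra hv
        exact hcp (hdc ▸ (code_eq_pt_iff hT hd).2 hv)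
      have key := sum_deep_branch hT hd hu fun p => if p.2 = τ then 1 else 0
      have hcard : ((leafDeck c).map fun p => if p.2 = τ then 1 else 0).sum =
          ((leafDeck c).filter fun p => p.2 = τ).card := by
        induction leafDeck c using Multiset.induction with
        | empty => simp
        | cons p D ih =>
          rw [Multiset.map_cons, Multiset.sum_cons, ih, Multiset.filter_cons]
          by_cases hp : p.2 = τ <;> simp [hp, add_comm]
      rw [← hcard, ← hdc, ← key, Finset.sum_boole, Finset.sum_boole]
      congr 2
      ext x
      simp only [mem_filter, mem_deepLabelSet, mem_erase]
      constructor
      · rintro ⟨⟨hd, hl⟩, hxb⟩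
        refine ⟨⟨⟨?_, hxb⟩, hd⟩, hl⟩
        rintro rfl
        exact hd.not_isInner hv
      · rintro ⟨⟨⟨-, hxb⟩, hd⟩, hl⟩
        exact ⟨⟨hd, hl⟩, hxb⟩
    · rw [if_neg hdc, if_neg hdc, zero_mul]

/-- The counting equation: the codes of the branches of the graphs obtained by deleting a deep
leaf, in terms of the codes of the branches of the tree. -/
theorem sum_codeCount_deleteIncidenceSet (hT : T.IsTree) (τ : Bool) {c s : ℕ}
    (hs : 2 ≤ s) (hsV : s + 2 ≤ Fintype.card V) (hc : size c + 1 = s) :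
    (∑ x ∈ T.deepLabelSet τ, (T.deleteIncidenceSet x).codeCount c) +
      (if c = pt then (T.deepLabelSet τ).card
        else T.codeCount c * ((leafDeck c).filter fun p => p.2 = τ).card) =
    T.codeCount c * (T.deepLabelSet τ).card + ∑ d ∈ T.dartSet,
      if size (T.code d.1 d.2) = s then (leafDeck (T.code d.1 d.2)).count (c, τ) else 0 := by
  have h1 : ∀ x, (T.deleteIncidenceSet x).codeCount c = ∑ d ∈ T.dartSet,
      if (T.deleteIncidenceSet x).Adj d.1 d.2 ∧
        (T.deleteIncidenceSet x).code d.1 d.2 = c then 1 else 0 := by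
    intro x
    rw [codeCount, Finset.sum_boole, Finset.sum_boole]
    congr 2
    ext d
    simp only [mem_filter, mem_dartSet, deleteIncidenceSet_adj]
    tauto
  rw [Finset.sum_congr rfl fun x _ => h1 x, Finset.sum_comm,
    ← sum_deep_mem_branch hT τ (by omega), codeCount, Finset.sum_mul, ← Finset.sum_add_distrib,
    ← Finset.sum_add_distrib]
  refine Finset.sum_congr rfl fun d hd => ?_
  rw [count_deletions_dart hT (mem_dartSet.1 hd) τ hs hsV hc]
  congr 1
  split_ifs <;> simp

end Counting

end SimpleGraph

/-! ### Moving a leaf of a tree -/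

namespace SimpleGraph

open scoped Classical
open Finset TreeCode

section LeafMove

variable {V : Type*} [Fintype V] {T S : SimpleGraph V} {u v w a b x p q : V} {m : ℕ} {z : ℕ → V}

omit [Fintype V] in
theorem IsLeafAt.dist_eq (hT : T.IsTree) (h : T.IsLeafAt p x) (hw : w ≠ x) :
    T.dist x w = T.dist p w + 1 := by
  obtain ⟨a, ha, ha'⟩ := hT.exists_adj_toward hw.symm
  obtain rfl := (h a).1 ha
  exact ha'

theorem IsLeafAt.mem_branch_iff (hT : T.IsTree) (h : T.IsLeafAt p x) (hu : u ≠ x) (hv : v ≠ x) :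
    x ∈ T.branch u v ↔ p ∈ T.branch u v := by
  rw [mem_branch, mem_branch, dist_comm (v := x), dist_comm (v := x), h.dist_eq hT hu,
    h.dist_eq hT hv, dist_comm (u := p), dist_comm (u := p)]
  omega

/-- `S` is obtained from the tree `T` by moving the leaf `x` from the vertex `z 0` to the vertex
`z m`, where `z 0, …, z m` is a path. -/
structure LeafMove (T S : SimpleGraph V) (x : V) (m : ℕ) (z : ℕ → V) : Prop where
  isTree_left : T.IsTree
  isTree_right : S.IsTree
  isLeafAt_left : T.IsLeafAt (z 0) x
  isLeafAt_right : S.IsLeafAt (z m) x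
  adj_iff : ∀ a b, a ≠ x → b ≠ x → (T.Adj a b ↔ S.Adj a b)
  ne : ∀ i ≤ m, z i ≠ x
  adj : ∀ i < m, T.Adj (z i) (z (i + 1))
  dist : ∀ i ≤ m, T.dist (z 0) (z i) = i ∧ T.dist (z i) (z m) + i = m

-- A shortest path of `T` between vertices other than the leaf `x` avoids `x`, so it survives in
-- `S`.
omit [Fintype V] in
theorem dist_le_dist_of_adj_iff (hT : T.IsTree) (hS : S.IsTree) (h : T.IsLeafAt p x)
    (hadj : ∀ a b, a ≠ x → b ≠ x → (T.Adj a b ↔ S.Adj a b)) (ha : a ≠ x) (hb : b ≠ x) :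
    S.dist a b ≤ T.dist a b := by
  induction hn : T.dist a b generalizing a with
  | zero => rw [hT.dist_eq_zero.1 hn, dist_self]
  | succ n ih =>
    have hab : a ≠ b := by
      rintro rfl
      simp at hn
    obtain ⟨c, hc, hc'⟩ := hT.exists_adj_toward hab
    have hcx : c ≠ x := by
      rintro rfl
      have := (h a).1 hc.symm
      have := h.dist_eq hT hb
      simp_all
    have h1 := ih hcx (by omega)
    have h2 := hS.connected.dist_triangle (u := a) (v := c) (w := b)
    have h3 : S.dist a c = 1 := dist_eq_one_iff_adj.2 ((hadj a c ha hcx).1 hc)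
    omega

namespace LeafMove

variable (h : LeafMove T S x m z)
include h

omit [Fintype V] in
theorem dist_eq (ha : a ≠ x) (hb : b ≠ x) : T.dist a b = S.dist a b :=
  le_antisymm
    (dist_le_dist_of_adj_iff h.isTree_right h.isTree_left h.isLeafAt_right
      (fun a b ha hb => (h.adj_iff a b ha hb).symm) ha hb)
    (dist_le_dist_of_adj_iff h.isTree_left h.isTree_right h.isLeafAt_left h.adj_iff ha hb)

omit [Fintype V] in
theorem symm : LeafMove S T x m fun i => z (m - i) where
  isTree_left := h.isTree_right
  isTree_right := h.isTree_left
  isLeafAt_left := h.isLeafAt_right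
  isLeafAt_right := by simpa using h.isLeafAt_left
  adj_iff a b ha hb := (h.adj_iff a b ha hb).symm
  ne i _ := h.ne _ (by omega)
  adj i hi := by
    have h1 := h.adj (m - (i + 1)) (by omega)
    rw [show m - (i + 1) + 1 = m - i by omega] at h1
    exact ((h.adj_iff _ _ (h.ne _ (by omega)) (h.ne _ (by omega))).1 h1).symm
  dist i hi := by
    have h1 := h.dist (m - i) (by omega)
    have h0 := h.dist 0 (by omega)
    simp only [Nat.sub_zero, Nat.sub_self]
    rw [← h.dist_eq (h.ne _ le_rfl) (h.ne _ (by omega)),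
      ← h.dist_eq (h.ne _ (by omega)) (h.ne _ (by omega)), dist_comm, dist_comm (v := z 0)]
    omega

theorem mem_branch_iff (hu : u ≠ x) (hv : v ≠ x) (hw : w ≠ x) :
    w ∈ T.branch u v ↔ w ∈ S.branch u v := by
  rw [mem_branch, mem_branch, h.dist_eq hu hw, h.dist_eq hv hw]

omit [Fintype V] in
theorem deleteIncidenceSet_eq : T.deleteIncidenceSet x = S.deleteIncidenceSet x := by
  ext a b
  rw [deleteIncidenceSet_adj, deleteIncidenceSet_adj]
  have := h.adj_iff a b
  tauto

theorem code_eq_of_notMem (hadj : T.Adj u v) (hu : u ≠ x) (hv : v ≠ x)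
    (h0 : z 0 ∉ T.branch u v) (hm : z m ∉ T.branch u v) : T.code u v = S.code u v := by
  rw [← code_deleteIncidenceSet_of_notMem h.isTree_left hadj, h.deleteIncidenceSet_eq,
    code_deleteIncidenceSet_of_notMem h.isTree_right ((h.adj_iff u v hu hv).1 hadj)]
  · rwa [h.isLeafAt_right.mem_branch_iff h.isTree_right hu hv,
      ← h.mem_branch_iff hu hv (h.ne _ le_rfl)]
  · rwa [h.isLeafAt_left.mem_branch_iff h.isTree_left hu hv]

theorem branch_eq_insert (hu : u ≠ x) (hv : v ≠ x) (h0 : z 0 ∈ T.branch u v)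
    (hm : z m ∉ T.branch u v) : T.branch u v = insert x (S.branch u v) ∧ x ∉ S.branch u v := by
  refine ⟨?_, ?_⟩
  · ext w
    rw [mem_insert]
    by_cases hw : w = x
    · subst hw
      simp [h.isLeafAt_left.mem_branch_iff h.isTree_left hu hv, h0]
    · simp [hw, h.mem_branch_iff hu hv hw]
  · rwa [h.isLeafAt_right.mem_branch_iff h.isTree_right hu hv,
      ← h.mem_branch_iff hu hv (h.ne _ le_rfl)]

theorem zero_mem_branch {i : ℕ} (hi : i < m) : z 0 ∈ T.branch (z (i + 1)) (z i) := by
  have h1 := (h.dist i hi.le).1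
  have h2 := (h.dist (i + 1) hi).1
  rw [mem_branch, dist_comm, dist_comm (u := z (i + 1))]
  omega

theorem last_notMem_branch {i : ℕ} (hi : i < m) : z m ∉ T.branch (z (i + 1)) (z i) := by
  have h1 := (h.dist i hi.le).2
  have h2 := (h.dist (i + 1) hi).2
  rw [mem_branch]
  omega

theorem exists_eq_of_mem_branch (hadj : T.Adj u v) (h0 : z 0 ∈ T.branch u v)
    (hm : z m ∉ T.branch u v) : ∃ i < m, v = z i ∧ u = z (i + 1) := by
  obtain ⟨i, hi, h1, h2⟩ := exists_crossing (P := fun i => z i ∈ T.branch u v) h0 hm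
  have := h.isTree_left.eq_of_adj_of_notMem_branch hadj h1 (h.adj i hi) h2
  exact ⟨i, hi, this.1.symm, this.2.symm⟩

omit [Fintype V] in
theorem ne_of_lt {i j : ℕ} (hij : i < j) (hj : j ≤ m) : z i ≠ z j := by
  intro he
  have h1 := (h.dist i (by omega)).1
  have h2 := (h.dist j hj).1
  rw [he] at h1
  omega

omit [Fintype V] in
theorem adj_right {i : ℕ} (hi : i < m) : S.Adj (z i) (z (i + 1)) :=
  (h.adj_iff _ _ (h.ne _ hi.le) (h.ne _ hi)).1 (h.adj i hi)

theorem card_branch_eq {i : ℕ} (hi : i < m) :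
    (T.branch (z (i + 1)) (z i)).card = (S.branch (z (i + 1)) (z i)).card + 1 := by
  obtain ⟨h1, h2⟩ := h.branch_eq_insert (h.ne _ hi) (h.ne _ hi.le) (h.zero_mem_branch hi)
    (h.last_notMem_branch hi)
  rw [h1, card_insert_of_notMem h2]

theorem size_code_eq {i : ℕ} (hi : i < m) :
    size (T.code (z (i + 1)) (z i)) = size (S.code (z (i + 1)) (z i)) + 1 := by
  rw [size_code h.isTree_left (h.adj i hi).symm, size_code h.isTree_right (h.adj_right hi).symm,
    h.card_branch_eq hi]

theorem size_code_lt {i j : ℕ} (hij : i < j) (hj : j < m) :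
    size (S.code (z (i + 1)) (z i)) < size (S.code (z (j + 1)) (z j)) := by
  induction j with
  | zero => omega
  | succ j ih =>
    have h1 : size (S.code (z (j + 1)) (z j)) < size (S.code (z (j + 1 + 1)) (z (j + 1))) := by
      rw [size_code h.isTree_right (h.adj_right (by omega)).symm,
        size_code h.isTree_right (h.adj_right (by omega)).symm]
      exact h.isTree_right.card_branch_lt (h.adj_right hj).symm (h.adj_right (by omega)).symm
        (h.ne_of_lt (by omega) (by omega))
    rcases Nat.lt_succ_iff_lt_or_eq.1 hij with h2 | rfl
    · exact (ih h2 (by omega)).trans h1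
    · exact h1

theorem card_branch_add_two_le {i : ℕ} (hi : i < m) :
    (S.branch (z (i + 1)) (z i)).card + 2 ≤ Fintype.card V := by
  have h1 := h.card_branch_eq hi
  have h2 := h.isTree_left.card_branch_add (h.adj i hi).symm
  have h3 := (h.adj i hi).one_le_card_branch
  omega

theorem code_cons (hadj : T.Adj u v) (hu : u ≠ x) (hv : v ≠ x) (ha : T.Adj v a) (hau : a ≠ u)
    (hax : a ≠ x) (h0 : z 0 ∈ T.branch v a) (hm : z m ∉ T.branch u v) :
    T.code u v = node (T.code v a ::ₘ (kids (S.code u v)).erase (S.code v a)) := by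
  have hk : T.kidSet u v = S.kidSet u v := by
    ext b
    rw [mem_kidSet, mem_kidSet, and_congr_left_iff]
    intro hbu
    by_cases hbx : b = x
    · subst hbx
      constructor
      · intro hb
        have := (h.isLeafAt_left v).1 hb.symm
        subst this
        exact absurd h0 left_notMem_branch
      · intro hb
        have := (h.isLeafAt_right v).1 hb.symm
        subst this
        exact absurd hadj.mem_branch_right hm
    · exact h.adj_iff v b hv hbx
  have hak : a ∈ (S.kidSet u v).val := by
    rw [Finset.mem_val, ← hk, mem_kidSet]; exact ⟨ha, hau⟩
  rw [code_eq h.isTree_left le_rfl hadj,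
    code_eq h.isTree_right le_rfl ((h.adj_iff u v hu hv).1 hadj), kids_node,
    ← Multiset.map_erase_of_mem _ _ hak, hk]
  congr 1
  conv_lhs => rw [← Multiset.cons_erase hak, Multiset.map_cons]
  congr 1
  refine Multiset.map_congr rfl fun b hb => ?_
  rw [(S.kidSet u v).nodup.mem_erase_iff, Finset.mem_val, ← hk, mem_kidSet] at hb
  have hd := Finset.disjoint_left.1 (h.isTree_left.disjoint_branch ha hb.2.1 hb.1.symm) h0
  refine h.code_eq_of_notMem hb.2.1 hv ?_ hd fun hmb => hm ?_
  · rintro rfl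
    have := (h.isLeafAt_left v).1 hb.2.1.symm
    subst this
    exact absurd h0 left_notMem_branch
  · exact h.isTree_left.branch_subset hadj hb.2.1 hb.2.2 hmb

theorem code_cons_zero (hadj : T.Adj u (z 0)) (hu : u ≠ x) (hm : z m ∉ T.branch u (z 0)) :
    T.code u (z 0) = node (pt ::ₘ kids (S.code u (z 0))) := by
  have h0x := h.ne 0 (Nat.zero_le _)
  have hx := h.isLeafAt_left.adj.symm
  have hxS : x ∉ S.kidSet u (z 0) := by
    rw [mem_kidSet]
    rintro ⟨hb, -⟩
    have := (h.isLeafAt_right _).1 hb.symm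
    exact hm (this ▸ hadj.mem_branch_right)
  have hk : T.kidSet u (z 0) = insert x (S.kidSet u (z 0)) := by
    ext b
    rw [mem_insert, mem_kidSet, mem_kidSet]
    by_cases hbx : b = x
    · subst hbx
      simp [hx, hu.symm]
    · simp [hbx, h.adj_iff _ b h0x hbx]
  rw [code_eq h.isTree_left le_rfl hadj,
    code_eq h.isTree_right le_rfl ((h.adj_iff _ _ hu h0x).1 hadj), kids_node, hk,
    Finset.insert_val_of_notMem hxS, Multiset.map_cons,
    (code_eq_pt_iff h.isTree_left hx).2 h.isLeafAt_left.not_isInner]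
  congr 2
  refine Multiset.map_congr rfl fun b hb => ?_
  rw [Finset.mem_val] at hb
  have hbx : b ≠ x := fun e => hxS (e ▸ hb)
  rw [mem_kidSet] at hb
  have hbT := (h.adj_iff _ _ h0x hbx).2 hb.1
  refine h.code_eq_of_notMem hbT h0x hbx left_notMem_branch fun hmb => hm ?_
  exact h.isTree_left.branch_subset hadj hbT hb.2 hmb

/-- A branch with `x` arises from the branch without `x` by enlarging the child on the path, or by
adding a leaf at the start of the path. This recipe depends only on branches without `x`, and those
match by `hP`. -/
theorem left_code_eq_right_code {j : ℕ} (hj : j < m)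
    (hP : ∀ i ≤ j, S.code (z (i + 1)) (z i) = T.code (z (m - (i + 1))) (z (m - i))) :
    T.code (z (j + 1)) (z j) = S.code (z (m - (j + 1))) (z (m - j)) := by
  have h' := h.symm
  induction j with
  | zero =>
    have h1 := h.code_cons_zero (h.adj 0 hj).symm (h.ne _ hj) (h.last_notMem_branch hj)
    have h2 := h'.code_cons_zero (h'.adj 0 hj).symm (h'.ne _ hj) (h'.last_notMem_branch hj)
    rw [h1, hP 0 le_rfl]
    exact h2.symm
  | succ j ih =>
    have h1 := h.code_cons (h.adj _ hj).symm (h.ne _ hj) (h.ne _ hj.le)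
      (h.adj j (by omega)).symm (h.ne_of_lt (by omega) (by omega)) (h.ne j (by omega))
      (h.zero_mem_branch (by omega)) (h.last_notMem_branch hj)
    have h2 := h'.code_cons (h'.adj _ hj).symm (h'.ne _ hj) (h'.ne _ hj.le)
      (h'.adj j (by omega)).symm (h'.ne_of_lt (by omega) (by omega)) (h'.ne j (by omega))
      (h'.zero_mem_branch (by omega)) (h'.last_notMem_branch hj)
    rw [h1, hP _ le_rfl, hP j (by omega), ih (by omega) fun i hi => hP i (by omega)]
    exact h2.symm

/-- A branch with both ends of the path contains a whole side of the edge between `z j` and `z (j +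
1)`. The near side has one vertex more in `T` than in `S`. The far side is at least as large as the
branch at `z (m - j)`, because `2 * j + 1 ≤ m`, and the inclusion is strict because of `x`. -/
theorem lt_card_branch_of_mem {j : ℕ} (hj : 2 * j + 1 ≤ m) (hadj : T.Adj u v) (hu : u ≠ x)
    (hv : v ≠ x) (h0 : z 0 ∈ T.branch u v) (hm : z m ∈ T.branch u v) :
    min (size (S.code (z (j + 1)) (z j))) (size (T.code (z (m - (j + 1))) (z (m - j)))) <
      (T.branch u v).card := by
  have hT := h.isTree_left
  have hjm : j < m := by omega
  have he := h.adj j hjm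
  have hz0 := h.zero_mem_branch hjm
  have hzm := h.last_notMem_branch hjm
  have hcross : ∀ a b, T.Adj a b → a ∈ T.branch (z (j + 1)) (z j) →
      b ∉ T.branch (z (j + 1)) (z j) → a = z j ∧ b = z (j + 1) :=
    fun a b hab ha hb => hT.eq_of_adj_of_notMem_branch he.symm ha hab hb
  by_cases hua : u ∈ T.branch (z (j + 1)) (z j)
  · by_cases hva : v ∈ T.branch (z (j + 1)) (z j)
    · have hsub := hT.branch_subset_of_mem (u := u) (v := v) he
        (by rwa [← hT.notMem_branch_iff he.symm, not_not] at *)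
        (by rwa [hT.notMem_branch_iff he] ) ((hT.notMem_branch_iff he.symm).1 hzm) hm
      have hxu : x ∈ T.branch u v := (h.isLeafAt_left.mem_branch_iff hT hu hv).2 h0
      have hxn : x ∉ T.branch (z j) (z (j + 1)) := by
        rw [hT.notMem_branch_iff he]
        exact (h.isLeafAt_left.mem_branch_iff hT (h.ne _ hjm) (h.ne _ hjm.le)).2 hz0
      have h1 : (T.branch (z j) (z (j + 1))).card < (T.branch u v).card :=
        Finset.card_lt_card ⟨hsub, fun hs => hxn (hs hxu)⟩
      have h2 : size (T.code (z (m - (j + 1))) (z (m - j))) ≤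
          (T.branch (z j) (z (j + 1))).card := by
        rw [← size_code hT he]
        rcases Nat.lt_or_ge j (m - (j + 1)) with hlt | hge
        · have := h.symm.size_code_lt hlt (by omega)
          rw [show m - (m - (j + 1) + 1) = j by omega, show m - (m - (j + 1)) = j + 1 by omega]
            at this
          exact this.le
        · rw [show m - (j + 1) = j by omega, show m - j = j + 1 by omega]
      omega
    · obtain ⟨rfl, rfl⟩ := hcross u v hadj hua hva
      rw [hT.notMem_branch_iff he.symm] at hzm
      rw [← hT.notMem_branch_iff he.symm] at h0
      exact absurd hz0 h0
  · by_cases hva : v ∈ T.branch (z (j + 1)) (z j)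
    · obtain ⟨rfl, rfl⟩ := hcross v u hadj.symm hva hua
      exact absurd hm hzm
    · have hsub := hT.branch_subset_of_mem he.symm hua hva hz0 h0
      have h1 := Finset.card_le_card hsub
      have h2 := h.card_branch_eq hjm
      rw [← size_code h.isTree_right (h.adj_right hjm).symm] at h2
      omega

end LeafMove

end LeafMove

end SimpleGraph

/-! ### Comparing the codes of two trees that differ in the position of a leaf -/

namespace SimpleGraph

open scoped Classical
open Finset TreeCode

section Compare

variable {V : Type*} [Fintype V] {T S : SimpleGraph V} {u v w a b x p q : V} {m : ℕ} {z : ℕ → V}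

/-- The sum of a function of codes over all darts. -/
noncomputable def dartSum (X : SimpleGraph V) (F : ℕ → ℕ) : ℕ :=
  ∑ d ∈ X.dartSet, F (X.code d.1 d.2)

theorem dartSum_eq_of_isLeafAt (hT : T.IsTree) (h : T.IsLeafAt p x) (F : ℕ → ℕ)
    (hF : F (T.code x p) = 0) :
    T.dartSum F = (∑ d ∈ (T.deleteIncidenceSet x).dartSet, F (T.code d.1 d.2)) + F pt := by
  have hset : T.dartSet = insert (p, x) (insert (x, p) (T.deleteIncidenceSet x).dartSet) := by
    ext ⟨a, b⟩
    simp only [mem_insert, mem_dartSet, Prod.mk.injEq, deleteIncidenceSet_adj]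
    constructor
    · intro hab
      by_cases ha : a = x
      · subst ha
        exact Or.inr (Or.inl ⟨rfl, (h b).1 hab⟩)
      · by_cases hb : b = x
        · subst hb
          exact Or.inl ⟨(h a).1 hab.symm, rfl⟩
        · exact Or.inr (Or.inr ⟨hab, ha, hb⟩)
    · rintro (⟨rfl, rfl⟩ | ⟨rfl, rfl⟩ | ⟨hab, -⟩)
      · exact h.adj.symm
      · exact h.adj
      · exact hab
  have hpx := h.adj.ne
  rw [dartSum, hset, Finset.sum_insert, Finset.sum_insert, hF,
    (code_eq_pt_iff hT h.adj.symm).2 h.not_isInner]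
  · ring
  · simp [deleteIncidenceSet_adj]
  · simp [deleteIncidenceSet_adj, hpx.symm]

namespace LeafMove

variable (h : LeafMove T S x m z)
include h

theorem sum_darts_across (f : V × V → ℕ) :
    ∑ d ∈ (T.deleteIncidenceSet x).dartSet with
        z 0 ∈ T.branch d.1 d.2 ∧ z m ∉ T.branch d.1 d.2, f d =
      ∑ i ∈ range m, f (z (i + 1), z i) := by
  symm
  refine Finset.sum_bij (fun i _ => (z (i + 1), z i)) ?_ ?_ ?_ (fun _ _ => rfl)
  · intro i hi
    rw [mem_range] at hi
    rw [mem_filter, mem_dartSet, deleteIncidenceSet_adj]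
    exact ⟨⟨(h.adj i hi).symm, h.ne _ hi, h.ne _ hi.le⟩, h.zero_mem_branch hi,
      h.last_notMem_branch hi⟩
  · intro i hi j hj hij
    rw [mem_range] at hi hj
    rw [Prod.mk.injEq] at hij
    by_contra hne
    rcases lt_or_gt_of_ne hne with hlt | hlt
    · exact h.ne_of_lt hlt hj.le hij.2
    · exact h.ne_of_lt hlt hi.le hij.2.symm
  · rintro ⟨u, v⟩ hd
    rw [mem_filter, mem_dartSet, deleteIncidenceSet_adj] at hd
    obtain ⟨i, hi, h1, h2⟩ := h.exists_eq_of_mem_branch hd.1.1 hd.2.1 hd.2.2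
    exact ⟨i, mem_range.2 hi, by simp only at h1 h2; rw [h1, h2]⟩

/-- The darts of the common deletion of `x` are compared one by one. Branches with neither end of
the path are unchanged, and those with both ends exceed the size bound. The others lie along the
path: before `j` they are exchanged with their mirror images, beyond `j` they are too large, and at
`j` only the two branches without `x` remain. -/
theorem dartSum_add_eq {j : ℕ} (hj : 2 * j + 1 ≤ m)
    (hP : ∀ i < j, S.code (z (i + 1)) (z i) = T.code (z (m - (i + 1))) (z (m - i))) (F : ℕ → ℕ)
    (hF : ∀ c, min (size (S.code (z (j + 1)) (z j)))
      (size (T.code (z (m - (j + 1))) (z (m - j)))) < size c → F c = 0) :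
    T.dartSum F + F (S.code (z (j + 1)) (z j)) =
      S.dartSum F + F (T.code (z (m - (j + 1))) (z (m - j))) := by
  have h' := h.symm
  have hjm : j < m := by omega
  set s := min (size (S.code (z (j + 1)) (z j)))
      (size (T.code (z (m - (j + 1))) (z (m - j)))) with hs
  have hsV : s + 2 ≤ Fintype.card V := by
    have h1 := h.card_branch_add_two_le hjm
    rw [← size_code h.isTree_right (h.adj_right hjm).symm] at h1
    omega
  have hFx : ∀ {X : SimpleGraph V} {y : V}, X.IsTree → X.IsLeafAt y x → F (X.code x y) = 0 := by
    intro X y hX hy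
    apply hF
    have h1 := hX.card_branch_add hy.adj
    rw [hy.branch_eq hX, card_singleton] at h1
    rw [size_code hX hy.adj]
    omega
  rw [dartSum_eq_of_isLeafAt h.isTree_left h.isLeafAt_left F (hFx h.isTree_left h.isLeafAt_left),
    dartSum_eq_of_isLeafAt h.isTree_right h.isLeafAt_right F
      (hFx h.isTree_right h.isLeafAt_right), ← h.deleteIncidenceSet_eq]
  set R := (T.deleteIncidenceSet x).dartSet with hR
  have hRadj : ∀ d ∈ R, T.Adj d.1 d.2 ∧ d.1 ≠ x ∧ d.2 ≠ x := by
    intro d hd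
    rwa [hR, mem_dartSet, deleteIncidenceSet_adj] at hd
  -- The index `i` stands for a dart whose branch contains only the first end of the path, together
  -- with the mirror image of this dart.
  have hsplit : ∀ f : V × V → ℕ, ∑ d ∈ R, f d =
      (∑ i ∈ range m, (f (z (i + 1), z i) + f (z (m - (i + 1)), z (m - i)))) +
        ∑ d ∈ R with (z 0 ∈ T.branch d.1 d.2 ↔ z m ∈ T.branch d.1 d.2), f d := by
    intro f
    have h2 := h'.sum_darts_across f
    rw [← h.deleteIncidenceSet_eq] at h2
    simp only [Nat.sub_zero, Nat.sub_self] at h2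
    rw [Finset.sum_add_distrib, ← h.sum_darts_across f, ← h2, Finset.sum_filter, Finset.sum_filter,
      Finset.sum_filter, ← Finset.sum_add_distrib, ← Finset.sum_add_distrib]
    refine Finset.sum_congr rfl fun d hd => ?_
    obtain ⟨-, hd1, hd2⟩ := hRadj d hd
    simp only [← h.mem_branch_iff hd1 hd2 (h.ne 0 (Nat.zero_le _)),
      ← h.mem_branch_iff hd1 hd2 (h.ne m le_rfl)]
    by_cases h1 : z 0 ∈ T.branch d.1 d.2 <;> by_cases h2 : z m ∈ T.branch d.1 d.2 <;>
      simp [h1, h2]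
  have hrest : ∑ d ∈ R with (z 0 ∈ T.branch d.1 d.2 ↔ z m ∈ T.branch d.1 d.2),
      F (T.code d.1 d.2) =
      ∑ d ∈ R with (z 0 ∈ T.branch d.1 d.2 ↔ z m ∈ T.branch d.1 d.2), F (S.code d.1 d.2) := by
    refine Finset.sum_congr rfl fun d hd => ?_
    rw [mem_filter] at hd
    obtain ⟨hdR, hiff⟩ := hd
    obtain ⟨hadj, hd1, hd2⟩ := hRadj d hdR
    by_cases h0 : z 0 ∈ T.branch d.1 d.2
    · have hm := hiff.1 h0
      have hadjS := (h.adj_iff _ _ hd1 hd2).1 hadj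
      have h1 := h.lt_card_branch_of_mem hj hadj hd1 hd2 h0 hm
      have h2 := h'.lt_card_branch_of_mem hj hadjS hd1 hd2
        (by simpa using (h.mem_branch_iff hd1 hd2 (h.ne m le_rfl)).1 hm)
        (by simpa using (h.mem_branch_iff hd1 hd2 (h.ne 0 (Nat.zero_le _))).1 h0)
      rw [show m - (m - (j + 1)) = j + 1 by omega, show m - (m - j) = j by omega, min_comm] at h2
      rw [hF _ (by rw [size_code h.isTree_left hadj]; exact h1),
        hF _ (by rw [size_code h.isTree_right hadjS]; exact h2)]
    · rw [h.code_eq_of_notMem hadj hd1 hd2 h0 fun hm => h0 (hiff.2 hm)]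
  rw [hsplit fun d => F (T.code d.1 d.2), hsplit fun d => F (S.code d.1 d.2), hrest]
  have hjr : j ∈ range m := mem_range.2 hjm
  rw [← Finset.add_sum_erase _ _ hjr, ← Finset.add_sum_erase (range m) (fun i =>
    F (S.code (z (i + 1)) (z i)) + F (S.code (z (m - (i + 1))) (z (m - i)))) hjr]
  have hmain : ∑ i ∈ (range m).erase j,
      (F (T.code (z (i + 1)) (z i)) + F (T.code (z (m - (i + 1))) (z (m - i)))) =
      ∑ i ∈ (range m).erase j,
      (F (S.code (z (i + 1)) (z i)) + F (S.code (z (m - (i + 1))) (z (m - i)))) := by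
    refine Finset.sum_congr rfl fun i hi => ?_
    rw [mem_erase, mem_range] at hi
    rcases lt_or_gt_of_ne hi.1 with hlt | hlt
    · rw [h.left_code_eq_right_code hi.2 fun k hk => hP k (by omega), hP i hlt, add_comm]
    · have h1 := h.size_code_lt hlt hi.2
      have h2 := h'.size_code_lt hlt hi.2
      have h3 := h.size_code_eq hi.2
      have h4 := h'.size_code_eq hi.2
      rw [hF _ (by omega), hF _ (by omega), hF _ (by omega), hF _ (by omega)]
  have h3 := h.size_code_eq hjm
  have h4 := h'.size_code_eq hjm
  rw [hmain, hF (T.code (z (j + 1)) (z j)) (by omega),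
    hF (S.code (z (m - (j + 1))) (z (m - j))) (by omega)]
  ring

/-- Two trees that differ in the position of a leaf and whose deep leaves have the same deletions
have the same codes on both ends of the path along which the leaf moves. -/
theorem code_eq_code
    (hcard : ∀ τ, (T.deepLabelSet τ).card = (S.deepLabelSet τ).card)
    (hcount : ∀ τ c, ∑ y ∈ T.deepLabelSet τ, (T.deleteIncidenceSet y).codeCount c =
      ∑ y ∈ S.deepLabelSet τ, (S.deleteIncidenceSet y).codeCount c)
    (hpt : T.codeCount pt = S.codeCount pt) {j : ℕ} (hj : 2 * j + 1 ≤ m) :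
    S.code (z (j + 1)) (z j) = T.code (z (m - (j + 1))) (z (m - j)) := by
  induction j using Nat.strong_induction_on with
  | _ j ih =>
    have key := fun F => h.dartSum_add_eq hj (fun i hi => ih i hi (by omega)) F
    have hjm : j < m := by omega
    have hsV : size (S.code (z (j + 1)) (z j)) + 2 ≤ Fintype.card V := by
      have h1 := h.card_branch_add_two_le hjm
      rwa [← size_code h.isTree_right (h.adj_right hjm).symm] at h1
    set P := S.code (z (j + 1)) (z j) with hPdef
    set Q := T.code (z (m - (j + 1))) (z (m - j)) with hQdef
    set s := min (size P) (size Q) with hs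
    have hs1 : 1 ≤ s := le_min (one_le_size _) (one_le_size _)
    have hcc : ∀ c, size c ≤ s → T.codeCount c + (if P = c then 1 else 0) =
        S.codeCount c + if Q = c then 1 else 0 := by
      intro c hc
      refine key (fun e => if e = c then 1 else 0) fun e he => if_neg ?_
      rintro rfl
      omega
    -- In size one the equality of the numbers of leaves decides.
    by_cases hs1' : s = 1
    · have h1 := hcc pt (by rw [size_pt]; omega)
      have h2 : P = pt ∨ Q = pt := by rw [← size_eq_one, ← size_eq_one]; omega
      by_cases hP : P = pt
      · by_cases hQ : Q = pt
        · rw [hP, hQ]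
        · rw [if_pos hP, if_neg hQ] at h1; omega
      · by_cases hQ : Q = pt
        · rw [if_neg hP, if_pos hQ] at h1; omega
        · tauto
    -- Codes of size `s - 1` occur equally often in both trees, so the counting equations give equal
    -- total decks over the branches of size `s`. By `key` these totals differ only by the
    -- contributions of `P` and `Q`.
    · have hdeck : ∀ e : ℕ × Bool,
          (if size P = s then (leafDeck P).count e else 0) =
            if size Q = s then (leafDeck Q).count e else 0 := by
        rintro ⟨c, τ⟩
        by_cases hc : size c + 1 = s
        · have h1 := sum_codeCount_deleteIncidenceSet h.isTree_left τ (c := c) (s := s) (by omega)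
            (by omega) hc
          have h2 := sum_codeCount_deleteIncidenceSet h.isTree_right τ (c := c) (s := s) (by omega)
            (by omega) hc
          have h3 : T.codeCount c = S.codeCount c := by
            have := hcc c (by omega)
            rwa [if_neg, if_neg, add_zero, add_zero] at this
            · rintro rfl; omega
            · rintro rfl; omega
          rw [hcount τ c, hcard τ, h3] at h1
          have h4 := key (fun e => if size e = s then (leafDeck e).count (c, τ) else 0)
            fun e he => if_neg (by omega)
          simp only [dartSum] at h4
          omega
        · have : ∀ e, size e = s → (leafDeck e).count (c, τ) = 0 := by
            intro e he
            rw [Multiset.count_eq_zero]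
            intro hmem
            have := size_of_mem_leafDeck hmem
            simp only at this
            omega
          by_cases hP : size P = s <;> by_cases hQ : size Q = s
          · rw [if_pos hP, if_pos hQ, this P hP, this Q hQ]
          · rw [if_pos hP, if_neg hQ, this P hP]
          · rw [if_neg hP, if_pos hQ, this Q hQ]
          · rw [if_neg hP, if_neg hQ]
      by_cases hP : size P = s
      · by_cases hQ : size Q = s
        · simp only [hP, hQ, if_true] at hdeck
          exact eq_of_leafDeck_eq (hP.trans hQ.symm) (Multiset.ext.2 hdeck)
        -- If only one of `P` and `Q` had size `s`, its deck would be empty, which is impossible for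
        -- `s ≥ 2`.
        · simp only [hP, hQ, if_true, if_false] at hdeck
          refine absurd (Multiset.eq_zero_of_forall_notMem fun e => ?_)
            (leafDeck_ne_zero (c := P) ?_)
          · exact Multiset.count_eq_zero.1 (hdeck e)
          · rintro hpt'
            rw [hpt', size_pt] at hP
            omega
      · have hQ : size Q = s := by omega
        simp only [hP, hQ, if_true, if_false] at hdeck
        refine absurd (Multiset.eq_zero_of_forall_notMem fun e => ?_)
          (leafDeck_ne_zero (c := Q) ?_)
        · exact Multiset.count_eq_zero.1 (hdeck e).symm
        · rintro hpt'
          rw [hpt', size_pt] at hQ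
          omega

end LeafMove

end Compare

end SimpleGraph

/-! ### Isomorphisms and codes -/

namespace SimpleGraph

open scoped Classical
open Finset TreeCode

section Iso

variable {V W : Type*} [Fintype V] [Fintype W] {T X : SimpleGraph V} {S Y : SimpleGraph W}
  {u v w a b x y : V} {u' v' : W}

theorem exists_injOn_of_map_eq {α β γ : Type*} [Nonempty β] {f : α → γ} {g : β → γ}
    {s : Finset α} {t : Finset β} (h : s.val.map f = t.val.map g) :
    ∃ σ : α → β, (∀ a ∈ s, σ a ∈ t ∧ g (σ a) = f a) ∧ Set.InjOn σ s := by
  induction s using Finset.induction generalizing t with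
  | empty => exact ⟨fun _ => Classical.arbitrary β, by simp, by simp⟩
  | insert a s ha ih =>
    rw [Finset.insert_val_of_notMem ha, Multiset.map_cons] at h
    have hmem : f a ∈ t.val.map g := h ▸ Multiset.mem_cons_self _ _
    obtain ⟨b, hb, hba⟩ := Multiset.mem_map.1 hmem
    have h' : s.val.map f = (t.erase b).val.map g := by
      rw [← Multiset.cons_erase hb, Multiset.map_cons, hba, Multiset.cons_inj_right,
        ← Finset.erase_val] at h
      exact h
    obtain ⟨σ, h1, h2⟩ := ih h'
    have hne : ∀ c ∈ s, c ≠ a := fun c hc e => ha (e ▸ hc)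
    refine ⟨Function.update σ a b, fun c hc => ?_, ?_⟩
    · rcases Finset.mem_insert.1 hc with rfl | hc
      · simp only [Function.update_self]
        exact ⟨hb, hba⟩
      · rw [Function.update_of_ne (hne c hc)]
        exact ⟨Finset.mem_of_mem_erase (h1 c hc).1, (h1 c hc).2⟩
    · have hb' : ∀ c ∈ s, σ c ≠ b := fun c hc => Finset.ne_of_mem_erase (h1 c hc).1
      intro c hc d hd hcd
      rcases Finset.mem_insert.1 (Finset.mem_coe.1 hc) with rfl | hc' <;>
        rcases Finset.mem_insert.1 (Finset.mem_coe.1 hd) with rfl | hd'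
      · rfl
      · rw [Function.update_self, Function.update_of_ne (hne d hd')] at hcd
        exact absurd hcd.symm (hb' d hd')
      · rw [Function.update_self, Function.update_of_ne (hne c hc')] at hcd
        exact absurd hcd (hb' c hc')
      · rw [Function.update_of_ne (hne c hc'), Function.update_of_ne (hne d hd')] at hcd
        exact h2 hc' hd' hcd

/-- Equal codes match the children of `v` injectively with children of `v'` of the same codes. The
embeddings of their branches are glued; the branches are disjoint and no edge joins two of them. -/
theorem exists_branch_embedding (hT : T.IsTree) (hS : S.IsTree) (h : T.Adj u v) (h' : S.Adj u' v')
    (hc : T.code u v = S.code u' v') :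
    ∃ f : V → W, f v = v' ∧ Set.InjOn f (T.branch u v) ∧
      (∀ w ∈ T.branch u v, f w ∈ S.branch u' v') ∧
      ∀ a ∈ T.branch u v, ∀ b ∈ T.branch u v, T.Adj a b → S.Adj (f a) (f b) := by
  induction hn : (T.branch u v).card using Nat.strong_induction_on generalizing u v u' v' with
  | _ n ih =>
    subst hn
    rw [code_eq hT le_rfl h, code_eq hS le_rfl h', EmbeddingLike.apply_eq_iff_eq] at hc
    have : Nonempty W := ⟨v'⟩
    obtain ⟨σ, hσ, hσi⟩ := exists_injOn_of_map_eq hc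
    have hK : ∀ a ∈ T.kidSet u v, T.Adj v a ∧ a ≠ u := fun a ha => mem_kidSet.1 ha
    have hK' : ∀ a ∈ T.kidSet u v, S.Adj v' (σ a) ∧ σ a ≠ u' := fun a ha =>
      mem_kidSet.1 (hσ a ha).1
    have hex : ∀ a : V, ∃ f : V → W, a ∈ T.kidSet u v → f a = σ a ∧
        Set.InjOn f (T.branch v a) ∧ (∀ w ∈ T.branch v a, f w ∈ S.branch v' (σ a)) ∧
        ∀ b ∈ T.branch v a, ∀ c ∈ T.branch v a, T.Adj b c → S.Adj (f b) (f c) := by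
      intro a
      by_cases ha : a ∈ T.kidSet u v
      · obtain ⟨f, hf⟩ := ih _ (hT.card_branch_lt h (hK a ha).1 (hK a ha).2) (hK a ha).1
          (hK' a ha).1 (hσ a ha).2.symm rfl
        exact ⟨f, fun _ => hf⟩
      · exact ⟨fun _ => v', fun ha' => absurd ha' ha⟩
    choose F hF using hex
    -- The default value serves `v` itself, which lies in none of the branches of its children.
    let f : V → W := fun w =>
      if hw : ∃ a ∈ T.kidSet u v, w ∈ T.branch v a then F hw.choose w else v'
    have hfv : f v = v' := by
      refine dif_neg ?_
      rintro ⟨a, -, hva⟩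
      exact left_notMem_branch hva
    have hf : ∀ a ∈ T.kidSet u v, ∀ w ∈ T.branch v a, f w = F a w := by
      intro a ha w hw
      have hex : ∃ a ∈ T.kidSet u v, w ∈ T.branch v a := ⟨a, ha, hw⟩
      have h1 : f w = F hex.choose w := dif_pos hex
      have h2 := hex.choose_spec
      have h3 : hex.choose = a := by
        by_contra hne
        exact Finset.disjoint_left.1
          (hT.disjoint_branch (hK _ h2.1).1 (hK a ha).1 hne) h2.2 hw
      rw [h1, h3]
    have hcases : ∀ w ∈ T.branch u v, w = v ∨ ∃ a ∈ T.kidSet u v, w ∈ T.branch v a := by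
      intro w hw
      rcases (hT.mem_branch_iff_eq_or h).1 hw with h1 | ⟨a, ha, hwa⟩
      · exact Or.inl h1
      · exact Or.inr ⟨a, mem_kidSet.2 ha, hwa⟩
    have hmaps : ∀ a ∈ T.kidSet u v, ∀ w ∈ T.branch v a, f w ∈ S.branch v' (σ a) := by
      intro a ha w hw
      rw [hf a ha w hw]
      exact (hF a ha).2.2.1 w hw
    have hadjv : ∀ a ∈ T.branch u v, T.Adj v a → S.Adj v' (f a) := by
      intro a ha hva
      have hak : a ∈ T.kidSet u v := by
        refine mem_kidSet.2 ⟨hva, ?_⟩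
        rintro rfl
        exact left_notMem_branch ha
      rw [hf a hak a hva.mem_branch_right, (hF a hak).1]
      exact (hK' a hak).1
    refine ⟨f, hfv, ?_, ?_, ?_⟩
    · intro w hw w' hw' he
      rcases hcases w hw with rfl | ⟨a, ha, hwa⟩ <;> rcases hcases w' hw' with rfl | ⟨b, hb, hwb⟩
      · rfl
      · have := hmaps b hb w' hwb
        rw [← he, hfv] at this
        exact absurd this left_notMem_branch
      · have := hmaps a ha w hwa
        rw [he, hfv] at this
        exact absurd this left_notMem_branch
      · by_cases hab : a = b
        · subst hab
          rw [hf a ha w hwa, hf a ha w' hwb] at he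
          exact (hF a ha).2.1 hwa hwb he
        · have h1 := hmaps a ha w hwa
          have h2 := hmaps b hb w' hwb
          rw [he] at h1
          exact absurd h2 (Finset.disjoint_left.1 (hS.disjoint_branch (hK' a ha).1 (hK' b hb).1
            fun hab' => hab (hσi ha hb hab')) h1)
    · intro w hw
      rcases hcases w hw with rfl | ⟨a, ha, hwa⟩
      · rw [hfv]; exact h'.mem_branch_right
      · exact hS.branch_subset h' (hK' a ha).1 (hK' a ha).2 (hmaps a ha w hwa)
    · intro a ha b hb hab
      rcases hcases a ha with rfl | ⟨c, hc, hac⟩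
      · rw [hfv]; exact hadjv b hb hab
      rcases hcases b hb with rfl | ⟨d, hd, hbd⟩
      · rw [hfv]; exact (hadjv a ha hab.symm).symm
      by_cases hcd : b ∈ T.branch v c
      · rw [hf c hc a hac, hf c hc b hcd]
        exact (hF c hc).2.2.2 a hac b hcd hab
      · have := (hT.eq_of_adj_of_notMem_branch (hK c hc).1 hac hab hcd).2
        subst this
        exact absurd hbd left_notMem_branch

/-- An injective homomorphism between trees with the same number of vertices is an isomorphism. -/
theorem IsTree.nonempty_iso_of_injective (hT : T.IsTree) (hS : S.IsTree) {f : V → W}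
    (hf : Function.Injective f) (hcard : Fintype.card V = Fintype.card W)
    (hadj : ∀ a b, T.Adj a b → S.Adj (f a) (f b)) : Nonempty (T ≃g S) := by
  have hbij : Function.Bijective f := (Fintype.bijective_iff_injective_and_card f).2 ⟨hf, hcard⟩
  have hle : T ≤ S.comap f := fun a b h => hadj a b h
  have hac : (S.comap f).IsAcyclic :=
    IsAcyclic.comap (⟨f, fun h => h⟩ : S.comap f →g S) hf hS.isAcyclic
  -- A tree is a maximal acyclic graph, so the acyclic graph pulled back from `S` cannot have more
  -- edges than `T`.
  have hge := (isTree_iff_maximal_isAcyclic.1 hT).2.2 hac hle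
  exact ⟨⟨Equiv.ofBijective f hbij, fun {a b} => ⟨fun h => hge h, fun h => hadj a b h⟩⟩⟩

/-- The two sides of an edge cover the tree and are joined by this edge only, so the embeddings of
the sides combine to an injective homomorphism. -/
theorem nonempty_iso_of_code_eq (hT : T.IsTree) (hS : S.IsTree) (h : T.Adj u v)
    (h' : S.Adj u' v') (h1 : T.code u v = S.code u' v') (h2 : T.code v u = S.code v' u') :
    Nonempty (T ≃g S) := by
  obtain ⟨f, hfv, hfi, hfm, hfa⟩ := exists_branch_embedding hT hS h h' h1
  obtain ⟨g, hgu, hgi, hgm, hga⟩ := exists_branch_embedding hT hS h.symm h'.symm h2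
  have hcard : Fintype.card V = Fintype.card W := by
    rw [← hT.card_branch_add h, ← hS.card_branch_add h', ← size_code hT h, ← size_code hS h',
      ← size_code hT h.symm, ← size_code hS h'.symm, h1, h2]
  let F : V → W := fun w => if w ∈ T.branch u v then f w else g w
  have hF1 : ∀ w ∈ T.branch u v, F w = f w := fun w hw => if_pos hw
  have hF2 : ∀ w ∉ T.branch u v, F w = g w := fun w hw => if_neg hw
  have hdis : ∀ a ∈ T.branch u v, ∀ b ∉ T.branch u v, F a ≠ F b := by
    intro a ha b hb he
    rw [hF1 a ha, hF2 b hb] at he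
    have h3 := hfm a ha
    have h4 := hgm b ((hT.notMem_branch_iff h).1 hb)
    rw [← he, ← hS.notMem_branch_iff h'] at h4
    exact h4 h3
  have hcross : ∀ a ∈ T.branch u v, ∀ b ∉ T.branch u v, T.Adj a b → S.Adj (F a) (F b) := by
    intro a ha b hb hab
    obtain ⟨rfl, rfl⟩ := hT.eq_of_adj_of_notMem_branch h ha hab hb
    rw [hF1 a ha, hF2 b hb, hfv, hgu]
    exact h'.symm
  refine hT.nonempty_iso_of_injective hS (f := F) ?_ hcard ?_
  · intro a b he
    by_cases ha : a ∈ T.branch u v <;> by_cases hb : b ∈ T.branch u v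
    · rw [hF1 a ha, hF1 b hb] at he
      exact hfi ha hb he
    · exact absurd he (hdis a ha b hb)
    · exact absurd he.symm (hdis b hb a ha)
    · rw [hF2 a ha, hF2 b hb] at he
      exact hgi ((hT.notMem_branch_iff h).1 ha) ((hT.notMem_branch_iff h).1 hb) he
  · intro a b hab
    by_cases ha : a ∈ T.branch u v <;> by_cases hb : b ∈ T.branch u v
    · rw [hF1 a ha, hF1 b hb]; exact hfa a ha b hb hab
    · exact hcross a ha b hb hab
    · exact (hcross b hb a ha hab.symm).symm
    · rw [hF2 a ha, hF2 b hb]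
      exact hga a ((hT.notMem_branch_iff h).1 ha) b ((hT.notMem_branch_iff h).1 hb) hab

theorem codeAux_iso (e : X ≃g Y) (k : ℕ) (u v : V) :
    X.codeAux k u v = Y.codeAux k (e u) (e v) := by
  induction k generalizing u v with
  | zero => rfl
  | succ k ih =>
    rw [codeAux, codeAux]
    congr 1
    have hk : Y.kidSet (e u) (e v) = (X.kidSet u v).map e.toEquiv.toEmbedding := by
      ext w
      obtain ⟨a, rfl⟩ := e.surjective w
      rw [mem_kidSet, Finset.mem_map]
      constructor
      · rintro ⟨h1, h2⟩
        refine ⟨a, mem_kidSet.2 ⟨e.map_adj_iff.1 h1, fun h => h2 (h ▸ rfl)⟩, rfl⟩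
      · rintro ⟨b, hb, hba⟩
        obtain rfl := e.injective hba
        rw [mem_kidSet] at hb
        exact ⟨e.map_adj_iff.2 hb.1, fun h => hb.2 (e.injective h)⟩
    rw [hk, Finset.map_val, Multiset.map_map]
    exact Multiset.map_congr rfl fun a _ => ih v a

theorem codeCount_iso (e : X ≃g Y) (c : ℕ) : X.codeCount c = Y.codeCount c := by
  have hcode : ∀ u v, X.code u v = Y.code (e u) (e v) := by
    intro u v
    rw [code, code, codeAux_iso e, Fintype.card_congr e.toEquiv]
  rw [codeCount, codeCount]
  refine Finset.sum_bij (fun d _ => (e d.1, e d.2)) ?_ ?_ ?_ ?_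
  · intro d hd
    rw [mem_dartSet] at hd ⊢
    exact e.map_adj_iff.2 hd
  · rintro ⟨a, b⟩ - ⟨c, d⟩ - h
    simpa [Prod.ext_iff] using h
  · rintro ⟨a, b⟩ hd
    obtain ⟨a, rfl⟩ := e.surjective a
    obtain ⟨b, rfl⟩ := e.surjective b
    rw [mem_dartSet] at hd
    exact ⟨(a, b), mem_dartSet.2 (e.map_adj_iff.1 hd), rfl⟩
  · intro d _
    rw [hcode]

omit [Fintype V] [Fintype W] in
/-- An isomorphism of vertex-deleted subgraphs extends to the whole vertex sets. -/
theorem exists_equiv_of_induce_iso {x : V} {y : W}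
    (e : T.induce ({x}ᶜ : Set V) ≃g S.induce ({y}ᶜ : Set W)) :
    ∃ ψ : V ≃ W, ψ x = y ∧ ∀ a b, a ≠ x → b ≠ x → (T.Adj a b ↔ S.Adj (ψ a) (ψ b)) := by
  let f : V → W := fun a => if h : a = x then y else (e ⟨a, h⟩).1
  let g : W → V := fun a => if h : a = y then x else (e.symm ⟨a, h⟩).1
  have hfx : f x = y := dif_pos rfl
  have hgy : g y = x := dif_pos rfl
  have hf : ∀ a (h : a ≠ x), f a = (e ⟨a, h⟩).1 := fun a h => dif_neg h
  have hg : ∀ a (h : a ≠ y), g a = (e.symm ⟨a, h⟩).1 := fun a h => dif_neg h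
  have hfne : ∀ a, a ≠ x → f a ≠ y := fun a h => by rw [hf a h]; exact (e ⟨a, h⟩).2
  have hgne : ∀ a, a ≠ y → g a ≠ x := fun a h => by rw [hg a h]; exact (e.symm ⟨a, h⟩).2
  refine ⟨⟨f, g, fun a => ?_, fun a => ?_⟩, hfx, fun a b ha hb => ?_⟩
  · by_cases h : a = x
    · rw [h, hfx, hgy]
    · rw [hg _ (hfne a h)]
      have : (⟨f a, hfne a h⟩ : ({y}ᶜ : Set W)) = e ⟨a, h⟩ := Subtype.ext (hf a h)
      rw [this, e.symm_apply_apply]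
  · by_cases h : a = y
    · rw [h, hgy, hfx]
    · rw [hf _ (hgne a h)]
      have : (⟨g a, hgne a h⟩ : ({x}ᶜ : Set V)) = e.symm ⟨a, h⟩ := Subtype.ext (hg a h)
      rw [this, e.apply_symm_apply]
  · have := e.map_adj_iff (v := ⟨a, ha⟩) (w := ⟨b, hb⟩)
    simp only [comap_adj, Function.Embedding.coe_subtype] at this
    simp only [Equiv.coe_fn_mk]
    rw [hf a ha, hf b hb, this]

theorem codeCount_eq_of_induce_iso {x : V} {y : W}
    (e : T.induce ({x}ᶜ : Set V) ≃g S.induce ({y}ᶜ : Set W)) (c : ℕ) :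
    (T.deleteIncidenceSet x).codeCount c = (S.deleteIncidenceSet y).codeCount c := by
  obtain ⟨ψ, rfl, h⟩ := exists_equiv_of_induce_iso e
  refine codeCount_iso ⟨ψ, fun {a b} => ?_⟩ c
  rw [deleteIncidenceSet_adj, deleteIncidenceSet_adj, ψ.injective.ne_iff, ψ.injective.ne_iff]
  have := h a b
  tauto

end Iso

/-! ### Isomorphism by reversing the path. -/

namespace LeafMove

variable {V : Type*} [Fintype V] {T S : SimpleGraph V} {x : V} {m : ℕ} {z : ℕ → V}

/-- Comparing the two sides of one edge in the middle suffices. For odd `m` it is the middle edge of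
the path; for even `m` it is an edge at the middle vertex. -/
theorem nonempty_iso (h : LeafMove T S x m z)
    (hP : ∀ j, 2 * j + 1 ≤ m → S.code (z (j + 1)) (z j) = T.code (z (m - (j + 1))) (z (m - j))) :
    Nonempty (T ≃g S) := by
  have hP' : ∀ j, 2 * j + 1 ≤ m →
      T.code (z (j + 1)) (z j) = S.code (z (m - (j + 1))) (z (m - j)) :=
    fun j hj => h.left_code_eq_right_code (by omega) fun i hi => hP i (by omega)
  rcases Nat.even_or_odd' m with ⟨j, hj | hj⟩
  · rcases Nat.eq_zero_or_pos j with rfl | hjpos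
    · have hTS : T = S := by
        have hm : m = 0 := by omega
        subst hm
        ext a b
        by_cases ha : a = x
        · rw [ha, h.isLeafAt_left b, h.isLeafAt_right b]
        · by_cases hb : b = x
          · rw [hb, T.adj_comm, S.adj_comm, h.isLeafAt_left a, h.isLeafAt_right a]
          · exact h.adj_iff a b ha hb
      exact hTS ▸ ⟨RelIso.refl _⟩
    · obtain ⟨j, rfl⟩ : ∃ i, j = i + 1 := ⟨j - 1, by omega⟩
      have h1 := hP j (by omega)
      have h2 := hP' j (by omega)
      rw [show m - (j + 1) = j + 1 by omega, show m - j = j + 2 by omega] at h1 h2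
      have hadj := h.adj j (by omega)
      have hadj1 := h.adj (j + 1) (by omega)
      have hadjS := h.adj_right (i := j) (by omega)
      have hadjS1 := h.adj_right (i := j + 1) (by omega)
      have hx1 := h.ne (j + 1) (by omega)
      -- The middle vertex is `z (j + 1)`. Its edge to `z j` in `T` is matched with its edge to `z
      -- (j + 2)` in `S`; the branches off the path contain neither end of the path.
      refine nonempty_iso_of_code_eq h.isTree_left h.isTree_right hadj.symm hadjS1 h2 ?_
      set c := z (j + 1) with hc
      set C := (univ.filter fun w => T.Adj c w ∧ w ≠ z j ∧ w ≠ z (j + 2)) with hC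
      have hne2 : z j ≠ z (j + 2) := h.ne_of_lt (by omega) (by omega)
      have hnx : ¬ T.Adj c x := by
        intro hcx
        have := (h.isLeafAt_left c).1 hcx.symm
        exact h.ne_of_lt (i := 0) (j := j + 1) (by omega) (by omega) this.symm
      have hnx' : ¬ S.Adj c x := by
        intro hcx
        have := (h.isLeafAt_right c).1 hcx.symm
        exact h.ne_of_lt (i := j + 1) (j := m) (by omega) (by omega) this
      have hTS : ∀ w, T.Adj c w ↔ S.Adj c w := by
        intro w
        by_cases hw : w = x
        · rw [hw]; exact iff_of_false hnx hnx'
        · exact h.adj_iff c w hx1 hw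
      have hk1 : T.kidSet (z j) c = insert (z (j + 2)) C := by
        ext w
        rw [mem_kidSet, mem_insert, hC, mem_filter]
        by_cases hw : w = z (j + 2)
        · subst hw
          simp only [true_or, iff_true]
          exact ⟨hadj1, hne2.symm⟩
        · simp [hw]
      have hk2 : S.kidSet (z (j + 2)) c = insert (z j) C := by
        ext w
        rw [mem_kidSet, mem_insert, hC, mem_filter, ← hTS]
        by_cases hw : w = z j
        · subst hw
          simp only [true_or, iff_true]
          exact ⟨hadj.symm, hne2⟩
        · simp [hw]
      rw [code_eq h.isTree_left le_rfl hadj, code_eq h.isTree_right le_rfl hadjS1.symm, hk1, hk2,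
        Finset.insert_val_of_notMem (by simp [hC]), Finset.insert_val_of_notMem (by simp [hC]),
        Multiset.map_cons, Multiset.map_cons, h1]
      congr 2
      refine Multiset.map_congr rfl fun w hw => ?_
      rw [Finset.mem_val, hC, mem_filter] at hw
      obtain ⟨-, hw, hwj, hwj2⟩ := hw
      have hwx : w ≠ x := fun e => hnx (e ▸ hw)
      refine h.code_eq_of_notMem hw hx1 hwx ?_ ?_
      · exact Finset.disjoint_left.1 (h.isTree_left.disjoint_branch hadj.symm hw hwj.symm)
          (h.zero_mem_branch (by omega))
      · refine Finset.disjoint_left.1 (h.isTree_left.disjoint_branch hadj1 hw hwj2.symm) ?_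
        rw [← h.isTree_left.notMem_branch_iff hadj1.symm]
        exact h.last_notMem_branch (by omega)
  · have h1 := hP j (by omega)
    have h2 := hP' j (by omega)
    rw [show m - (j + 1) = j by omega, show m - j = j + 1 by omega] at h1 h2
    exact nonempty_iso_of_code_eq h.isTree_left h.isTree_right (h.adj j (by omega)).symm
      (h.adj_right (by omega)) h2 h1.symm

end LeafMove

end SimpleGraph

/-! ### Trees are determined by the deletions of their deep leaves -/

namespace SimpleGraph

open scoped Classical
open Finset TreeCode

section Label

variable {V : Type*} [Fintype V] {T S X : SimpleGraph V} {u v w a b x y p q : V}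

omit [Fintype V] in
theorem IsTree.exists_adj_isInner (hT : T.IsTree) (hd : ∃ a b, 4 ≤ T.dist a b) (p : V) :
    ∃ u, T.Adj p u ∧ T.IsInner u := by
  obtain ⟨a, b, hab⟩ := hd
  have h1 := hT.connected.dist_triangle (u := a) (v := p) (w := b)
  obtain ⟨w, hw⟩ : ∃ w, 2 ≤ T.dist p w := by
    rw [dist_comm (u := a) (v := p)] at h1
    rcases Nat.lt_or_ge (T.dist p a) 2 with h | h
    · exact ⟨b, by omega⟩
    · exact ⟨a, h⟩
  have hpw : p ≠ w := by rintro rfl; simp at hw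
  obtain ⟨u, hu, hu'⟩ := hT.exists_adj_toward hpw
  have huw : u ≠ w := by rintro rfl; rw [dist_self] at hu'; omega
  obtain ⟨c, hc, hc'⟩ := hT.exists_adj_toward huw
  refine ⟨u, hu, p, c, ?_, hu.symm, hc⟩
  rintro rfl
  omega

omit [Fintype V] in
theorem IsLeafAt.isInner (hT : T.IsTree) (hd : ∃ a b, 4 ≤ T.dist a b) (h : T.IsLeafAt p x) :
    T.IsInner p := by
  obtain ⟨u, hu, hui⟩ := hT.exists_adj_isInner hd p
  exact ⟨u, x, fun e => h.not_isInner (e ▸ hui), hu, h.adj.symm⟩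

theorem IsTree.exists_isDeepLeaf_mem_branch (hT : T.IsTree) (h : T.Adj u v) (hu : T.IsInner u)
    (hv : T.IsInner v) : ∃ x ∈ T.branch u v, T.IsDeepLeaf x := by
  by_contra hcon
  push Not at hcon
  have h1 := sum_deep_branch hT h hu fun _ => 1
  have h2 : ((T.branch u v).erase v).filter T.IsDeepLeaf = ∅ := by
    rw [Finset.filter_eq_empty_iff]
    exact fun x hx => hcon x (mem_of_mem_erase hx)
  rw [h2, Finset.sum_empty, Multiset.map_const', Multiset.sum_replicate, smul_eq_mul, mul_one] at h1
  refine leafDeck_ne_zero ?_ (Multiset.card_eq_zero.1 h1.symm)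
  rw [Ne, code_eq_pt_iff hT h, not_not]
  exact hv

theorem code_eq_pt_iff_of_le (hT : T.IsTree) (hX : X ≤ T) (h : T.Adj u v) :
    X.code u v = pt ↔ X.kidSet u v = ∅ := by
  rw [code_eq hT hX h, pt, EmbeddingLike.apply_eq_iff_eq, Multiset.map_eq_zero, Finset.val_eq_zero]

theorem code_eq_edge_iff_of_le (hT : T.IsTree) (hX : X ≤ T) (h : T.Adj u v) :
    X.code u v = TreeCode.edge ↔ ∃ a, X.kidSet u v = {a} ∧ X.kidSet v a = ∅ := by
  rw [code_eq hT hX h, TreeCode.edge, EmbeddingLike.apply_eq_iff_eq, Multiset.map_eq_singleton]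
  refine exists_congr fun a => ?_
  rw [← Finset.singleton_val, Finset.val_inj]
  refine and_congr_right fun ha => ?_
  have : a ∈ X.kidSet u v := by rw [ha, mem_singleton]
  exact code_eq_pt_iff_of_le hT hX (hX (mem_kidSet.1 this).1)

theorem leafLabel_eq_true_iff (hx : T.IsLeafAt p x) :
    T.leafLabel x = true ↔ ∃ q, ∀ y, T.Adj p y → y = x ∨ y = q := by
  rw [leafLabel, decide_eq_true_iff]
  constructor
  · rintro ⟨p', q, hp', hq⟩
    obtain rfl := hx.eq hp'
    exact ⟨q, hq⟩
  · rintro ⟨q, hq⟩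
    exact ⟨p, q, hx, hq⟩

/-- How the number of leaves changes when a leaf is deleted. -/
theorem codeCount_pt_deleteIncidenceSet (hT : T.IsTree) (hx : T.IsLeafAt p x) (hp : T.IsInner p) :
    (T.deleteIncidenceSet x).codeCount pt + 1 =
      T.codeCount pt + if T.leafLabel x = true then 1 else 0 := by
  have hX := deleteIncidenceSet_le T x
  set X := T.deleteIncidenceSet x with hXdef
  have hcount : ∀ {Y : SimpleGraph V}, Y ≤ T → Y.codeCount pt =
      (Y.dartSet.filter fun d => Y.kidSet d.1 d.2 = ∅).card := by
    intro Y hY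
    rw [codeCount, Finset.sum_boole, Nat.cast_id]
    congr 1
    refine Finset.filter_congr fun d hd => ?_
    exact code_eq_pt_iff_of_le hT hY (hY (mem_dartSet.1 hd))
  have hXadj : ∀ a b, X.Adj a b ↔ T.Adj a b ∧ a ≠ x ∧ b ≠ x := fun a b => deleteIncidenceSet_adj
  have hnp : ∀ a, T.Adj a p → T.kidSet a p ≠ ∅ := by
    intro a ha h0
    have h1 := (code_eq_pt_iff_of_le hT le_rfl ha).2 h0
    exact (code_eq_pt_iff hT ha).1 h1 hp
  have hpx : (p, x) ∈ T.dartSet.filter fun d => T.kidSet d.1 d.2 = ∅ := by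
    rw [mem_filter, mem_dartSet]
    refine ⟨hx.adj.symm, ?_⟩
    rw [← code_eq_pt_iff_of_le hT le_rfl hx.adj.symm, code_eq_pt_iff hT hx.adj.symm]
    exact hx.not_isInner
  -- Apart from `p`, the deletion changes the set of leaves only by removing `x`.
  have h1 : (X.dartSet.filter fun d => X.kidSet d.1 d.2 = ∅).filter (fun d => d.2 ≠ p) =
      (T.dartSet.filter fun d => T.kidSet d.1 d.2 = ∅).erase (p, x) := by
    ext ⟨a, b⟩
    simp only [mem_filter, mem_dartSet, mem_erase, ne_eq, Prod.mk.injEq, not_and]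
    have hk : b ≠ p → X.kidSet a b = T.kidSet a b ∨ b = x := by
      intro hbp
      by_cases hbx : b = x
      · exact Or.inr hbx
      · left
        ext c
        rw [mem_kidSet, mem_kidSet, hXadj]
        refine ⟨fun h => ⟨h.1.1, h.2⟩, fun h => ⟨⟨h.1, hbx, ?_⟩, h.2⟩⟩
        rintro rfl
        exact hbp ((hx b).1 h.1.symm)
    constructor
    · rintro ⟨⟨hab, hk0⟩, hbp⟩
      rw [hXadj] at hab
      refine ⟨fun _ => hab.2.2, hab.1, ?_⟩
      rw [← (hk hbp).resolve_right hab.2.2]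
      exact hk0
    · rintro ⟨hne, hab, hk0⟩
      have hbp : b ≠ p := by
        rintro rfl
        exact hnp a hab hk0
      have hbx : b ≠ x := by
        rintro rfl
        exact hne ((hx a).1 hab.symm) rfl
      refine ⟨⟨(hXadj a b).2 ⟨hab, ?_, hbx⟩, ?_⟩, hbp⟩
      · rintro rfl
        exact hbp ((hx b).1 hab)
      · rw [(hk hbp).resolve_right hbx]
        exact hk0
  -- The vertex `p` becomes a leaf exactly if it had degree two, which is the meaning of the label.
  have h2 : ((X.dartSet.filter fun d => X.kidSet d.1 d.2 = ∅).filter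
      (fun d => ¬ d.2 ≠ p)).card = if T.leafLabel x = true then 1 else 0 := by
    have hpx' : p ≠ x := hx.adj.ne.symm
    have hmem : ∀ a b, (a, b) ∈ (X.dartSet.filter fun d => X.kidSet d.1 d.2 = ∅).filter
        (fun d => ¬ d.2 ≠ p) ↔ b = p ∧ T.Adj p a ∧ a ≠ x ∧ ∀ y, T.Adj p y → y = x ∨ y = a := by
      intro a b
      simp only [mem_filter, mem_dartSet, ne_eq, not_not, hXadj, Finset.eq_empty_iff_forall_notMem,
        mem_kidSet]
      constructor
      · rintro ⟨⟨⟨hab, hax, hbx⟩, hk⟩, rfl⟩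
        refine ⟨rfl, hab.symm, hax, fun y hy => ?_⟩
        have := hk y
        tauto
      · rintro ⟨rfl, hab, hax, hk⟩
        refine ⟨⟨⟨hab.symm, hax, hpx'⟩, fun y hy => ?_⟩, rfl⟩
        rcases hk y hy.1.1 with h | h
        · exact hy.1.2.2 h
        · exact hy.2 h
    split_ifs with hl
    · obtain ⟨q, hq⟩ := (leafLabel_eq_true_iff hx).1 hl
      obtain ⟨a, b, hab, ha, hb⟩ := hp
      obtain ⟨u, hu, hux⟩ : ∃ u, T.Adj p u ∧ u ≠ x := by
        by_cases hax : a = x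
        · exact ⟨b, hb, fun h => hab (hax.trans h.symm)⟩
        · exact ⟨a, ha, hax⟩
      have huq := (hq u hu).resolve_left hux
      rw [Finset.card_eq_one]
      refine ⟨(u, p), ?_⟩
      ext ⟨c, d⟩
      rw [hmem, mem_singleton, Prod.mk.injEq]
      constructor
      · rintro ⟨rfl, -, -, hk⟩
        exact ⟨((hk u hu).resolve_left hux).symm, rfl⟩
      · rintro ⟨rfl, rfl⟩
        exact ⟨rfl, hu, hux, huq ▸ hq⟩
    · rw [Finset.card_eq_zero, Finset.eq_empty_iff_forall_notMem]
      rintro ⟨c, d⟩ hcd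
      rw [hmem] at hcd
      exact hl ((leafLabel_eq_true_iff hx).2 ⟨c, hcd.2.2.2⟩)
  rw [hcount hX, hcount le_rfl, ← Finset.card_filter_add_card_filter_not (fun d => d.2 ≠ p), h1,
    h2, Finset.card_erase_of_mem hpx]
  have := Finset.card_pos.2 ⟨_, hpx⟩
  omega

/-- If all labels are true, each deep leaf hangs from a vertex of degree two. For a leaf other than
`x` this gives a branch `edge` that survives the deletion of `x`, and different leaves give
different darts. -/
theorem card_deepSet_le (hT : T.IsTree) (hd : ∃ a b, 4 ≤ T.dist a b)
    (hl : ∀ y, T.IsDeepLeaf y → T.leafLabel y = true) (hx : T.IsDeepLeaf x) :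
    T.deepSet.card ≤ (T.deleteIncidenceSet x).codeCount TreeCode.edge + 1 := by
  have hex : ∀ y, ∃ d : V × V, T.IsDeepLeaf y → T.IsInner d.1 ∧ T.Adj d.1 d.2 ∧
      T.IsLeafAt d.2 y ∧ ∀ w, T.Adj d.2 w → w = y ∨ w = d.1 := by
    intro y
    by_cases hy : T.IsDeepLeaf y
    · obtain ⟨p, hp, -⟩ := id hy
      obtain ⟨u, hu, hui⟩ := hT.exists_adj_isInner hd p
      obtain ⟨q, hq⟩ := (leafLabel_eq_true_iff hp).1 (hl y hy)
      have huy : u ≠ y := fun e => hp.not_isInner (e ▸ hui)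
      obtain rfl := (hq u hu).resolve_left huy
      exact ⟨(u, p), fun _ => ⟨hui, hu.symm, hp, hq⟩⟩
    · exact ⟨(y, y), fun h => absurd h hy⟩
  choose D hD using hex
  rw [← Finset.card_erase_add_one (mem_deepSet.2 hx), codeCount, Finset.sum_boole, Nat.cast_id]
  refine Nat.add_le_add_right (Finset.card_le_card_of_injOn D ?_ ?_) 1
  · intro y hy
    rw [mem_coe, mem_erase, mem_deepSet] at hy
    obtain ⟨h1, h2, h3, h4⟩ := hD y hy.2
    have hk : T.kidSet (D y).1 (D y).2 = {y} := by
      ext w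
      rw [mem_kidSet, mem_singleton]
      constructor
      · rintro ⟨hw, hw'⟩
        exact (h4 w hw).resolve_right hw'
      · rintro rfl
        exact ⟨h3.adj.symm, fun e => h3.not_isInner (e ▸ h1)⟩
    have hpx : (D y).2 ≠ x := fun e => hx.not_isInner (e ▸ h3.isInner hT hd)
    rw [mem_coe, mem_filter, mem_dartSet, deleteIncidenceSet_adj]
    refine ⟨⟨h2, fun e => hx.not_isInner (e ▸ h1), hpx⟩, ?_⟩
    rw [code_deleteIncidenceSet_of_notMem hT h2, code_eq_edge_iff_of_le hT le_rfl h2]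
    · refine ⟨y, hk, ?_⟩
      rw [← code_eq_pt_iff_of_le hT le_rfl h3.adj.symm, code_eq_pt_iff hT h3.adj.symm]
      exact h3.not_isInner
    · rw [hT.branch_eq h2, hk, singleton_biUnion, h3.branch_eq hT, mem_insert, mem_singleton]
      rintro (h | h)
      · exact hpx h.symm
      · exact hy.1 h.symm
  · intro y hy y' hy' he
    rw [mem_coe, mem_erase, mem_deepSet] at hy hy'
    obtain ⟨h1, -, h3, h4⟩ := hD y hy.2
    obtain ⟨-, -, h3', -⟩ := hD y' hy'.2
    rw [← he] at h3'
    rcases h4 y' h3'.adj.symm with h | h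
    · exact h.symm
    · exact absurd (h ▸ h1) h3'.not_isInner

/-- If all labels are false, a branch `edge` must have been created by the deletion. Its root is
then the neighbour `p` of `x`, and it points away from the only inner neighbour of `p`. -/
theorem codeCount_edge_le_one (hT : T.IsTree) (hd : ∃ a b, 4 ≤ T.dist a b)
    (hl : ∀ y, T.IsDeepLeaf y → T.leafLabel y ≠ true) (hx : T.IsDeepLeaf x) :
    (T.deleteIncidenceSet x).codeCount TreeCode.edge ≤ 1 := by
  obtain ⟨p, hp, hpu⟩ := id hx
  rw [codeCount, Finset.sum_boole, Nat.cast_id, Finset.card_le_one]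
  have key : ∀ d ∈ (T.deleteIncidenceSet x).dartSet.filter
      (fun d => (T.deleteIncidenceSet x).code d.1 d.2 = TreeCode.edge), d.2 = p ∧ T.IsInner d.1 ∧
        T.Adj p d.1 := by
    rintro ⟨u, v⟩ h
    rw [mem_filter, mem_dartSet] at h
    have huv := deleteIncidenceSet_adj.1 h.1
    simp only at huv
    obtain ⟨a, ha, ha'⟩ :=
      (code_eq_edge_iff_of_le hT (deleteIncidenceSet_le _ _) huv.1).1 h.2
    have hva : ∀ w, T.Adj v w → w ≠ x → w = a ∨ w = u := by
      intro w hw hwx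
      by_contra hcon
      push Not at hcon
      have : w ∈ (T.deleteIncidenceSet x).kidSet u v :=
        mem_kidSet.2 ⟨deleteIncidenceSet_adj.2 ⟨hw, huv.2.2, hwx⟩, hcon.2⟩
      rw [ha, mem_singleton] at this
      exact hcon.1 this
    have hak : a ∈ (T.deleteIncidenceSet x).kidSet u v := by rw [ha, mem_singleton]
    rw [mem_kidSet, deleteIncidenceSet_adj] at hak
    obtain ⟨⟨hvaT, -, hax⟩, hau⟩ := hak
    have haw : ∀ w, T.Adj a w → w ≠ x → w = v := by
      intro w hw hwx
      by_contra hcon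
      have : w ∈ (T.deleteIncidenceSet x).kidSet v a :=
        mem_kidSet.2 ⟨deleteIncidenceSet_adj.2 ⟨hw, hax, hwx⟩, hcon⟩
      rw [ha'] at this
      simp at this
    have hvp : v = p := by
      by_contra hvp
      have hvx : ∀ w, T.Adj v w → w ≠ x := by
        rintro w hw rfl
        exact hvp ((hp v).1 hw.symm)
      by_cases hap : a = p
      · subst hap
        refine hl x hx ((leafLabel_eq_true_iff hp).2 ⟨v, fun y hy => ?_⟩)
        by_cases hyx : y = x
        · exact Or.inl hyx
        · exact Or.inr (haw y hy hyx)
      · have haleaf : T.IsLeafAt v a := by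
          intro w
          refine ⟨fun hw => haw w hw ?_, fun hw => hw ▸ hvaT.symm⟩
          rintro rfl
          exact hap ((hp a).1 hw.symm)
        have hadeep : T.IsDeepLeaf a := by
          refine ⟨v, haleaf, ?_⟩
          have : ∀ c, T.Adj v c → T.IsInner c → c = u := by
            intro c hc hci
            refine (hva c hc (hvx c hc)).resolve_left ?_
            rintro rfl
            exact haleaf.not_isInner hci
          intro c c' hc hc' hci hci'
          rw [this c hc hci, this c' hc' hci']
        exact hl a hadeep ((leafLabel_eq_true_iff haleaf).2 ⟨u, fun y hy => hva y hy (hvx y hy)⟩)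
    subst hvp
    refine ⟨rfl, ?_, huv.1.symm⟩
    obtain ⟨c, hc, hci⟩ := hT.exists_adj_isInner hd v
    have hcx : c ≠ x := fun e => hx.not_isInner (e ▸ hci)
    rcases hva c hc hcx with h | h
    · subst h
      have : T.IsLeafAt v c := by
        intro w
        refine ⟨fun hw => haw w hw ?_, fun hw => hw ▸ hvaT.symm⟩
        rintro rfl
        exact hvaT.ne ((hp c).1 hw.symm).symm
      exact absurd hci this.not_isInner
    · exact h ▸ hci
  intro d hdm d' hdm'
  obtain ⟨h1, h2, h3⟩ := key d hdm
  obtain ⟨h1', h2', h3'⟩ := key d' hdm'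
  exact Prod.ext (hpu _ _ h3 h3' h2 h2') (h1.trans h1'.symm)

/-- A false label provides a second leaf at the neighbour `p` of `x`; a third deep leaf lies beyond
the inner neighbour of `p`. -/
theorem three_le_card_deepSet (hT : T.IsTree) (hd : ∃ a b, 4 ≤ T.dist a b)
    (hx : T.IsDeepLeaf x) (hl : T.leafLabel x ≠ true) : 3 ≤ T.deepSet.card := by
  obtain ⟨p, hp, hpu⟩ := id hx
  obtain ⟨u, hu, hui⟩ := hT.exists_adj_isInner hd p
  have hpi := hp.isInner hT hd
  obtain ⟨y, hy, hyx, hyu⟩ : ∃ y, T.Adj p y ∧ y ≠ x ∧ y ≠ u := by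
    by_contra hcon
    push Not at hcon
    refine hl ((leafLabel_eq_true_iff hp).2 ⟨u, fun y hy => ?_⟩)
    by_cases hyx : y = x
    · exact Or.inl hyx
    · exact Or.inr (hcon y hy hyx)
  have hyi : ¬ T.IsInner y := fun h => hyu (hpu y u hy hu h hui)
  have hyd : T.IsDeepLeaf y := ⟨p, hy.symm.isLeafAt_of_not_isInner hyi, hpu⟩
  obtain ⟨w, hw, hwd⟩ := hT.exists_isDeepLeaf_mem_branch hu hpi hui
  have hne : ∀ v, T.Adj p v → v ≠ u → w ≠ v := by
    rintro v hv hvu rfl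
    exact Finset.disjoint_left.1 (hT.disjoint_branch hu hv hvu.symm) hw hv.mem_branch_right
  have hwx := hne x hp.adj.symm fun e => hp.not_isInner (e ▸ hui)
  have hwy := hne y hy hyu
  have hsub : ({x, y, w} : Finset V) ⊆ T.deepSet := by
    intro v hv
    simp only [mem_insert, mem_singleton] at hv
    rw [mem_deepSet]
    rcases hv with rfl | rfl | rfl <;> assumption
  have hcard : ({x, y, w} : Finset V).card = 3 := by
    rw [Finset.card_eq_three]
    exact ⟨x, y, w, hyx.symm, hwx.symm, hwy.symm, rfl⟩
  exact hcard ▸ Finset.card_le_card hsub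

theorem IsTree.exists_isDeepLeaf (hT : T.IsTree) (hd : ∃ a b, 4 ≤ T.dist a b) :
    ∃ x, T.IsDeepLeaf x := by
  obtain ⟨a, -⟩ := id hd
  obtain ⟨u, -, hu⟩ := hT.exists_adj_isInner hd a
  obtain ⟨v, huv, hv⟩ := hT.exists_adj_isInner hd u
  obtain ⟨x, -, hx⟩ := hT.exists_isDeepLeaf_mem_branch huv hu hv
  exact ⟨x, hx⟩

/-- Matched deletions of deep leaves bound the number of leaves. -/
theorem codeCount_pt_le_of_deletions (hT : T.IsTree) (hS : S.IsTree)
    (hdT : ∃ a b, 4 ≤ T.dist a b) (hdS : ∃ a b, 4 ≤ S.dist a b) (φ : Equiv.Perm V)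
    (hφ : ∀ x, T.IsDeepLeaf x ↔ S.IsDeepLeaf (φ x))
    (hc : ∀ x, T.IsDeepLeaf x → ∀ c,
      (T.deleteIncidenceSet x).codeCount c = (S.deleteIncidenceSet (φ x)).codeCount c) :
    S.codeCount pt ≤ T.codeCount pt := by
  by_contra hlt
  push Not at hlt
  -- Matched deletions have equally many leaves. If `S` has more leaves than `T`, this forces the
  -- label `true` in `T` and `false` in `S` throughout.
  have key : ∀ x, T.IsDeepLeaf x → T.leafLabel x = true ∧ S.leafLabel (φ x) ≠ true := by
    intro x hx
    have h0 := hc x hx pt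
    obtain ⟨p, hp, -⟩ := id hx
    obtain ⟨q, hq, -⟩ := (hφ x).1 hx
    have h1 := codeCount_pt_deleteIncidenceSet hT hp (hp.isInner hT hdT)
    have h2 := codeCount_pt_deleteIncidenceSet hS hq (hq.isInner hS hdS)
    by_cases h3 : T.leafLabel x = true <;> by_cases h4 : S.leafLabel (φ x) = true <;>
      simp only [h3, h4, if_true, if_false, Bool.false_eq_true, ne_eq, not_true_eq_false,
        not_false_eq_true, and_self, and_true, and_false] at h1 h2 ⊢ <;> omega
  obtain ⟨x, hx⟩ := hT.exists_isDeepLeaf hdT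
  -- `T` has at most two deep leaves and `S` at least three, against the matching `φ`.
  have h1 := card_deepSet_le hT hdT (fun y hy => (key y hy).1) hx
  have h2 := codeCount_edge_le_one hS hdS (x := φ x) (fun y hy => ?_) ((hφ x).1 hx)
  · have h3 := three_le_card_deepSet hS hdS ((hφ x).1 hx) (key x hx).2
    have h4 : S.deepSet.card = T.deepSet.card := by
      refine (Finset.card_bij (fun x _ => φ x) ?_ ?_ ?_).symm
      · intro y hy
        rw [mem_deepSet] at hy ⊢
        exact (hφ y).1 hy
      · intro a _ b _ hab
        exact φ.injective hab
      · intro b hb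
        rw [mem_deepSet] at hb
        exact ⟨φ.symm b, by rw [mem_deepSet, hφ]; simpa using hb, by simp⟩
    have h5 := hc x hx TreeCode.edge
    omega
  · have h3 := key (φ.symm y) (by rw [hφ]; simpa using hy)
    simpa using h3.2

/-- Two trees on the same vertex set that differ in the position of one deep leaf are isomorphic
if their deletions of deep leaves match. -/
theorem nonempty_iso_of_deletions (hT : T.IsTree) (hS : S.IsTree)
    (hdT : ∃ a b, 4 ≤ T.dist a b) (hdS : ∃ a b, 4 ≤ S.dist a b) (φ : Equiv.Perm V)
    (hφ : ∀ x, T.IsDeepLeaf x ↔ S.IsDeepLeaf (φ x))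
    (hc : ∀ x, T.IsDeepLeaf x → ∀ c,
      (T.deleteIncidenceSet x).codeCount c = (S.deleteIncidenceSet (φ x)).codeCount c)
    (hx : T.IsDeepLeaf x) (hxφ : φ x = x)
    (hadj : ∀ a b, a ≠ x → b ≠ x → (T.Adj a b ↔ S.Adj a b)) : Nonempty (T ≃g S) := by
  have hφ' : ∀ y, S.IsDeepLeaf y ↔ T.IsDeepLeaf (φ.symm y) := fun y => by rw [hφ]; simp
  have hpt : T.codeCount pt = S.codeCount pt := by
    refine le_antisymm ?_ (codeCount_pt_le_of_deletions hT hS hdT hdS φ hφ hc)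
    refine codeCount_pt_le_of_deletions hS hT hdS hdT φ.symm hφ' fun y hy c => ?_
    rw [hc _ ((hφ' y).1 hy)]
    simp
  -- Once the numbers of leaves agree, the number of leaves after a deletion reveals the label.
  have hlab : ∀ y, T.IsDeepLeaf y → T.leafLabel y = S.leafLabel (φ y) := by
    intro y hy
    have h0 := hc y hy pt
    obtain ⟨p, hp, -⟩ := id hy
    obtain ⟨q, hq, -⟩ := (hφ y).1 hy
    have h1 := codeCount_pt_deleteIncidenceSet hT hp (hp.isInner hT hdT)
    have h2 := codeCount_pt_deleteIncidenceSet hS hq (hq.isInner hS hdS)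
    cases h3 : T.leafLabel y <;> cases h4 : S.leafLabel (φ y) <;>
      simp only [h3, h4, if_true, if_false, Bool.false_eq_true] at h1 h2 ⊢ <;> omega
  have hset : ∀ τ, S.deepLabelSet τ = (T.deepLabelSet τ).map φ.toEmbedding := by
    intro τ
    ext y
    rw [Finset.mem_map_equiv, mem_deepLabelSet, mem_deepLabelSet, hφ' y]
    refine and_congr_right fun hy => ?_
    rw [hlab _ hy, Equiv.apply_symm_apply]
  obtain ⟨p, hp, -⟩ := id hx
  obtain ⟨q, hq, -⟩ := hxφ ▸ (hφ x).1 hx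
  obtain ⟨z, hz0, hzm, hzadj, hzd⟩ := hT.exists_geodesic p q
  have hpx : p ≠ x := hp.adj.ne.symm
  have hqx : q ≠ x := hq.adj.ne.symm
  have hmove : LeafMove T S x (T.dist p q) z := by
    refine ⟨hT, hS, hz0.symm ▸ hp, hzm.symm ▸ hq, hadj, ?_, hzadj, ?_⟩
    · intro i hi hix
      have h1 := (hzd i hi).2
      rw [hix, hp.dist_eq hT hqx] at h1
      have h2 := (hzd i hi).1
      rw [hix, dist_comm, hp.dist_eq hT hpx] at h2
      omega
    · rw [hz0, hzm]
      exact hzd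
  refine hmove.nonempty_iso fun j hj => hmove.code_eq_code ?_ ?_ hpt hj
  · intro τ
    rw [hset, Finset.card_map]
  · intro τ c
    rw [hset, Finset.sum_map]
    exact Finset.sum_congr rfl fun y hy => hc y (mem_deepLabelSet.1 hy).1 c

end Label

/-! ### Trees on different vertex sets. -/

section Iso

variable {V W : Type*} {T : SimpleGraph V} {S : SimpleGraph W}

theorem IsInner.iso (e : T ≃g S) {v : V} (h : T.IsInner v) : S.IsInner (e v) := by
  obtain ⟨a, b, hab, ha, hb⟩ := h
  exact ⟨e a, e b, e.injective.ne hab, e.map_adj_iff.2 ha, e.map_adj_iff.2 hb⟩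

theorem IsDeepLeaf.iso (e : T ≃g S) {x : V} (h : T.IsDeepLeaf x) : S.IsDeepLeaf (e x) := by
  obtain ⟨p, hp, hu⟩ := h
  refine ⟨e p, fun y => ?_, fun a b ha hb hai hbi => ?_⟩
  · obtain ⟨y, rfl⟩ := e.surjective y
    rw [e.map_adj_iff, hp y, e.injective.eq_iff]
  · obtain ⟨a, rfl⟩ := e.surjective a
    obtain ⟨b, rfl⟩ := e.surjective b
    rw [hu a b (e.map_adj_iff.1 ha) (e.map_adj_iff.1 hb)]
    · simpa using hai.iso e.symm
    · simpa using hbi.iso e.symm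

theorem isDeepLeaf_iso_iff (e : T ≃g S) {x : V} : S.IsDeepLeaf (e x) ↔ T.IsDeepLeaf x :=
  ⟨fun h => by simpa using h.iso e.symm, fun h => h.iso e⟩

/-- Trees of diameter at least four are determined by the deletions of their deep leaves. -/
theorem nonempty_iso_of_induce_iso [Fintype V] [Fintype W] (hT : T.IsTree) (hS : S.IsTree)
    (hdT : ∃ a b, 4 ≤ T.dist a b) (hdS : ∃ a b, 4 ≤ S.dist a b) (φ : V ≃ W)
    (hφ : ∀ x, T.IsDeepLeaf x ↔ S.IsDeepLeaf (φ x))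
    (he : ∀ x, T.IsDeepLeaf x →
      Nonempty (T.induce ({x}ᶜ : Set V) ≃g S.induce ({φ x}ᶜ : Set W))) : Nonempty (T ≃g S) := by
  obtain ⟨x, hx⟩ := hT.exists_isDeepLeaf hdT
  obtain ⟨e⟩ := he x hx
  obtain ⟨ψ, hψx, hψ⟩ := exists_equiv_of_induce_iso e
  -- Pulled back along `ψ`, the tree `S` agrees with `T` off `x`, and the matching becomes a
  -- permutation fixing `x`.
  let e' : S.comap ψ ≃g S := Iso.comap ψ S
  have he' : ∀ a, e' a = ψ a := fun _ => rfl
  have hS' : (S.comap ψ).IsTree := e'.isTree_iff.2 hS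
  have hdS' : ∃ a b, 4 ≤ (S.comap ψ).dist a b := by
    obtain ⟨a, b, hab⟩ := hdS
    refine ⟨ψ.symm a, ψ.symm b, ?_⟩
    obtain ⟨W, hW⟩ := hS'.connected.exists_walk_length_eq_dist (ψ.symm a) (ψ.symm b)
    have h1 := dist_le (W.map e'.toHom)
    rw [Walk.length_map, hW] at h1
    have h2 : ∀ c, e'.toHom (ψ.symm c) = c := fun c => ψ.apply_symm_apply c
    rw [h2, h2] at h1
    omega
  have hφ' : ∀ y, T.IsDeepLeaf y ↔ (S.comap ψ).IsDeepLeaf ((φ.trans ψ.symm) y) := by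
    intro y
    rw [hφ, ← isDeepLeaf_iso_iff e', he', Equiv.trans_apply, Equiv.apply_symm_apply]
  have hc : ∀ y, T.IsDeepLeaf y → ∀ c, (T.deleteIncidenceSet y).codeCount c =
      ((S.comap ψ).deleteIncidenceSet ((φ.trans ψ.symm) y)).codeCount c := by
    intro y hy c
    obtain ⟨e₁⟩ := he y hy
    rw [codeCount_eq_of_induce_iso e₁]
    symm
    refine codeCount_iso ⟨ψ, fun {a b} => ?_⟩ c
    rw [deleteIncidenceSet_adj, deleteIncidenceSet_adj, comap_adj, Equiv.trans_apply, ne_eq, ne_eq,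
      ne_eq, ne_eq, Equiv.eq_symm_apply, Equiv.eq_symm_apply]
  obtain ⟨e₂⟩ := nonempty_iso_of_deletions hT hS' hdT hdS' (φ.trans ψ.symm) hφ' hc hx
    (by rw [Equiv.trans_apply, ← hψx, Equiv.symm_apply_apply]) hψ
  exact ⟨e₂.trans e'⟩

end Iso

end SimpleGraph

/-! ### Cubes of trees: simplicial vertices and deletion of leaves -/

namespace SimpleGraph

open scoped Classical
open Finset

/-- The neighbours of `x` are pairwise adjacent. -/
def IsSimplicialVertex {V : Type*} (G : SimpleGraph V) (x : V) : Prop :=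
  ∀ a b, G.Adj x a → G.Adj x b → a ≠ b → G.Adj a b

/-- `v` has at least two neighbours that are not leaves. -/
def IsCore {V : Type*} (T : SimpleGraph V) (v : V) : Prop :=
  ∃ a b, a ≠ b ∧ T.Adj v a ∧ T.Adj v b ∧ T.IsInner a ∧ T.IsInner b

section Dist

variable {V : Type*} [Fintype V] {T : SimpleGraph V} {u v w a b c x y p q : V}

-- Induction along the path from `u` to `a`: by `IsTree.dist_away`, each step leads one further away
-- from `y`.
omit [Fintype V] in
theorem IsTree.dist_add (hT : T.IsTree) (hc : T.Adj u c) (hb : T.Adj u b) (hcb : c ≠ b)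
    (hy : T.dist u y = T.dist c y + 1) (ha : T.dist u a = T.dist b a + 1) :
    T.dist a y = T.dist a u + T.dist u y := by
  have key : ∀ n, ∀ {u c b : V}, T.Adj u c → T.Adj u b → c ≠ b → T.dist u y = T.dist c y + 1 →
      T.dist u a = n → T.dist u a = T.dist b a + 1 → T.dist a y = n + T.dist u y := by
    intro n
    induction n with
    | zero => intro u c b _ _ _ _ h1 h2; omega
    | succ n ih =>
      intro u c b hc hb hcb hy h1 h2
      have h3 := hT.dist_away hc hb hcb hy
      rcases eq_or_ne b a with rfl | hba
      · rw [dist_self] at h2; omega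
      · obtain ⟨d, hd, hd'⟩ := hT.exists_adj_toward hba
        have := ih hb.symm hd (fun e => by subst e; omega) h3 (by omega) hd'
        omega
  rw [dist_comm (u := a) (v := u)]
  exact key _ hc hb hcb hy rfl ha

omit [Fintype V] in
theorem IsTree.dist_eq_two (hT : T.IsTree) (ha : T.Adj u a) (hb : T.Adj u b) (hab : a ≠ b) :
    T.dist a b = 2 := by
  have h1 : T.dist u b = 1 := dist_eq_one_iff_adj.2 hb
  have := hT.dist_away hb ha hab.symm (by rw [h1, dist_self])
  omega

omit [Fintype V] in
theorem IsCore.isInner (h : T.IsCore u) : T.IsInner u := by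
  obtain ⟨a, b, hab, ha, hb, -⟩ := h
  exact ⟨a, b, hab, ha, hb⟩

omit [Fintype V] in
theorem IsInner.exists_adj_ne (h : T.IsInner u) (c : V) : ∃ a, T.Adj u a ∧ a ≠ c := by
  obtain ⟨a, b, hab, ha, hb⟩ := h
  by_cases hac : a = c
  · exact ⟨b, hb, fun e => hab (hac.trans e.symm)⟩
  · exact ⟨a, ha, hac⟩

omit [Fintype V] in
theorem IsCore.exists_adj_ne (h : T.IsCore u) (c : V) : ∃ a, T.Adj u a ∧ a ≠ c ∧ T.IsInner a := by
  obtain ⟨a, b, hab, ha, hb, hai, hbi⟩ := h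
  by_cases hac : a = c
  · exact ⟨b, hb, fun e => hab (hac.trans e.symm), hbi⟩
  · exact ⟨a, ha, hac, hai⟩

omit [Fintype V] in
theorem isDeepLeaf_iff : T.IsDeepLeaf x ↔ ∃ p, T.IsLeafAt p x ∧ ¬ T.IsCore p := by
  simp only [IsDeepLeaf, IsCore]
  refine exists_congr fun p => and_congr_right fun _ => ?_
  constructor
  · rintro h ⟨a, b, hab, ha, hb, hai, hbi⟩
    exact hab (h a b ha hb hai hbi)
  · intro h a b ha hb hai hbi
    by_contra hab
    exact h ⟨a, b, hab, ha, hb, hai, hbi⟩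

omit [Fintype V] in
/-- A vertex with two neighbours that are not leaves is the centre of a path of length four. -/
theorem IsCore.exists_dist_eq_four (hT : T.IsTree) (hu : T.IsCore u) :
    ∃ a b, T.dist u a = 2 ∧ T.dist u b = 2 ∧ T.dist a b = 4 := by
  obtain ⟨c, d, hcd, hc, hd, hci, hdi⟩ := hu
  obtain ⟨a, ha, hau⟩ := hci.exists_adj_ne u
  obtain ⟨b, hb, hbu⟩ := hdi.exists_adj_ne u
  have h1 := hT.dist_eq_two hc.symm ha hau.symm
  have h2 := hT.dist_eq_two hd.symm hb hbu.symm
  have h3 := hT.dist_add hd hc hcd.symm (y := b) (a := a)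
    (by rw [h2, dist_eq_one_iff_adj.2 hb]) (by rw [h1, dist_eq_one_iff_adj.2 ha])
  refine ⟨a, b, h1, h2, ?_⟩
  rw [h3, dist_comm, h1, h2]

omit [Fintype V] in
/-- The ball of radius three around a deep leaf. -/
theorem IsLeafAt.dist_le_three_iff (hT : T.IsTree) (hx : T.IsLeafAt p x) (hp : ¬ T.IsCore p)
    (hu : T.Adj p u) (hui : T.IsInner u) :
    T.dist x y ≤ 3 ↔ T.dist p y ≤ 1 ∨ T.dist u y ≤ 1 := by
  have hxp : T.dist x p = 1 := dist_eq_one_iff_adj.2 hx.adj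
  have hpu : T.dist p u = 1 := dist_eq_one_iff_adj.2 hu
  have h1 := hT.connected.dist_triangle (u := x) (v := p) (w := y)
  have h2 := hT.connected.dist_triangle (u := p) (v := u) (w := y)
  refine ⟨fun h => ?_, fun h => by omega⟩
  rcases eq_or_ne y x with rfl | hyx
  · left; rw [dist_comm]; omega
  have h3 := hx.dist_eq hT hyx
  by_contra hcon
  have hpy : p ≠ y := by rintro rfl; simp at hcon
  -- A vertex `y` at distance two from `p` that is not within distance one of `u` would make `c` a
  -- second inner neighbour of `p`.
  obtain ⟨c, hc, hc'⟩ := hT.exists_adj_toward hpy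
  have hcy : T.dist c y = 1 := by omega
  refine hp ⟨u, c, ?_, hu, hc, hui, p, y, hpy, hc.symm, dist_eq_one_iff_adj.1 hcy⟩
  rintro rfl
  omega

end Dist

/-! ### Simplicial vertices of the cube. -/

section Power

variable {V : Type u} {T : SimpleGraph V} {v w a b c x y p q : V}

theorem IsTree.kthPower_adj (hT : T.IsTree) {k : ℕ} :
    (T.kthPower k).Adj x y ↔ x ≠ y ∧ T.dist x y ≤ k := by
  refine and_congr_right fun _ => ?_
  rw [← (hT.connected x y).coe_dist_eq_edist, Nat.cast_le]

theorem IsTree.kthPower_three_ne_top (hT : T.IsTree) :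
    T.kthPower 3 ≠ ⊤ ↔ ∃ a b, 4 ≤ T.dist a b := by
  constructor
  · intro h
    by_contra hcon
    push Not at hcon
    refine h ?_
    ext x y
    rw [hT.kthPower_adj, top_adj]
    have := hcon x y
    exact ⟨fun h => h.1, fun h => ⟨h, by omega⟩⟩
  · rintro ⟨a, b, hab⟩ h
    have h1 : (T.kthPower 3).Adj a b := by
      rw [h, top_adj]; rintro rfl; simp at hab
    rw [hT.kthPower_adj] at h1
    omega

variable [Fintype V]

omit [Fintype V] in
/-- The ball of radius three around a deep leaf has diameter at most three. -/
theorem IsDeepLeaf.dist_le_three (hT : T.IsTree) (hd : ∃ a b, 4 ≤ T.dist a b)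
    (hx : T.IsDeepLeaf x) (ha : T.dist x a ≤ 3) (hb : T.dist x b ≤ 3) : T.dist a b ≤ 3 := by
  obtain ⟨p, hp, hpc⟩ := isDeepLeaf_iff.1 hx
  obtain ⟨u, hu, hui⟩ := hT.exists_adj_isInner hd p
  rw [hp.dist_le_three_iff hT hpc hu hui] at ha hb
  have hpu : T.dist p u = 1 := dist_eq_one_iff_adj.2 hu
  have h1 := hT.connected.dist_triangle (u := a) (v := p) (w := b)
  have h2 := hT.connected.dist_triangle (u := a) (v := u) (w := b)
  have h3 := hT.connected.dist_triangle (u := p) (v := u) (w := b)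
  have h4 := hT.connected.dist_triangle (u := u) (v := p) (w := b)
  rw [dist_comm (u := a) (v := p), dist_comm (u := a) (v := u), dist_comm (u := u) (v := p)] at *
  omega

theorem IsDeepLeaf.exists_four_le_dist (hT : T.IsTree) (hd : ∃ a b, 4 ≤ T.dist a b)
    (hx : T.IsDeepLeaf x) : ∃ z, 4 ≤ T.dist x z := by
  by_contra hcon
  push Not at hcon
  obtain ⟨a, b, hab⟩ := id hd
  have := hx.dist_le_three hT hd (Nat.le_of_lt_succ (hcon a)) (Nat.le_of_lt_succ (hcon b))
  omega

/-- The simplicial vertices of the cube of a tree are the deep leaves of the tree. -/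
theorem IsTree.isSimplicialVertex_iff (hT : T.IsTree) (hd : ∃ a b, 4 ≤ T.dist a b) :
    (T.kthPower 3).IsSimplicialVertex x ↔ T.IsDeepLeaf x := by
  constructor
  · intro h
    have hs : ∀ a b, T.dist x a ≤ 3 → T.dist x b ≤ 3 → T.dist a b ≤ 3 := by
      intro a b ha hb
      rcases eq_or_ne a b with rfl | hab
      · simp
      rcases eq_or_ne x a with rfl | hxa
      · exact hb
      rcases eq_or_ne x b with rfl | hxb
      · rwa [dist_comm]
      exact (hT.kthPower_adj.1 (h a b (hT.kthPower_adj.2 ⟨hxa, ha⟩)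
        (hT.kthPower_adj.2 ⟨hxb, hb⟩) hab)).2
    obtain ⟨z, hz⟩ : ∃ z, 4 ≤ T.dist x z := by
      by_contra hcon
      push Not at hcon
      obtain ⟨a, b, hab⟩ := id hd
      have := hs a b (Nat.le_of_lt_succ (hcon a)) (Nat.le_of_lt_succ (hcon b))
      omega
    obtain ⟨u, hu, -⟩ := hT.exists_adj_isInner hd x
    by_cases hxi : T.IsInner x
    · exfalso
      -- Three steps towards a far vertex and one step in another direction end at vertices of the
      -- ball with distance four.
      obtain ⟨g, h0, h1, hadj, hg⟩ := hT.exists_geodesic x z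
      obtain ⟨c, hc, hcg⟩ := hxi.exists_adj_ne (g 1)
      have hg0 : T.Adj x (g 1) := h0 ▸ hadj 0 (by omega)
      have hg3 := (hg 3 (by omega)).1
      have hg13 : T.dist (g 1) (g 3) ≤ 2 := by
        have h12 := dist_eq_one_iff_adj.2 (hadj 1 (by omega))
        have h23 := dist_eq_one_iff_adj.2 (hadj 2 (by omega))
        have := hT.connected.dist_triangle (u := g 1) (v := g 2) (w := g 3)
        simp only [Nat.reduceAdd] at *
        omega
      have h4 : T.dist x (g 3) = T.dist (g 1) (g 3) + 1 := by
        rcases hT.dist_adj_or (g 3) hg0 with h | h <;> omega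
      have h5 := hT.dist_away hg0 hc hcg.symm h4
      have h6 := hs c (g 3) (by rw [dist_eq_one_iff_adj.2 hc]; omega) hg3.le
      omega
    · rw [isDeepLeaf_iff]
      refine ⟨u, hu.isLeafAt_of_not_isInner hxi, fun hc => ?_⟩
      -- A leaf at a core vertex sees both ends of a path of length four centred there.
      obtain ⟨a, b, ha, hb, hab⟩ := hc.exists_dist_eq_four hT
      have hxu : T.dist x u = 1 := dist_eq_one_iff_adj.2 hu
      have h1 := hT.connected.dist_triangle (u := x) (v := u) (w := a)
      have h2 := hT.connected.dist_triangle (u := x) (v := u) (w := b)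
      have := hs a b (by omega) (by omega)
      omega
  · intro hx a b ha hb hab
    rw [hT.kthPower_adj] at ha hb ⊢
    exact ⟨hab, hx.dist_le_three hT hd ha.2 hb.2⟩

end Power

/-! ### Deletion of a leaf and powers. -/

section Delete

variable {V : Type u} [Fintype V] {T : SimpleGraph V} {v w a b c x y p q : V}

theorem IsLeafAt.isTree_induce (hT : T.IsTree) (hx : T.IsLeafAt p x) :
    (T.induce ({x}ᶜ : Set V)).IsTree := by
  refine ⟨hT.connected.induce_compl_singleton_of_degree_eq_one ?_, hT.isAcyclic.induce _⟩
  rw [← card_neighborFinset_eq_degree, Finset.card_eq_one]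
  exact ⟨p, by ext y; rw [mem_neighborFinset, hx y, mem_singleton]⟩

theorem IsLeafAt.dist_induce (hT : T.IsTree) (hx : T.IsLeafAt p x) (a b : ({x}ᶜ : Set V)) :
    (T.induce ({x}ᶜ : Set V)).dist a b = T.dist a b := by
  have hT' := hx.isTree_induce hT
  refine le_antisymm ?_ ?_
  · induction hn : T.dist a b generalizing a with
    | zero =>
      have : a = b := Subtype.ext (hT.dist_eq_zero.1 hn)
      simp [this]
    | succ n ih =>
      have hab : (a : V) ≠ b := by intro e; rw [e, dist_self] at hn; omega
      obtain ⟨c, hc, hc'⟩ := hT.exists_adj_toward hab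
      have hcx : c ≠ x := by
        rintro rfl
        rw [(hx a).1 hc.symm, hx.dist_eq hT b.2] at hc'
        omega
      have h1 := ih ⟨c, hcx⟩ (by simp only; omega)
      have h2 := hT'.connected.dist_triangle (u := a) (v := ⟨c, hcx⟩) (w := b)
      have h3 : (T.induce ({x}ᶜ : Set V)).dist a ⟨c, hcx⟩ = 1 := dist_eq_one_iff_adj.2 hc
      omega
  · obtain ⟨W, hW⟩ := hT'.connected.exists_walk_length_eq_dist a b
    rw [← hW, ← Walk.length_map (Embedding.induce ({x}ᶜ : Set V)).toHom W]
    exact dist_le _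

/-- Deleting a leaf commutes with taking powers. -/
theorem IsLeafAt.kthPower_induce (hT : T.IsTree) (hx : T.IsLeafAt p x) (k : ℕ) :
    (T.induce ({x}ᶜ : Set V)).kthPower k = (T.kthPower k).induce ({x}ᶜ : Set V) := by
  ext a b
  rw [(hx.isTree_induce hT).kthPower_adj, hx.dist_induce hT, comap_adj, hT.kthPower_adj]
  simp [Subtype.ext_iff]

end Delete

end SimpleGraph

/-! ### Uniqueness of cube roots among trees -/

namespace SimpleGraph

open scoped Classical
open Finset

/-- The closed neighbourhood of `x`. -/
noncomputable def closedNbhd {V : Type*} [Fintype V] (G : SimpleGraph V) (x : V) : Finset V :=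
  univ.filter fun y => y = x ∨ G.Adj x y

/-- The simplicial vertices with the same closed neighbourhood as `x`. -/
noncomputable def twinSet {V : Type*} [Fintype V] (G : SimpleGraph V) (x : V) : Finset V :=
  univ.filter fun y => G.IsSimplicialVertex y ∧ G.closedNbhd y = G.closedNbhd x

/-- The leaves attached to `p`. -/
noncomputable def leafSet {V : Type*} [Fintype V] (T : SimpleGraph V) (p : V) : Finset V :=
  univ.filter fun x => T.IsLeafAt p x

section Nbhd

variable {V : Type u} [Fintype V] {T : SimpleGraph V} {u v w a b c x y p q : V}

@[simp] theorem mem_leafSet : x ∈ T.leafSet p ↔ T.IsLeafAt p x := by simp [leafSet]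

theorem IsTree.mem_closedNbhd (hT : T.IsTree) : y ∈ T.closedNbhd x ↔ T.dist x y ≤ 1 := by
  simp only [closedNbhd, mem_filter, mem_univ, true_and, ← dist_eq_one_iff_adj]
  rw [eq_comm, ← hT.dist_eq_zero]
  omega

theorem IsTree.mem_closedNbhd_kthPower (hT : T.IsTree) {k : ℕ} :
    y ∈ (T.kthPower k).closedNbhd x ↔ T.dist x y ≤ k := by
  simp only [closedNbhd, mem_filter, mem_univ, true_and, hT.kthPower_adj]
  rcases eq_or_ne y x with rfl | h
  · simp
  · simp [h, h.symm]

/-- A vertex at distance two or more from `u` lies off the direction of `a` or off that of `b`,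
hence at distance at least four from `a` or from `b`. -/
theorem IsTree.closedNbhd_inter_of_dist_eq_four (hT : T.IsTree) (ha : T.dist u a = 2)
    (hb : T.dist u b = 2) (hab : T.dist a b = 4) :
    (T.kthPower 3).closedNbhd a ∩ (T.kthPower 3).closedNbhd b = T.closedNbhd u := by
  ext y
  rw [mem_inter, hT.mem_closedNbhd_kthPower, hT.mem_closedNbhd_kthPower, hT.mem_closedNbhd]
  have h1 := hT.connected.dist_triangle (u := a) (v := u) (w := y)
  have h2 := hT.connected.dist_triangle (u := b) (v := u) (w := y)
  rw [dist_comm (v := u)] at h1 h2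
  refine ⟨fun ⟨h3, h4⟩ => ?_, fun h => ⟨by omega, by omega⟩⟩
  by_contra hcon
  have hua : u ≠ a := by rintro rfl; simp at ha
  have hub : u ≠ b := by rintro rfl; simp at hb
  have huy : u ≠ y := by rintro rfl; simp at hcon
  obtain ⟨c, hc, hc'⟩ := hT.exists_adj_toward hua
  obtain ⟨d, hd, hd'⟩ := hT.exists_adj_toward hub
  obtain ⟨e, he, he'⟩ := hT.exists_adj_toward huy
  have hcd : c ≠ d := by
    rintro rfl
    have := hT.connected.dist_triangle (u := a) (v := c) (w := b)
    rw [dist_comm (u := a) (v := c)] at this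
    omega
  by_cases hec : e = c
  · have := hT.dist_add he hd (fun h => hcd (hec.symm.trans h)) he' hd'
    rw [dist_comm (u := b) (v := u)] at this
    omega
  · have := hT.dist_add he hc hec he' hc'
    rw [dist_comm (u := a) (v := u)] at this
    omega

theorem IsCore.exists_closedNbhd_inter (hT : T.IsTree) (hu : T.IsCore u) :
    ∃ a b, b ∉ (T.kthPower 3).closedNbhd a ∧ 3 ≤ (T.closedNbhd u).card ∧
      T.closedNbhd u = (T.kthPower 3).closedNbhd a ∩ (T.kthPower 3).closedNbhd b := by
  obtain ⟨a, b, ha, hb, hab⟩ := hu.exists_dist_eq_four hT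
  refine ⟨a, b, ?_, ?_, (hT.closedNbhd_inter_of_dist_eq_four ha hb hab).symm⟩
  · rw [hT.mem_closedNbhd_kthPower]; omega
  · obtain ⟨c, d, hcd, hc, hd, -⟩ := hu
    have : ({u, c, d} : Finset V) ⊆ T.closedNbhd u := by
      intro y hy
      simp only [mem_insert, mem_singleton] at hy
      simp only [closedNbhd, mem_filter, mem_univ, true_and]
      rcases hy with rfl | rfl | rfl <;> tauto
    rw [← card_eq_three.2 ⟨u, c, d, hc.ne, hd.ne, hcd, rfl⟩]
    exact card_le_card this

/-- At distance five or more, the two balls meet at most in `g 2` and `g 3` on the path from `a` to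
`b`. So the count forces distance four, and the midpoint is the core vertex. -/
theorem IsTree.exists_isCore_of_closedNbhd_inter (hT : T.IsTree)
    (hab : b ∉ (T.kthPower 3).closedNbhd a)
    (hcard : 3 ≤ ((T.kthPower 3).closedNbhd a ∩ (T.kthPower 3).closedNbhd b).card) :
    ∃ u, T.IsCore u ∧
      T.closedNbhd u = (T.kthPower 3).closedNbhd a ∩ (T.kthPower 3).closedNbhd b := by
  rw [hT.mem_closedNbhd_kthPower, not_le] at hab
  obtain ⟨g, h0, h1, hadj, hg⟩ := hT.exists_geodesic a b
  rcases Nat.lt_or_ge 4 (T.dist a b) with h5 | h4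
  · exfalso
    have hsub : (T.kthPower 3).closedNbhd a ∩ (T.kthPower 3).closedNbhd b ⊆ {g 2, g 3} := by
      intro y hy
      rw [mem_inter, hT.mem_closedNbhd_kthPower, hT.mem_closedNbhd_kthPower] at hy
      rw [mem_insert, mem_singleton]
      have h23 : T.Adj (g 2) (g 3) := hadj 2 (by omega)
      have hg2 := hg 2 (by omega)
      have hg3 := hg 3 (by omega)
      by_cases hyb : y ∈ T.branch (g 2) (g 3)
      · right
        have := hT.dist_across h23 hyb (y := a) (by
          rw [mem_branch, dist_comm, hg3.1, dist_comm, hg2.1]; omega)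
        rw [dist_comm (u := y) (v := a), dist_comm (u := g 2) (v := a)] at this
        exact hT.dist_eq_zero.1 (by omega)
      · left
        have := hT.dist_across h23 (w := b) (y := y) (by rw [mem_branch]; omega) hyb
        rw [dist_comm (u := b) (v := g 3)] at this
        exact (hT.dist_eq_zero.1 (by omega)).symm
    have := (card_le_card hsub).trans card_le_two
    omega
  · have h4 : T.dist a b = 4 := by omega
    have hg1 := hg 1 (by omega)
    have hg2 := hg 2 (by omega)
    have hg3 := hg 3 (by omega)
    have hg4 := hg 4 (by omega)
    have h01 : T.Adj (g 0) (g 1) := hadj 0 (by omega)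
    have h12 : T.Adj (g 1) (g 2) := hadj 1 (by omega)
    have h23 : T.Adj (g 2) (g 3) := hadj 2 (by omega)
    have h34 : T.Adj (g 3) (g 4) := hadj 3 (by omega)
    have hne : ∀ i j, i ≤ 4 → j ≤ 4 → i ≠ j → g i ≠ g j := by
      intro i j hi hj hij e
      have h1 := (hg i (by omega)).1
      have h2 := (hg j (by omega)).1
      rw [e] at h1
      omega
    refine ⟨g 2, ⟨g 1, g 3, hne _ _ (by omega) (by omega) (by omega), h12.symm, h23,
      ⟨g 0, g 2, hne _ _ (by omega) (by omega) (by omega), h01.symm, h12⟩,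
      ⟨g 2, g 4, hne _ _ (by omega) (by omega) (by omega), h23.symm, h34⟩⟩,
      (hT.closedNbhd_inter_of_dist_eq_four ?_ ?_ h4).symm⟩
    · rw [dist_comm]; exact hg2.1
    · omega

theorem IsTree.closedNbhd_injOn (hT : T.IsTree) (hu : T.IsInner u)
    (h : T.closedNbhd u = T.closedNbhd v) : u = v := by
  by_contra huv
  have h1 : v ∈ T.closedNbhd u := by
    rw [h, hT.mem_closedNbhd, dist_self]; omega
  obtain ⟨c, hc, hcv⟩ := hu.exists_adj_ne v
  have h2 : c ∈ T.closedNbhd v := by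
    rw [← h, hT.mem_closedNbhd, dist_eq_one_iff_adj.2 hc]
  have hadj : T.Adj u v := by
    simp only [closedNbhd, mem_filter, mem_univ, true_and] at h1
    exact h1.resolve_left (Ne.symm huv)
  rw [hT.mem_closedNbhd, hT.dist_eq_two hadj hc hcv.symm] at h2
  omega

/-- Adjacent vertices share only each other and themselves, as there are no triangles; non-adjacent
ones share at most one neighbour, as there are no 4-cycles. -/
theorem IsTree.adj_iff_card_inter (hT : T.IsTree) (huv : u ≠ v) :
    T.Adj u v ↔ (T.closedNbhd u ∩ T.closedNbhd v).card = 2 := by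
  constructor
  · intro h
    rw [card_eq_two]
    refine ⟨u, v, huv, ?_⟩
    ext y
    rw [mem_inter, hT.mem_closedNbhd, hT.mem_closedNbhd, mem_insert, mem_singleton]
    constructor
    · rintro ⟨h1, h2⟩
      rcases hT.dist_adj_or y h with h3 | h3
      · right; exact (hT.dist_eq_zero.1 (by omega)).symm
      · left; exact (hT.dist_eq_zero.1 (by omega)).symm
    · have := dist_eq_one_iff_adj.2 h
      rintro (rfl | rfl)
      · rw [dist_comm (u := v), dist_self]; omega
      · rw [dist_self]; omega
  · intro h
    obtain ⟨a, b, hab, he⟩ := card_eq_two.1 h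
    by_contra hadj
    have key : ∀ y ∈ ({a, b} : Finset V), T.Adj u y ∧ T.Adj v y := by
      intro y hy
      rw [← he, mem_inter] at hy
      simp only [closedNbhd, mem_filter, mem_univ, true_and] at hy
      rcases hy with ⟨rfl | h1, rfl | h2⟩
      · exact absurd rfl huv
      · exact absurd h2.symm hadj
      · exact absurd h1 hadj
      · exact ⟨h1, h2⟩
    obtain ⟨h1, h2⟩ := key a (by simp)
    obtain ⟨h3, h4⟩ := key b (by simp)
    have h5 := hT.dist_eq_two h1.symm h2.symm huv
    exact hab (hT.toward_unique h1 h3 (by rw [h5, dist_eq_one_iff_adj.2 h2.symm])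
      (by rw [h5, dist_eq_one_iff_adj.2 h4.symm]))

omit [Fintype V] in
theorem IsInner.exists_isLeafAt (h : T.IsInner p) (hp : ¬ T.IsCore p) : ∃ x, T.IsLeafAt p x := by
  obtain ⟨a, b, hab, ha, hb⟩ := h
  by_cases hai : T.IsInner a
  · by_cases hbi : T.IsInner b
    · exact absurd ⟨a, b, hab, ha, hb, hai, hbi⟩ hp
    · exact ⟨b, hb.symm.isLeafAt_of_not_isInner hbi⟩
  · exact ⟨a, ha.symm.isLeafAt_of_not_isInner hai⟩

/-- The path from a leaf at `p` to a vertex at distance four continues from `p` to its only inner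
neighbour `u`, and the next vertex on it is inner as well. -/
theorem IsTree.isCore_of_adj (hT : T.IsTree) (hd : ∃ a b, 4 ≤ T.dist a b) (hpi : T.IsInner p)
    (hp : ¬ T.IsCore p) (h : T.Adj p u) (hu : T.IsInner u) : T.IsCore u := by
  obtain ⟨x, hx⟩ := hpi.exists_isLeafAt hp
  obtain ⟨z, hz⟩ := (isDeepLeaf_iff.2 ⟨p, hx, hp⟩).exists_four_le_dist hT hd
  obtain ⟨g, h0, -, hadj, hg⟩ := hT.exists_geodesic x z
  have h01 : T.Adj (g 0) (g 1) := hadj 0 (by omega)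
  have h12 : T.Adj (g 1) (g 2) := hadj 1 (by omega)
  have h23 : T.Adj (g 2) (g 3) := hadj 2 (by omega)
  have h34 : T.Adj (g 3) (g 4) := hadj 3 (by omega)
  have hne : ∀ i j, i ≤ 4 → j ≤ 4 → i ≠ j → g i ≠ g j := by
    intro i j hi hj hij e
    have h1 := (hg i (by omega)).1
    have h2 := (hg j (by omega)).1
    rw [e] at h1
    omega
  obtain rfl : g 1 = p := (hx _).1 (h0 ▸ h01)
  have h2i : T.IsInner (g 2) := ⟨_, _, hne 1 3 (by omega) (by omega) (by omega), h12.symm, h23⟩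
  obtain rfl : g 2 = u := by
    by_contra hcon
    exact hp ⟨_, _, hcon, h12, h, h2i, hu⟩
  exact ⟨_, _, hne 1 3 (by omega) (by omega) (by omega), h12.symm, h23, hpi,
    ⟨_, _, hne 2 4 (by omega) (by omega) (by omega), h23.symm, h34⟩⟩

theorem IsLeafAt.closedNbhd_kthPower (hT : T.IsTree) (hx : T.IsLeafAt p x) (hp : ¬ T.IsCore p)
    (hu : T.Adj p u) (hui : T.IsInner u) :
    (T.kthPower 3).closedNbhd x = T.closedNbhd p ∪ T.closedNbhd u := by
  ext y
  rw [mem_union, hT.mem_closedNbhd_kthPower, hT.mem_closedNbhd, hT.mem_closedNbhd,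
    hx.dist_le_three_iff hT hp hu hui]

/-- The ball around `x` is `T.closedNbhd p ∪ T.closedNbhd u`, where `u` is the inner neighbour of
`p`. A core vertex in it other than `u` has a neighbour beyond it, away from `u`. -/
theorem IsLeafAt.closedNbhd_subset_iff (hT : T.IsTree) (hd : ∃ a b, 4 ≤ T.dist a b)
    (hx : T.IsLeafAt p x) (hp : ¬ T.IsCore p) (hw : T.IsCore w) :
    T.closedNbhd w ⊆ (T.kthPower 3).closedNbhd x ↔ T.Adj w p := by
  obtain ⟨u, hu, hui⟩ := hT.exists_adj_isInner hd p
  rw [hx.closedNbhd_kthPower hT hp hu hui]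
  have hwp : w ≠ p := fun e => hp (e ▸ hw)
  constructor
  · intro h
    by_contra hadj
    have h1 : w ∈ T.closedNbhd p ∪ T.closedNbhd u := h (by
      rw [hT.mem_closedNbhd, dist_self]; omega)
    have hwu : w ≠ u := by rintro rfl; exact hadj hu.symm
    have huw : T.Adj u w := by
      simp only [closedNbhd, mem_union, mem_filter, mem_univ, true_and, hwp, hwu, false_or] at h1
      exact h1.resolve_left fun h => hadj h.symm
    obtain ⟨c, hc, hcu, -⟩ := hw.exists_adj_ne u
    have h2 := h (x := c) (by rw [hT.mem_closedNbhd, dist_eq_one_iff_adj.2 hc])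
    have h3 : T.dist u c = 2 := hT.dist_eq_two huw.symm hc hcu.symm
    have h4 := hT.dist_away huw hu.symm hwp (w := c) (by
      rw [h3, dist_eq_one_iff_adj.2 hc])
    rw [mem_union, hT.mem_closedNbhd, hT.mem_closedNbhd] at h2
    omega
  · intro h
    obtain rfl : w = u := by
      by_contra hcon
      exact hp ⟨w, u, hcon, h.symm, hu, hw.isInner, hui⟩
    exact subset_union_right

/-- A deep leaf with the same ball as `x` lies in that ball, hence hangs from `p` or from the inner
neighbour of `p`. The latter is core, so leaves at it are not deep. -/
theorem IsLeafAt.twinSet_kthPower (hT : T.IsTree) (hd : ∃ a b, 4 ≤ T.dist a b)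
    (hx : T.IsLeafAt p x) (hp : ¬ T.IsCore p) : (T.kthPower 3).twinSet x = T.leafSet p := by
  obtain ⟨u, hu, hui⟩ := hT.exists_adj_isInner hd p
  ext y
  simp only [twinSet, mem_filter, mem_univ, true_and, mem_leafSet]
  rw [hT.isSimplicialVertex_iff hd, isDeepLeaf_iff]
  constructor
  · rintro ⟨⟨q, hy, hq⟩, he⟩
    obtain rfl | hqp := eq_or_ne q p
    · exact hy
    exfalso
    have h1 : y ∈ T.closedNbhd p ∪ T.closedNbhd u := by
      rw [← hx.closedNbhd_kthPower hT hp hu hui, ← he, hT.mem_closedNbhd_kthPower, dist_self]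
      omega
    have huc : T.IsCore u := hT.isCore_of_adj hd (hx.isInner hT hd) hp hu hui
    simp only [closedNbhd, mem_union, mem_filter, mem_univ, true_and] at h1
    rcases h1 with (rfl | h1) | (rfl | h1)
    · exact hy.not_isInner (hx.isInner hT hd)
    · exact hqp ((hy p).1 h1.symm).symm
    · exact hy.not_isInner hui
    · exact hq ((hy u).1 h1.symm ▸ huc)
  · intro hy
    exact ⟨⟨p, hy, hp⟩, by
      rw [hx.closedNbhd_kthPower hT hp hu hui, hy.closedNbhd_kthPower hT hp hu hui]⟩

end Nbhd

end SimpleGraph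

/-! ### Uniqueness of cube roots: the keys of the vertices -/

namespace SimpleGraph

open scoped Classical
open Finset

/-- The possible positions of a vertex of a tree, described in terms of the cube of the tree: a
vertex with at least two neighbours that are not leaves, a vertex with exactly one such
neighbour, a leaf attached to a vertex of the latter kind, or a leaf attached to a vertex of the
former kind. -/
inductive CubeKey (V : Type u) : Type u
  | core (A : Finset V)
  | rim (C : Finset V)
  | deep (C : Finset V)
  | shallow (A : Finset V)

namespace CubeKey

variable {V : Type u} [Fintype V]

/-- The keys of the vertices that are not leaves. -/
def IsInner : CubeKey V → Prop
  | core _ => True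
  | rim _ => True
  | deep _ => False
  | shallow _ => False

/-- The keys that occur for inner vertices, in terms of the cube. -/
def Occurs (G : SimpleGraph V) : CubeKey V → Prop
  | core A => ∃ a b, b ∉ G.closedNbhd a ∧ 3 ≤ A.card ∧ A = G.closedNbhd a ∩ G.closedNbhd b
  | rim C => ∃ x, G.IsSimplicialVertex x ∧ C = G.twinSet x
  | deep _ => False
  | shallow _ => False

/-- Adjacency of the vertices with given keys, in one of the two orders. -/
def Link (G : SimpleGraph V) : CubeKey V → CubeKey V → Prop
  | core A, core A' => A ≠ A' ∧ (A ∩ A').card = 2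
  | core A, rim C => ∃ x ∈ C, A ⊆ G.closedNbhd x
  | rim C, deep C' => C = C'
  | core A, shallow A' => A = A'
  | _, _ => False

/-- The key of the vertex `x` of the tree `T`. -/
def IsKey (T : SimpleGraph V) (x : V) : CubeKey V → Prop
  | core A => T.IsCore x ∧ A = T.closedNbhd x
  | rim C => T.IsInner x ∧ ¬ T.IsCore x ∧ C = T.leafSet x
  | deep C => ∃ p, T.IsLeafAt p x ∧ T.IsInner p ∧ ¬ T.IsCore p ∧ C = T.leafSet p
  | shallow A => ∃ p, T.IsLeafAt p x ∧ T.IsCore p ∧ A = T.closedNbhd p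

end CubeKey

open CubeKey

section Key

variable {V : Type u} [Fintype V] {T : SimpleGraph V} {u v w a b c x y p q : V} {κ κ' : CubeKey V}

theorem IsTree.exists_isKey (hT : T.IsTree) (hd : ∃ a b, 4 ≤ T.dist a b) (x : V) :
    ∃ κ : CubeKey V, κ.IsKey T x := by
  by_cases hc : T.IsCore x
  · exact ⟨core _, hc, rfl⟩
  by_cases hi : T.IsInner x
  · exact ⟨rim _, hi, hc, rfl⟩
  obtain ⟨p, hp, hpi⟩ := hT.exists_adj_isInner hd x
  have hx := hp.isLeafAt_of_not_isInner hi
  by_cases hpc : T.IsCore p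
  · exact ⟨shallow _, p, hx, hpc, rfl⟩
  · exact ⟨deep _, p, hx, hpi, hpc, rfl⟩

theorem IsInner.eq_of_leafSet_eq (hp : T.IsInner p) (hpc : ¬ T.IsCore p)
    (h : T.leafSet p = T.leafSet q) : p = q := by
  obtain ⟨x, hx⟩ := hp.exists_isLeafAt hpc
  have : x ∈ T.leafSet q := by rw [← h, mem_leafSet]; exact hx
  exact (mem_leafSet.1 this).eq hx

theorem CubeKey.IsKey.isInner_iff (h : κ.IsKey T x) : κ.IsInner ↔ T.IsInner x := by
  rcases κ with A | C | C | A
  · exact ⟨fun _ => h.1.isInner, fun _ => trivial⟩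
  · exact ⟨fun _ => h.1, fun _ => trivial⟩
  · obtain ⟨p, hp, -⟩ := h
    exact ⟨False.elim, fun h => hp.not_isInner h⟩
  · obtain ⟨p, hp, -⟩ := h
    exact ⟨False.elim, fun h => hp.not_isInner h⟩

theorem CubeKey.IsKey.eq (h : κ.IsKey T x) (h' : κ'.IsKey T x) : κ = κ' := by
  have hl : ∀ {p x}, T.IsLeafAt p x → T.IsCore x → False :=
    fun hp hx => hp.not_isInner hx.isInner
  rcases κ with A | C | C | A <;> rcases κ' with A' | C' | C' | A'
  · rw [h.2, h'.2]
  · exact absurd h.1 h'.2.1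
  · obtain ⟨p, hp, -⟩ := h'; exact (hl hp h.1).elim
  · obtain ⟨p, hp, -⟩ := h'; exact (hl hp h.1).elim
  · exact absurd h'.1 h.2.1
  · rw [h.2.2, h'.2.2]
  · obtain ⟨p, hp, -⟩ := h'; exact absurd h.1 hp.not_isInner
  · obtain ⟨p, hp, -⟩ := h'; exact absurd h.1 hp.not_isInner
  · obtain ⟨p, hp, -⟩ := h; exact (hl hp h'.1).elim
  · obtain ⟨p, hp, -⟩ := h; exact absurd h'.1 hp.not_isInner
  · obtain ⟨p, hp, -, -, rfl⟩ := h
    obtain ⟨q, hq, -, -, rfl⟩ := h'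
    rw [hp.eq hq]
  · obtain ⟨p, hp, -, hpc, rfl⟩ := h
    obtain ⟨q, hq, hqc, rfl⟩ := h'
    exact absurd (hp.eq hq ▸ hqc) hpc
  · obtain ⟨p, hp, -⟩ := h; exact (hl hp h'.1).elim
  · obtain ⟨p, hp, -⟩ := h; exact absurd h'.1 hp.not_isInner
  · obtain ⟨p, hp, hpc, rfl⟩ := h
    obtain ⟨q, hq, -, hqc, rfl⟩ := h'
    exact absurd (hp.eq hq ▸ hpc) hqc
  · obtain ⟨p, hp, -, rfl⟩ := h
    obtain ⟨q, hq, -, rfl⟩ := h'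
    rw [hp.eq hq]

/-- `Link` refers to the cube only. With `link_of_adj` this makes adjacency in the tree a function
of the keys and the cube. -/
theorem CubeKey.IsKey.adj_of_link (hT : T.IsTree) (hd : ∃ a b, 4 ≤ T.dist a b)
    (h : κ.IsKey T x) (h' : κ'.IsKey T y) (hl : Link (T.kthPower 3) κ κ') : T.Adj x y := by
  rcases κ with A | C | C | A <;> rcases κ' with A' | C' | C' | A' <;> try exact hl.elim
  · obtain ⟨hx, rfl⟩ := h
    obtain ⟨hy, rfl⟩ := h'
    exact (hT.adj_iff_card_inter fun e => hl.1 (congrArg _ e)).2 hl.2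
  · obtain ⟨hx, rfl⟩ := h
    obtain ⟨hy, hyc, rfl⟩ := h'
    obtain ⟨z, hz, hzs⟩ := hl
    exact ((mem_leafSet.1 hz).closedNbhd_subset_iff hT hd hyc hx).1 hzs
  · obtain ⟨hx, rfl⟩ := h
    obtain ⟨p, hp, hpc, rfl⟩ := h'
    rw [hT.closedNbhd_injOn hx.isInner hl]
    exact hp.adj.symm
  · obtain ⟨hx, hxc, rfl⟩ := h
    obtain ⟨p, hp, hpi, hpc, rfl⟩ := h'
    rw [hx.eq_of_leafSet_eq hxc hl]
    exact hp.adj.symm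

theorem CubeKey.IsKey.link_of_adj (hT : T.IsTree) (hd : ∃ a b, 4 ≤ T.dist a b)
    (h : κ.IsKey T x) (h' : κ'.IsKey T y) (hxy : T.Adj x y) :
    Link (T.kthPower 3) κ κ' ∨ Link (T.kthPower 3) κ' κ := by
  have cc : ∀ {A A' : Finset V} {x y}, (core A).IsKey T x → (core A').IsKey T y → T.Adj x y →
      Link (T.kthPower 3) (core A) (core A') := by
    rintro A A' x y ⟨hx, rfl⟩ ⟨hy, rfl⟩ hxy
    exact ⟨fun e => hxy.ne (hT.closedNbhd_injOn hx.isInner e),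
      (hT.adj_iff_card_inter hxy.ne).1 hxy⟩
  have cr : ∀ {A C : Finset V} {x y}, (core A).IsKey T x → (rim C).IsKey T y → T.Adj x y →
      Link (T.kthPower 3) (core A) (rim C) := by
    rintro A C x y ⟨hx, rfl⟩ ⟨hy, hyc, rfl⟩ hxy
    obtain ⟨z, hz⟩ := hy.exists_isLeafAt hyc
    exact ⟨z, mem_leafSet.2 hz, (hz.closedNbhd_subset_iff hT hd hyc hx).2 hxy⟩
  have cd : ∀ {A C : Finset V} {x y}, (core A).IsKey T x → (deep C).IsKey T y → ¬ T.Adj x y := by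
    rintro A C x y ⟨hx, rfl⟩ ⟨p, hp, -, hpc, rfl⟩ hxy
    exact hpc ((hp x).1 hxy.symm ▸ hx)
  have cs : ∀ {A A' : Finset V} {x y}, (core A).IsKey T x → (shallow A').IsKey T y → T.Adj x y →
      Link (T.kthPower 3) (core A) (shallow A') := by
    rintro A A' x y ⟨hx, rfl⟩ ⟨p, hp, -, rfl⟩ hxy
    rw [(hp x).1 hxy.symm]
    rfl
  have rr : ∀ {C C' : Finset V} {x y}, (rim C).IsKey T x → (rim C').IsKey T y → ¬ T.Adj x y := by
    rintro C C' x y ⟨hx, hxc, rfl⟩ ⟨hy, hyc, rfl⟩ hxy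
    exact hyc (hT.isCore_of_adj hd hx hxc hxy hy)
  have rd : ∀ {C C' : Finset V} {x y}, (rim C).IsKey T x → (deep C').IsKey T y → T.Adj x y →
      Link (T.kthPower 3) (rim C) (deep C') := by
    rintro C C' x y ⟨hx, -, rfl⟩ ⟨p, hp, -, -, rfl⟩ hxy
    rw [(hp x).1 hxy.symm]
    rfl
  have rs : ∀ {C A : Finset V} {x y}, (rim C).IsKey T x → (shallow A).IsKey T y →
      ¬ T.Adj x y := by
    rintro C A x y ⟨hx, hxc, rfl⟩ ⟨p, hp, hpc, rfl⟩ hxy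
    exact hxc ((hp x).1 hxy.symm ▸ hpc)
  have ll : ∀ {x y p q : V}, T.IsLeafAt p x → T.IsLeafAt q y → ¬ T.Adj x y := by
    intro x y p q hx hy hxy
    obtain rfl := (hx y).1 hxy
    exact hy.not_isInner (hx.isInner hT hd)
  rcases κ with A | C | C | A <;> rcases κ' with A' | C' | C' | A'
  · exact Or.inl (cc h h' hxy)
  · exact Or.inl (cr h h' hxy)
  · exact absurd hxy (cd h h')
  · exact Or.inl (cs h h' hxy)
  · exact Or.inr (cr h' h hxy.symm)
  · exact absurd hxy (rr h h')
  · exact Or.inl (rd h h' hxy)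
  · exact absurd hxy (rs h h')
  · exact absurd hxy.symm (cd h' h)
  · exact Or.inr (rd h' h hxy.symm)
  · obtain ⟨p, hp, -⟩ := h
    obtain ⟨q, hq, -⟩ := h'
    exact absurd hxy (ll hp hq)
  · obtain ⟨p, hp, -⟩ := h
    obtain ⟨q, hq, -⟩ := h'
    exact absurd hxy (ll hp hq)
  · exact Or.inr (cs h' h hxy.symm)
  · exact absurd hxy.symm (rs h' h)
  · obtain ⟨p, hp, -⟩ := h
    obtain ⟨q, hq, -⟩ := h'
    exact absurd hxy (ll hp hq)
  · obtain ⟨p, hp, -⟩ := h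
    obtain ⟨q, hq, -⟩ := h'
    exact absurd hxy (ll hp hq)

theorem CubeKey.IsKey.injective (hT : T.IsTree) (hκ : κ.IsInner) (h : κ.IsKey T x)
    (h' : κ.IsKey T y) : x = y := by
  rcases κ with A | C | C | A
  · exact hT.closedNbhd_injOn h.1.isInner (h.2.symm.trans h'.2)
  · exact h.1.eq_of_leafSet_eq h.2.1 (h.2.2.symm.trans h'.2.2)
  · exact hκ.elim
  · exact hκ.elim

/-- `Occurs` refers to the cube only, so the cube determines which inner keys are present. -/
theorem CubeKey.exists_isKey_iff (hT : T.IsTree) (hd : ∃ a b, 4 ≤ T.dist a b) (hκ : κ.IsInner) :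
    (∃ x, κ.IsKey T x) ↔ κ.Occurs (T.kthPower 3) := by
  rcases κ with A | C | C | A
  · constructor
    · rintro ⟨x, hx, rfl⟩
      exact hx.exists_closedNbhd_inter hT
    · rintro ⟨a, b, hab, h3, rfl⟩
      obtain ⟨u, hu, hu'⟩ := hT.exists_isCore_of_closedNbhd_inter hab h3
      exact ⟨u, hu, hu'.symm⟩
  · constructor
    · rintro ⟨p, hp, hpc, rfl⟩
      obtain ⟨x, hx⟩ := hp.exists_isLeafAt hpc
      exact ⟨x, (hT.isSimplicialVertex_iff hd).2 (isDeepLeaf_iff.2 ⟨p, hx, hpc⟩),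
        (hx.twinSet_kthPower hT hd hpc).symm⟩
    · rintro ⟨x, hx, rfl⟩
      rw [hT.isSimplicialVertex_iff hd, isDeepLeaf_iff] at hx
      obtain ⟨p, hp, hpc⟩ := hx
      exact ⟨p, hp.isInner hT hd, hpc, hp.twinSet_kthPower hT hd hpc⟩
  · exact hκ.elim
  · exact hκ.elim

theorem CubeKey.isKey_deep_iff (hT : T.IsTree) (hd : ∃ a b, 4 ≤ T.dist a b) {C : Finset V} :
    (deep C).IsKey T x ↔
      (T.kthPower 3).IsSimplicialVertex x ∧ C = (T.kthPower 3).twinSet x := by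
  rw [hT.isSimplicialVertex_iff hd, isDeepLeaf_iff]
  constructor
  · rintro ⟨p, hp, -, hpc, rfl⟩
    exact ⟨⟨p, hp, hpc⟩, (hp.twinSet_kthPower hT hd hpc).symm⟩
  · rintro ⟨⟨p, hp, hpc⟩, rfl⟩
    exact ⟨p, hp, hp.isInner hT hd, hpc, hp.twinSet_kthPower hT hd hpc⟩

end Key

/-! ### Multiplicities of keys and uniqueness of the root. -/

/-- The number of vertices of `T` with key `κ`. -/
noncomputable def keyCount {V : Type u} [Fintype V] (T : SimpleGraph V) (κ : CubeKey V) : ℕ :=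
  (univ.filter fun x => κ.IsKey T x).card

section Count

variable {V : Type u} [Fintype V] {T S : SimpleGraph V} {u v w a b c x y p q : V}
  {κ κ' : CubeKey V}

theorem keyCount_of_isInner (hT : T.IsTree) (hd : ∃ a b, 4 ≤ T.dist a b) (hκ : κ.IsInner) :
    T.keyCount κ = if κ.Occurs (T.kthPower 3) then 1 else 0 := by
  rw [← CubeKey.exists_isKey_iff hT hd hκ]
  split_ifs with h
  · obtain ⟨x, hx⟩ := h
    rw [keyCount, card_eq_one]
    refine ⟨x, ?_⟩
    ext y
    simp only [mem_filter, mem_univ, true_and, mem_singleton]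
    exact ⟨fun hy => hy.injective hT hκ hx, fun e => e ▸ hx⟩
  · rw [keyCount, card_eq_zero, filter_eq_empty_iff]
    exact fun x _ hx => h ⟨x, hx⟩

/-- The closed neighbourhood of a vertex with key `core A` is made up of the vertex, its inner
neighbours, and the leaves attached to it. -/
theorem card_eq_add_keyCount (hT : T.IsTree) (hd : ∃ a b, 4 ≤ T.dist a b) {A : Finset V}
    (hA : (core A).IsKey T u) :
    A.card = {κ : CubeKey V | κ.IsInner ∧ κ.Occurs (T.kthPower 3) ∧
      (Link (T.kthPower 3) (core A) κ ∨ Link (T.kthPower 3) κ (core A))}.ncard + 1 +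
        T.keyCount (shallow A) := by
  have h1 : A = insert u ((univ.filter fun x => T.Adj u x ∧ T.IsInner x) ∪
      univ.filter fun x => (shallow A).IsKey T x) := by
    ext x
    rw [mem_insert, mem_union, mem_filter, mem_filter]
    simp only [mem_univ, true_and]
    conv_lhs => rw [hA.2]
    simp only [closedNbhd, mem_filter, mem_univ, true_and]
    refine or_congr_right ⟨fun h => ?_, ?_⟩
    · by_cases hx : T.IsInner x
      · exact Or.inl ⟨h, hx⟩
      · exact Or.inr ⟨u, h.symm.isLeafAt_of_not_isInner hx, hA.1, hA.2⟩
    · rintro (h | ⟨p, hp, hpc, he⟩)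
      · exact h.1
      · rw [hT.closedNbhd_injOn hA.1.isInner (hA.2.symm.trans he)]
        exact hp.adj.symm
  conv_lhs => rw [h1]
  rw [card_insert_of_notMem, card_union_of_disjoint, keyCount, add_right_comm]
  · congr 2
    choose k hk using hT.exists_isKey hd
    have hin : ∀ x, (k x).IsInner ↔ T.IsInner x := fun x => (hk x).isInner_iff
    rw [← Set.ncard_coe_finset]
    refine Set.ncard_congr (fun x _ => k x) ?_ ?_ ?_
    · intro x hx
      simp only [coe_filter, mem_univ, true_and, Set.mem_ofPred_eq] at hx
      exact ⟨(hin x).2 hx.2, (CubeKey.exists_isKey_iff hT hd ((hin x).2 hx.2)).1 ⟨x, hk x⟩,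
        hA.link_of_adj hT hd (hk x) hx.1⟩
    · intro x y hx hy hxy
      simp only [coe_filter, mem_univ, true_and, Set.mem_ofPred_eq] at hx
      exact (hk x).injective hT ((hin x).2 hx.2) (hxy ▸ hk y)
    · rintro κ ⟨hκ, hoc, hl⟩
      obtain ⟨x, hx⟩ := (CubeKey.exists_isKey_iff hT hd hκ).2 hoc
      obtain rfl := hx.eq (hk x)
      refine ⟨x, ?_, rfl⟩
      simp only [coe_filter, mem_univ, true_and, Set.mem_ofPred_eq]
      refine ⟨?_, (hin x).1 hκ⟩
      rcases hl with hl | hl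
      · exact hA.adj_of_link hT hd hx hl
      · exact (hx.adj_of_link hT hd hA hl).symm
  · rw [Finset.disjoint_left]
    simp only [mem_filter, mem_univ, true_and]
    rintro x ⟨-, hx⟩ ⟨p, hp, -⟩
    exact hp.not_isInner hx
  · simp only [mem_union, mem_filter, mem_univ, true_and, not_or]
    refine ⟨fun h => h.1.ne rfl, ?_⟩
    rintro ⟨p, hp, -⟩
    exact hp.not_isInner hA.1.isInner

/-- Inner and deep keys are described by the cube. The shallow leaves at a core vertex are what
remains of its closed neighbourhood without the vertex itself and its inner neighbours, so the cube
determines their number, though not their identity. -/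
theorem keyCount_eq (hT : T.IsTree) (hS : S.IsTree) (hd : ∃ a b, 4 ≤ T.dist a b)
    (h : T.kthPower 3 = S.kthPower 3) (κ : CubeKey V) : T.keyCount κ = S.keyCount κ := by
  have hd' : ∃ a b, 4 ≤ S.dist a b := by
    rwa [← hS.kthPower_three_ne_top, ← h, hT.kthPower_three_ne_top]
  by_cases hκ : κ.IsInner
  · rw [keyCount_of_isInner hT hd hκ, keyCount_of_isInner hS hd' hκ, h]
  rcases κ with A | C | C | A
  · exact absurd trivial hκ
  · exact absurd trivial hκ
  · simp only [keyCount, CubeKey.isKey_deep_iff hT hd, CubeKey.isKey_deep_iff hS hd', h]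
  · by_cases hoc : (core A).Occurs (T.kthPower 3)
    · obtain ⟨u, hu⟩ := (CubeKey.exists_isKey_iff (κ := core A) hT hd trivial).2 hoc
      obtain ⟨v, hv⟩ := (CubeKey.exists_isKey_iff (κ := core A) hS hd' trivial).2 (h ▸ hoc)
      have h1 := card_eq_add_keyCount hT hd hu
      have h2 := card_eq_add_keyCount hS hd' hv
      rw [h] at h1
      omega
    · have key : ∀ {X : SimpleGraph V}, X.IsTree → (∃ a b, 4 ≤ X.dist a b) →
          ¬ (core A).Occurs (X.kthPower 3) → X.keyCount (shallow A) = 0 := by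
        intro X hX hXd hXo
        rw [keyCount, card_eq_zero, filter_eq_empty_iff]
        rintro x - ⟨p, hp, hpc, rfl⟩
        exact hXo ((CubeKey.exists_isKey_iff (κ := core _) hX hXd trivial).1 ⟨p, hpc, rfl⟩)
      rw [key hT hd hoc, key hS hd' (h ▸ hoc)]

/-- Trees with the same cube are isomorphic, unless this cube is complete. -/
theorem IsTree.nonempty_iso_of_kthPower_eq (hT : T.IsTree) (hS : S.IsTree)
    (hd : ∃ a b, 4 ≤ T.dist a b) (h : T.kthPower 3 = S.kthPower 3) : Nonempty (T ≃g S) := by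
  have hd' : ∃ a b, 4 ≤ S.dist a b := by
    rwa [← hS.kthPower_three_ne_top, ← h, hT.kthPower_three_ne_top]
  choose k hk using hT.exists_isKey hd
  choose l hl using hS.exists_isKey hd'
  have hcard : ∀ κ, Fintype.card {x // k x = κ} = Fintype.card {x // l x = κ} := by
    intro κ
    have h1 := keyCount_eq hT hS hd h κ
    have h2 : ∀ x, κ.IsKey T x ↔ k x = κ := fun x => ⟨fun h => (hk x).eq h, fun e => e ▸ hk x⟩
    have h3 : ∀ x, κ.IsKey S x ↔ l x = κ := fun x => ⟨fun h => (hl x).eq h, fun e => e ▸ hl x⟩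
    simp only [keyCount, h2, h3] at h1
    rw [Fintype.card_subtype, Fintype.card_subtype, h1]
  -- The bijection respects keys only and may exchange leaves with the same key, so it gives an
  -- isomorphism rather than equality of the trees.
  let e : V ≃ V := Equiv.ofFiberEquiv (f := k) (g := l) fun κ => Fintype.equivOfCardEq (hcard κ)
  have he : ∀ x, l (e x) = k x := fun x => Equiv.ofFiberEquiv_map _ x
  refine hT.nonempty_iso_of_injective hS e.injective rfl fun x y hxy => ?_
  have hex : (k x).IsKey S (e x) := he x ▸ hl (e x)
  have hey : (k y).IsKey S (e y) := he y ▸ hl (e y)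
  rcases (hk x).link_of_adj hT hd (hk y) hxy with hlk | hlk
  · exact hex.adj_of_link hS hd' hey (h ▸ hlk)
  · exact (hey.adj_of_link hS hd' hex (h ▸ hlk)).symm

end Count

end SimpleGraph

/-! ### Reconstruction of degrees and simplicial vertices -/

namespace SimpleGraph

open scoped Classical
open Finset

section Kelly

variable {V W : Type*} [Fintype V] [Fintype W] {G : SimpleGraph V} {H : SimpleGraph W}

/-- The number of neighbours of `v`. -/
noncomputable def nbrCount (G : SimpleGraph V) (v : V) : ℕ :=
  ∑ a, if G.Adj v a then 1 else 0

/-- The number of ordered pairs of adjacent vertices. -/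
noncomputable def pairCount (G : SimpleGraph V) : ℕ := ∑ v, G.nbrCount v

/-- The number of ordered pairs of adjacent neighbours of `v`. -/
noncomputable def triangleCountAt (G : SimpleGraph V) (v : V) : ℕ :=
  ∑ a, ∑ b, if G.Adj v a ∧ G.Adj v b ∧ G.Adj a b then 1 else 0

/-- The number of ordered triples of pairwise adjacent vertices. -/
noncomputable def triangleCount (G : SimpleGraph V) : ℕ := ∑ v, G.triangleCountAt v

theorem sum_compl_singleton (f : V → ℕ) (v : V) :
    ∑ a, f a = f v + ∑ a : ({v}ᶜ : Set V), f a := by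
  rw [← Finset.add_sum_erase _ _ (mem_univ v),
    Finset.sum_subtype (p := fun x => x ∈ ({v}ᶜ : Set V)) (univ.erase v) (by simp) f]

theorem pairCount_eq_add (G : SimpleGraph V) (v : V) :
    G.pairCount = (G.induce ({v}ᶜ : Set V)).pairCount + 2 * G.nbrCount v := by
  have h1 : G.nbrCount v = ∑ a : ({v}ᶜ : Set V), if G.Adj a v then 1 else 0 := by
    rw [nbrCount, sum_compl_singleton _ v]
    simp [G.adj_comm v]
  have h2 : ∀ a, G.nbrCount a = (if G.Adj a v then 1 else 0) +
      ∑ b : ({v}ᶜ : Set V), if G.Adj a b then 1 else 0 := fun a => sum_compl_singleton _ v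
  rw [pairCount, sum_compl_singleton _ v]
  simp only [h2 (Subtype.val _), sum_add_distrib]
  rw [← h1, pairCount]
  simp only [nbrCount, comap_adj, Function.Embedding.subtype_apply]
  omega

/-- In an ordered triangle through `v`, the vertex `v` can stand in any of three positions. -/
theorem triangleCount_eq_add (G : SimpleGraph V) (v : V) :
    G.triangleCount = (G.induce ({v}ᶜ : Set V)).triangleCount + 3 * G.triangleCountAt v := by
  have h0 : G.triangleCountAt v = ∑ a : ({v}ᶜ : Set V), ∑ b : ({v}ᶜ : Set V),
      if G.Adj v a ∧ G.Adj v b ∧ G.Adj a b then 1 else 0 := by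
    rw [triangleCountAt, sum_compl_singleton _ v]
    simp only [SimpleGraph.irrefl, false_and, if_false, sum_const_zero, zero_add]
    refine Finset.sum_congr rfl fun a _ => ?_
    rw [sum_compl_singleton _ v]
    simp
  have h1 : ∀ a : ({v}ᶜ : Set V), G.triangleCountAt a =
      (∑ b : ({v}ᶜ : Set V), if G.Adj v a ∧ G.Adj v b ∧ G.Adj a b then 1 else 0) +
      ((∑ b : ({v}ᶜ : Set V), if G.Adj v b ∧ G.Adj v a ∧ G.Adj b a then 1 else 0) +
      ∑ b : ({v}ᶜ : Set V), ∑ c : ({v}ᶜ : Set V),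
        if G.Adj a b ∧ G.Adj a c ∧ G.Adj b c then 1 else 0) := by
    intro a
    rw [triangleCountAt, sum_compl_singleton _ v]
    congr 1
    · rw [sum_compl_singleton _ v]
      simp only [SimpleGraph.irrefl, and_false, if_false, zero_add]
      refine Finset.sum_congr rfl fun b _ => if_congr ?_ rfl rfl
      rw [G.adj_comm a v]
      tauto
    · rw [← sum_add_distrib]
      refine Finset.sum_congr rfl fun b _ => ?_
      rw [sum_compl_singleton _ v]
      congr 1
      refine if_congr ?_ rfl rfl
      rw [G.adj_comm a v, G.adj_comm b v, G.adj_comm b a]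
      tauto
  rw [triangleCount, sum_compl_singleton _ v]
  simp only [h1, sum_add_distrib]
  rw [sum_comm (f := fun a b : ({v}ᶜ : Set V) =>
    if G.Adj v b ∧ G.Adj v a ∧ G.Adj b a then 1 else 0), ← h0, triangleCount]
  simp only [triangleCountAt, comap_adj, Function.Embedding.subtype_apply]
  simp only [triangleCountAt] at h0
  omega

theorem pairCount_iso (e : G ≃g H) : G.pairCount = H.pairCount :=
  Fintype.sum_equiv e.toEquiv _ _ fun a => Fintype.sum_equiv e.toEquiv _ _ fun b =>
    if_congr (e.map_adj_iff (v := a) (w := b)).symm rfl rfl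

theorem triangleCount_iso (e : G ≃g H) : G.triangleCount = H.triangleCount :=
  Fintype.sum_equiv e.toEquiv _ _ fun a => Fintype.sum_equiv e.toEquiv _ _ fun b =>
    Fintype.sum_equiv e.toEquiv _ _ fun c => if_congr
      (and_congr (e.map_adj_iff (v := a) (w := b)).symm
        (and_congr (e.map_adj_iff (v := a) (w := c)).symm
          (e.map_adj_iff (v := b) (w := c)).symm)) rfl rfl

/-- Kelly's argument: summation over `v` expresses `Fintype.card V - k` times the total by the
numbers `r v`. This determines the total, and then each single value. -/
theorem eq_of_sum_eq_of_eq_add {k : ℕ} (hk0 : 0 < k) (hk : k < Fintype.card V) (φ : V ≃ W)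
    {f : V → ℕ} {g : W → ℕ} {r : V → ℕ} (hf : ∀ v, ∑ a, f a = r v + k * f v)
    (hg : ∀ v, ∑ b, g b = r v + k * g (φ v)) (v : V) : f v = g (φ v) := by
  have h1 : Fintype.card V * ∑ a, f a = ∑ v, r v + k * ∑ v, f v := by
    rw [mul_sum _ _ k, ← sum_add_distrib, ← Finset.sum_congr rfl fun v _ => hf v]
    simp
  have h2 : Fintype.card V * ∑ b, g b = ∑ v, r v + k * ∑ b, g b := by
    conv_rhs => rw [← Equiv.sum_comp φ g]
    rw [mul_sum _ _ k, ← sum_add_distrib, ← Finset.sum_congr rfl fun v _ => hg v]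
    simp
  obtain ⟨m, hm⟩ := Nat.exists_eq_add_of_lt hk
  rw [hm] at h1 h2
  have h3 : (m + 1) * ∑ a, f a = (m + 1) * ∑ b, g b := by nlinarith
  have h4 := Nat.eq_of_mul_eq_mul_left (Nat.succ_pos m) h3
  have h5 := hf v
  have h6 := hg v
  exact Nat.eq_of_mul_eq_mul_left hk0 (by omega)

/-- The right side is the number of ordered pairs of distinct neighbours; equality means that all of
them are adjacent. -/
theorem isSimplicialVertex_iff_triangleCountAt {v : V} : G.IsSimplicialVertex v ↔
    G.triangleCountAt v = G.nbrCount v * G.nbrCount v - G.nbrCount v := by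
  have h1 : G.nbrCount v = (univ.filter (G.Adj v)).card := by rw [nbrCount, card_filter]
  have h2 : G.triangleCountAt v = (univ.filter fun p : V × V =>
      G.Adj v p.1 ∧ G.Adj v p.2 ∧ G.Adj p.1 p.2).card := by
    rw [triangleCountAt, card_filter, Fintype.sum_prod_type]
  rw [h1, h2, ← offDiag_card]
  have hsub : (univ.filter fun p : V × V => G.Adj v p.1 ∧ G.Adj v p.2 ∧ G.Adj p.1 p.2) ⊆
      (univ.filter (G.Adj v)).offDiag := by
    intro p hp
    simp only [mem_filter, mem_univ, true_and, mem_offDiag] at hp ⊢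
    exact ⟨hp.1, hp.2.1, hp.2.2.ne⟩
  constructor
  · intro h
    congr 1
    refine hsub.antisymm fun p hp => ?_
    simp only [mem_filter, mem_univ, true_and, mem_offDiag] at hp ⊢
    exact ⟨hp.1, hp.2.1, h _ _ hp.1 hp.2.1 hp.2.2⟩
  · intro h a b ha hb hab
    have h3 := eq_of_subset_of_card_le hsub h.ge
    have h4 : (a, b) ∈ (univ.filter (G.Adj v)).offDiag := by
      simp only [mem_filter, mem_univ, true_and, mem_offDiag]
      exact ⟨ha, hb, hab⟩
    rw [← h3, mem_filter] at h4
    exact h4.2.2.2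

theorem nbrCount_eq_of_induce_iso (hV : 2 < Fintype.card V) (φ : V ≃ W)
    (h : ∀ v, Nonempty (G.induce ({v}ᶜ : Set V) ≃g H.induce ({φ v}ᶜ : Set W))) (v : V) :
    G.nbrCount v = H.nbrCount (φ v) :=
  eq_of_sum_eq_of_eq_add (by omega) hV φ (fun v => G.pairCount_eq_add v) (fun v => by
    rw [pairCount_iso (h v).some]
    exact H.pairCount_eq_add (φ v)) v

theorem isSimplicialVertex_iff_of_induce_iso (hV : 3 < Fintype.card V) (φ : V ≃ W)
    (h : ∀ v, Nonempty (G.induce ({v}ᶜ : Set V) ≃g H.induce ({φ v}ᶜ : Set W))) (v : V) :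
    G.IsSimplicialVertex v ↔ H.IsSimplicialVertex (φ v) := by
  rw [isSimplicialVertex_iff_triangleCountAt, isSimplicialVertex_iff_triangleCountAt,
    nbrCount_eq_of_induce_iso (by omega) φ h v,
    eq_of_sum_eq_of_eq_add (by omega) hV φ (fun v => G.triangleCount_eq_add v) (fun v => by
      rw [triangleCount_iso (h v).some]
      exact H.triangleCount_eq_add (φ v)) v]

theorem exists_equiv_of_card_fiber_eq {K : Type*} {f : V → K} {g : W → K}
    (h : ∀ κ, (univ.filter fun x => f x = κ).card = (univ.filter fun x => g x = κ).card) :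
    ∃ e : V ≃ W, ∀ x, g (e x) = f x := by
  have hcard : ∀ κ, Fintype.card {x // f x = κ} = Fintype.card {x // g x = κ} := fun κ => by
    rw [Fintype.card_subtype, Fintype.card_subtype, h]
  exact ⟨Equiv.ofFiberEquiv (f := f) (g := g) fun κ => Fintype.equivOfCardEq (hcard κ),
    fun x => Equiv.ofFiberEquiv_map _ x⟩

omit [Fintype V] in
theorem not_eq_and_adj_iff {x a : V} : (¬ a = x ∧ G.Adj x a) ↔ G.Adj x a :=
  ⟨fun h => h.2, fun h => ⟨h.ne', h⟩⟩

omit [Fintype V] in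
theorem eq_and_not_adj_iff {x a : V} : (a = x ∧ ¬ G.Adj x a) ↔ a = x :=
  ⟨fun h => h.1, fun h => ⟨h, h ▸ G.irrefl⟩⟩

omit [Fintype V] in
theorem eq_and_adj_iff {x a : V} : (a = x ∧ G.Adj x a) ↔ False :=
  ⟨fun h => h.2.ne h.1.symm, False.elim⟩

/-- A graph with a complete vertex-deleted subgraph is determined by its order and the degree of
the deleted vertex. -/
theorem nonempty_iso_of_induce_eq_top {x : V} {y : W} (hG : G.induce ({x}ᶜ : Set V) = ⊤)
    (hH : H.induce ({y}ᶜ : Set W) = ⊤) (hc : Fintype.card V = Fintype.card W)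
    (hd : G.nbrCount x = H.nbrCount y) : Nonempty (G ≃g H) := by
  have hG' : ∀ a b, a ≠ x → b ≠ x → (G.Adj a b ↔ a ≠ b) := by
    intro a b ha hb
    have : (G.induce ({x}ᶜ : Set V)).Adj ⟨a, ha⟩ ⟨b, hb⟩ ↔ a ≠ b := by
      rw [hG, top_adj, ne_eq, ne_eq, Subtype.ext_iff]
    exact this
  have hH' : ∀ a b, a ≠ y → b ≠ y → (H.Adj a b ↔ a ≠ b) := by
    intro a b ha hb
    have : (H.induce ({y}ᶜ : Set W)).Adj ⟨a, ha⟩ ⟨b, hb⟩ ↔ a ≠ b := by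
      rw [hH, top_adj, ne_eq, ne_eq, Subtype.ext_iff]
    exact this
  have h1 : (univ.filter (G.Adj x)).card = (univ.filter (H.Adj y)).card := by
    rw [card_filter, card_filter]; exact hd
  have h2 : (univ.filter fun a => ¬ (a = x ∨ G.Adj x a)).card =
      (univ.filter fun a => ¬ (a = y ∨ H.Adj y a)).card := by
    have hx : (univ.filter fun a => a = x ∨ G.Adj x a) = insert x (univ.filter (G.Adj x)) := by
      ext a; simp
    have hy : (univ.filter fun a => a = y ∨ H.Adj y a) = insert y (univ.filter (H.Adj y)) := by
      ext a; simp
    have h3 := card_filter_add_card_filter_not (s := univ) fun a => a = x ∨ G.Adj x a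
    have h4 := card_filter_add_card_filter_not (s := univ) fun a => a = y ∨ H.Adj y a
    rw [hx, card_insert_of_notMem (by simp), h1, card_univ, hc] at h3
    rw [hy, card_insert_of_notMem (by simp), card_univ] at h4
    omega
  -- All adjacencies depend only on whether a vertex equals the deleted one, is adjacent to it, or
  -- neither, and these classes have equal sizes on both sides.
  obtain ⟨e, he⟩ := exists_equiv_of_card_fiber_eq
    (f := fun a => (decide (a = x), decide (G.Adj x a)))
    (g := fun a => (decide (a = y), decide (H.Adj y a))) (by
      rintro ⟨_ | _, _ | _⟩ <;>
        simp only [Prod.mk.injEq, decide_eq_true_eq, decide_eq_false_iff_not]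
      · simpa only [not_or] using h2
      · simpa only [not_eq_and_adj_iff] using h1
      · simp only [eq_and_not_adj_iff]
        rw [card_eq_one.2 ⟨x, by ext; simp⟩, card_eq_one.2 ⟨y, by ext; simp⟩]
      · simp only [eq_and_adj_iff, filter_false, card_empty])
  simp only [Prod.mk.injEq, decide_eq_decide] at he
  refine ⟨⟨e, fun {a b} => ?_⟩⟩
  by_cases ha : a = x
  · rw [(he a).1.2 ha, ha]; exact (he b).2
  · by_cases hb : b = x
    · rw [(he b).1.2 hb, hb, H.adj_comm, G.adj_comm]; exact (he a).2
    · rw [hG' a b ha hb, hH' _ _ (fun h => ha ((he a).1.1 h)) (fun h => hb ((he b).1.1 h)),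
        e.injective.ne_iff]

end Kelly

end SimpleGraph

/-! ### Weak reconstructibility of cubes of trees -/

namespace SimpleGraph

open scoped Classical
open Finset

section Final

variable {V W U : Type u} {T : SimpleGraph V} {S : SimpleGraph W} {G : SimpleGraph V}
  {H : SimpleGraph W}

theorem dist_le_dist_iso (e : T ≃g S) (hT : T.Connected) (a b : V) :
    S.dist (e a) (e b) ≤ T.dist a b := by
  obtain ⟨p, hp⟩ := hT.exists_walk_length_eq_dist a b
  rw [← hp, ← Walk.length_map e.toHom p]
  exact dist_le _

theorem IsTree.kthPower_comap (hS : S.IsTree) (e : V ≃ W) (k : ℕ) :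
    (S.comap e).kthPower k = (S.kthPower k).comap e := by
  let e' : S.comap e ≃g S := Iso.comap e S
  have hT : (S.comap e).IsTree := e'.isTree_iff.2 hS
  ext a b
  have h1 : S.dist (e a) (e b) ≤ (S.comap e).dist a b := dist_le_dist_iso e' hT.connected a b
  have h2 := dist_le_dist_iso e'.symm hS.connected (e' a) (e' b)
  rw [RelIso.symm_apply_apply, RelIso.symm_apply_apply] at h2
  have h3 : S.dist (e a) (e b) = (S.comap e).dist a b := le_antisymm h1 h2
  rw [hT.kthPower_adj, comap_adj, hS.kthPower_adj, h3, e.injective.ne_iff]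

theorem IsTree.nonempty_iso_of_kthPower_iso [Fintype V] (hT : T.IsTree) (hS : S.IsTree)
    (hd : ∃ a b, 4 ≤ T.dist a b) (e : T.kthPower 3 ≃g S.kthPower 3) : Nonempty (T ≃g S) := by
  let e' : S.comap e.toEquiv ≃g S := Iso.comap e.toEquiv S
  obtain ⟨e₁⟩ := hT.nonempty_iso_of_kthPower_eq (e'.isTree_iff.2 hS) hd (by
    rw [hS.kthPower_comap e.toEquiv]
    ext a b
    exact e.map_adj_iff.symm)
  exact ⟨e₁.trans e'⟩

theorem IsTreeCube.exists_eq (h : G.IsTreeCube) :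
    ∃ T : SimpleGraph V, T.IsTree ∧ G = T.kthPower 3 := by
  obtain ⟨U, T, hT, ⟨e⟩⟩ := h
  refine ⟨T.comap e.toEquiv, (Iso.comap e.toEquiv T).isTree_iff.2 hT, ?_⟩
  rw [hT.kthPower_comap e.toEquiv]
  ext a b
  exact e.map_adj_iff.symm

theorem exists_equiv_of_deck_eq [Fintype V] [Fintype W] (h : G.deck = H.deck) :
    ∃ φ : V ≃ W, ∀ v, Nonempty (G.induce ({v}ᶜ : Set V) ≃g H.induce ({φ v}ᶜ : Set W)) := by
  obtain ⟨e, he⟩ := exists_equiv_of_card_fiber_eq (f := G.card) (g := H.card) fun κ => by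
    have h1 := congrArg (Multiset.count κ) h
    simp only [deck, Multiset.count_map] at h1
    simp only [eq_comm (b := κ)]
    exact h1
  exact ⟨e, fun v => Quotient.exact (he v).symm⟩

theorem IsTree.five_le_card [Fintype V] (hT : T.IsTree) (hd : ∃ a b, 4 ≤ T.dist a b) :
    5 ≤ Fintype.card V := by
  obtain ⟨a, b, hab⟩ := hd
  obtain ⟨p, hp⟩ := hT.connected.exists_walk_length_eq_dist a b
  have := (Walk.isPath_of_length_eq_dist p hp).length_lt
  omega

theorem nonempty_iso_of_eq_top [Fintype V] [Fintype W] (hG : G = ⊤) (hH : H = ⊤)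
    (h : Fintype.card V = Fintype.card W) : Nonempty (G ≃g H) := by
  subst hG hH
  exact ⟨Iso.completeGraph (Fintype.equivOfCardEq h)⟩

theorem induce_eq_top_iff_of_iso {s : Set V} {t : Set W} (e : G.induce s ≃g H.induce t) :
    G.induce s = ⊤ ↔ H.induce t = ⊤ := by
  rw [eq_top_iff_forall_ne_adj, eq_top_iff_forall_ne_adj]
  constructor
  · intro h a b hab
    rw [← e.apply_symm_apply a, ← e.apply_symm_apply b, e.map_adj_iff]
    exact h _ _ (e.symm.injective.ne hab)
  · intro h a b hab
    rw [← e.map_adj_iff]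
    exact h _ _ (e.injective.ne hab)

end Final

end SimpleGraph

theorem lemma4p1 :
    SimpleGraph.IsWeaklyReconstructible.{u} (fun _ G => SimpleGraph.IsTreeCube G) := by
  classical
  intro V W _ _ G H hG hH hdeck
  obtain ⟨T, hT, rfl⟩ := SimpleGraph.IsTreeCube.exists_eq hG
  obtain ⟨S, hS, rfl⟩ := SimpleGraph.IsTreeCube.exists_eq hH
  obtain ⟨φ, hφ⟩ := SimpleGraph.exists_equiv_of_deck_eq hdeck
  have hcard := Fintype.card_congr φ
  -- With fewer than five vertices no distance reaches four, so both cubes are complete.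
  rcases Nat.lt_or_ge (Fintype.card V) 5 with h5 | h5
  · refine SimpleGraph.nonempty_iso_of_eq_top ?_ ?_ hcard
    · by_contra h
      have := hT.five_le_card (hT.kthPower_three_ne_top.1 h)
      omega
    · by_contra h
      have := hS.five_le_card (hS.kthPower_three_ne_top.1 h)
      omega
  -- Uniqueness of the root fails for complete cards, so these are treated through the degree of the
  -- deleted vertex.
  by_cases htop : ∃ x, (T.kthPower 3).induce ({x}ᶜ : Set V) = ⊤
  · obtain ⟨x, hx⟩ := htop
    exact SimpleGraph.nonempty_iso_of_induce_eq_top hx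
      ((SimpleGraph.induce_eq_top_iff_of_iso (hφ x).some).1 hx) hcard
      (SimpleGraph.nbrCount_eq_of_induce_iso (by omega) φ hφ x)
  push Not at htop
  have hdT : ∃ a b, 4 ≤ T.dist a b := by
    rw [← hT.kthPower_three_ne_top]
    intro h
    obtain ⟨x⟩ := hT.connected.nonempty
    exact htop x (by rw [h, SimpleGraph.induce_top])
  have hdS : ∃ a b, 4 ≤ S.dist a b := by
    rw [← hS.kthPower_three_ne_top]
    intro h
    obtain ⟨x⟩ := hT.connected.nonempty
    exact htop x ((SimpleGraph.induce_eq_top_iff_of_iso (hφ x).some).2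
      (by rw [h, SimpleGraph.induce_top]))
  have hdeep : ∀ x, T.IsDeepLeaf x ↔ S.IsDeepLeaf (φ x) := fun x => by
    rw [← hT.isSimplicialVertex_iff hdT, ← hS.isSimplicialVertex_iff hdS,
      SimpleGraph.isSimplicialVertex_iff_of_induce_iso (by omega) φ hφ]
  -- At a deep leaf both cards are cubes of trees and not complete, so the trees without the leaf
  -- are isomorphic.
  obtain ⟨e⟩ := SimpleGraph.nonempty_iso_of_induce_iso hT hS hdT hdS φ hdeep fun x hx => by
    obtain ⟨q, hq, -⟩ := (hdeep x).1 hx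
    obtain ⟨p, hp, -⟩ := hx
    have h := hφ x
    rw [← hp.kthPower_induce hT, ← hq.kthPower_induce hS] at h
    exact (hp.isTree_induce hT).nonempty_iso_of_kthPower_iso (hq.isTree_induce hS)
      ((hp.isTree_induce hT).kthPower_three_ne_top.1
        (by rw [hp.kthPower_induce hT]; exact htop x)) h.some
  have h := hS.kthPower_comap e.toEquiv 3
  have h' : S.comap e.toEquiv = T := by
    ext a b
    exact e.map_adj_iff
  rw [h'] at h
  rw [h]
  exact ⟨SimpleGraph.Iso.comap e.toEquiv (S.kthPower 3)⟩
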